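/- **Setting.** Let $N\ge 3$ be odd, $P=(N-1)/2$, $\omega=e^{2i\pi/N}$, and let $1/2$ (also in exponents of $\omega$) denote the inverse of $2$ modulo $N$. Indices $\alpha,\beta,i,j,\dots$ run over $\mathbb Z/N$, and $\delta(n)=1$ if $n\equiv 0$ mod $N$, $\delta(n)=0$ otherwise. Let $\mathcal W_N$ be the $\mathbb C$-algebra generated by $E^{\pm1},D$ with $ED=\omega DE$ and coproduct $\Delta(E)=E\otimes E$, $\Delta(D)=E\otimes D+D\otimes 1$. Let $Z_{ij}=\omega^i\delta(i-j)$, $X_{ij}=\delta(i-j-1)$, $Y=\omega^{1/2}XZ$. A representation is cyclic if $E$ and $D$ act invertibly. A standard representation $\rho$ on $V_\rho=\mathbb C^N$ is $\rho(E)=a_\rho^2Z$, $\rho(D)=a_\rho y_\rho X$ with $a_\rho,y_\rho\in\mathbb C^*$. A triple $(\rho,\mu,\nu)$ of standard representations is regular if $\rho\otimes\mu$, $\mu\otimes\nu$, $\rho\otimes\mu\otimes\nu$ are cyclic. A product $\rho\mu$ is a standard representation with $a_{\rho\mu}=a_\rho a_\mu$ and $y_{\rho\mu}$ an $N$-th root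 of $a_\rho^Ny_\mu^N+y_\rho^N/a_\mu^N$; fix products $\rho\mu$, $\mu\nu$ and $\rho\mu\nu=(\rho\mu)\nu$ (which is then also a product of $\rho$ and $\mu\nu$). For $x^N+y^N=z^N$ put $\omega(x,y,z|n)=\prod_{j=1}^n\frac{y}{z-x\omega^j}$ ($N$-periodic in $n$) and $\omega(x,y,z|m,n)=\omega(x,y,z|m-n)\,\omega^{n^2/2}$; put $[x]=N^{-1}\frac{1-x^N}{1-x}$. Let $g:\mathbb C\to\mathbb C$ be any determination of $\prod_{j=1}^{N-1}(1-x\omega^j)^{j/N}$ (i.e. $g(x)^N=\prod_j(1-x\omega^j)^j$ for every $x$), $h(x)=x^{-P}g(x)/g(1)$, and $$h_{\rho,\mu}=h\Big(\frac{y_{\rho\mu}}{a_\rho y_\mu}\Big),\qquad h_{\rho,\mu,\nu}=h\Big(\frac{y_{\rho\mu}y_{\mu\nu}}{y_{\rho\mu\nu}y_\mu}\Big).$$ The standard Clebsch–Gordan operators $K_\alpha(\rho,\mu):V_{\rho\mu}\to V_\rho\otimes V_\mu$ are $$K_\alpha(\rho,\mu)_{i,j}^k=h_{\rho,\mu}\,\omega^{\alpha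 j}\,\omega\big(a_\rho y_\mu,\tfrac{y_\rho}{a_\mu},y_{\rho\mu}\,\big|\,i,\alpha\big)\,\delta(i+j-k).$$ **Proposition.** Let $(\rho,\mu,\nu)$ be a regular triple of standard representations, with products as above. (0) For each of the pairs $(\rho,\mu)$, $(\rho\mu,\nu)$, $(\mu,\nu)$, $(\rho,\mu\nu)$ the standard Clebsch–Gordan operators form a basis of the space of $\mathcal W_N$-morphisms from the product into the tensor product. The composites $K_\alpha(\rho,\mu)K_\beta(\rho\mu,\nu)$, and the composites $K_\delta(\mu,\nu)K_\gamma(\rho,\mu\nu)$, are bases of $\mathrm{Hom}_{\mathcal W_N}(V_{\rho\mu\nu},(V_\rho\otimes V_\mu)\otimes V_\nu)$ and of $\mathrm{Hom}_{\mathcal W_N}(V_{\rho\mu\nu},V_\rho\otimes(V_\mu\otimes V_\nu))$ respectively. The $6j$-symbol is the matrix $R(\rho,\mu,\nu)$ defined, through the associativity isomorphism, by $$K_\alpha(\rho,\mu)K_\beta(\rho\mu,\nu)=\sum_{\gamma,\delta}R(\rho,\mu,\nu)_{\alpha,\beta}^{\gamma,\delta}\,K_\delta(\mu,\nu)K_\gamma(\rho,\mu\nu).$$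 (1) There is an $N$-th root of unity $\zeta$ such that, with $h'_{\rho,\mu,\nu}=\zeta\,h_{\rho,\mu,\nu}$, the $6j$-symbol and its inverse $\bar R=R^{-1}$ have exactly the entries $$R(\rho,\mu,\nu)_{\alpha,\beta}^{\gamma,\delta}=h'_{\rho,\mu,\nu}\,\omega^{\alpha\delta}\,\omega(y_{\rho\mu\nu}y_\mu,\,y_\rho y_\nu,\,y_{\rho\mu}y_{\mu\nu}\,|\,\gamma,\alpha)\,\delta(\gamma+\delta-\beta),$$ $$\bar R(\rho,\mu,\nu)_{\gamma,\delta}^{\alpha,\beta}=\frac{\big[\frac{y_{\rho\mu\nu}y_\mu}{y_{\rho\mu}y_{\mu\nu}}\big]}{h'_{\rho,\mu,\nu}}\;\omega^{-\alpha\delta}\,\frac{\delta(\gamma+\delta-\beta)}{\omega\big(\frac{y_{\rho\mu\nu}y_\mu}{\omega},\,y_\rho y_\nu,\,y_{\rho\mu}y_{\mu\nu}\,\big|\,\gamma,\alpha\big)}.$$ (2) Suppose that $g$ is the principal determination (principal powers of each factor), let $r(x)=(1-x^N)^{1/N}$ be the principal determination, and suppose that the five arguments $t$ of $h$ occurring here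 lie off the cuts, i.e. $t^N\notin[1,\infty)$. Let $e_1,e_2,e_3,e_4,f\in\mathbb Z/N$ be given by $$-\tfrac{y_\rho}{a_\rho a_\mu y_\mu}=\omega^{e_1}r\big(\tfrac{y_{\rho\mu}}{a_\rho y_\mu}\big),\quad -\tfrac{y_{\rho\mu}}{a_{\rho\mu}a_\nu y_\nu}=\omega^{e_2}r\big(\tfrac{y_{\rho\mu\nu}}{a_{\rho\mu}y_\nu}\big),\quad -\tfrac{y_\mu}{a_\mu a_\nu y_\nu}=\omega^{e_3}r\big(\tfrac{y_{\mu\nu}}{a_\mu y_\nu}\big),$$ $$-\tfrac{y_\rho}{a_\rho a_{\mu\nu}y_{\mu\nu}}=\omega^{e_4}r\big(\tfrac{y_{\rho\mu\nu}}{a_\rho y_{\mu\nu}}\big),\quad -\tfrac{y_\rho y_\nu}{y_{\rho\mu\nu}y_\mu}=\omega^{f}r\big(\tfrac{y_{\rho\mu}y_{\mu\nu}}{y_{\rho\mu\nu}y_\mu}\big).$$ Then $\zeta=\omega^{\frac18+(e_1-f)(e_2-e_3)-\frac12(e_4-e_3-f)^2}$, where $\frac18$ and $\frac12$ are inverses modulo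 $N$. (So $\zeta=1$ for instance when $e_1=e_2=e_3=e_4$ and $f=\pm\frac12$.) (3) $R(\rho,\mu,\nu)$ is a cyclic representation of the twisted dilogarithm operator $R_\omega=\Upsilon_\omega\Psi_\omega$. Precisely, let $\mathcal H$ be the Heisenberg double specialized at $q=\omega^{-1}$, i.e. the algebra generated by $E^{\pm1},\bar E^{\pm1},D,\bar D$ with $DE=qED$, $\bar D\bar E=q\bar E\bar D$, $E\bar E=q\bar EE$, $D\bar E=\bar ED$, $E\bar D=q\bar DE$, $D\bar D-\bar DD=(1-q)E$, together with $D\bar D=q\bar DD$. For $a,y\in\mathbb C^*$ its normal representation is $E\mapsto a^{-2}Z^{-1}$, $D\mapsto-\frac yaY^{-1}$, $\bar E\mapsto a^{-2}Y$, $\bar D\mapsto\frac1{ay}Z^{-1}Y$. For normal representations $\pi,\pi^*$ with parameters $(a_\pi,y_\pi)$, $(a_{\pi^*},y_{\pi^*})$ and a product with $y_{\pi\pi^*}\neq0$, and for a normalization $\kappa\in\mathbb C^*$, the image of $R_\omega$ is $\Upsilon\cdot\Psi$, with $$\Upsilon=\frac1N\sum_{i,j=0}^{N-1}\omega^{ij}\,(a_\pi^2\pi(E))^i\otimes(a_{\pi^*}^2\pi^*(\bar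 E))^j,\qquad \Psi=\kappa\sum_{t=0}^{N-1}\big(\pi(D)\otimes\pi^*(\bar D)\big)^t\prod_{s=1}^t\frac1{1-\omega^{-s}b},\qquad b=\frac{y_{\pi\pi^*}}{a_\pi y_{\pi^*}} .$$ Here all generators act invertibly and $(\pi(D)\otimes\pi^*(\bar D))^N=1-b^N$. Then there are such $\pi,\pi^*$ (with a product) for which $R(\rho,\mu,\nu)=\Upsilon\cdot\Psi$ with $\kappa=\zeta\,h(b)$, $\zeta$ as in (1). -/

import Mathlib

open scoped Kronecker TensorProduct

namespace CyclicSixJ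

noncomputable section

/-! ### Roots of unity and elementary functions -/

/-- The primitive root of unity `ω = exp (2 i π / N)`. -/
def root (N : ℕ) : ℂ := Complex.exp (2 * Real.pi * Complex.I / N)

/-- `ω ^ k` for an exponent `k` modulo `N`. -/
def wpow (N : ℕ) (k : ZMod N) : ℂ := root N ^ k.val

/-- The class `1/2 = (N + 1)/2` modulo `N` (`N` odd), so that `ω ^ (1/2) = ω ^ ((N+1)/2)`. -/
def half (N : ℕ) : ZMod N := (((N + 1) / 2 : ℕ) : ZMod N)

/-- `ω(x,y,z|n) = ∏_{j=1}^n y / (z - x ω^j)`, for `n` modulo `N`; for `x^N + y^N = z^N` the product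
is `N`-periodic in `n`, so we evaluate it at the representative `0 ≤ n < N`. -/
def cdil (N : ℕ) (x y z : ℂ) (n : ZMod N) : ℂ :=
  ∏ j ∈ Finset.range n.val, y / (z - x * root N ^ (j + 1))

/-- `ω(x,y,z|m,n) = ω(x,y,z|m-n) ω^{n²/2}`. -/
def cdil₂ (N : ℕ) (x y z : ℂ) (m n : ZMod N) : ℂ :=
  cdil N x y z (m - n) * wpow N (half N * n ^ 2)

/-- `[x] = N⁻¹ (1 - x^N) / (1 - x)`. -/
def bracket (N : ℕ) (x : ℂ) : ℂ := (N : ℂ)⁻¹ * ((1 - x ^ N) / (1 - x))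

/-- `g` is a determination of the `N`-valued function `∏_{j=1}^{N-1} (1 - x ω^j)^{j/N}`
(an arbitrary choice of the `N`-th root at every point; no continuity is asked). -/
def IsDetermination (N : ℕ) (g : ℂ → ℂ) : Prop :=
  ∀ x : ℂ, g x ^ N = ∏ j ∈ Finset.range N, (1 - x * root N ^ j) ^ j

/-- The principal determination of `g`. It is analytic on the plane cut along the rays
`|x| ≥ 1`, `arg x ∈ (2π/N) ℤ`, and there it continues the power series of `g` at `0`. -/
def gPrincipal (N : ℕ) (x : ℂ) : ℂ :=
  ∏ j ∈ Finset.range N, (1 - x * root N ^ j) ^ ((j : ℂ) / (N : ℂ))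

/-- The principal determination of `r(x) = (1 - x^N)^{1/N}`, analytic on the same cut plane. -/
def rPrincipal (N : ℕ) (x : ℂ) : ℂ := (1 - x ^ N) ^ ((1 : ℂ) / (N : ℂ))

/-- `x` lies off the cuts `|x| ≥ 1`, `arg x ∈ (2π/N) ℤ`, i.e. `x^N ∉ [1, ∞)`. -/
def OffCuts (N : ℕ) (x : ℂ) : Prop := 1 - x ^ N ∈ Complex.slitPlane

/-- `h(x) = x^{-P} g(x) / g(1)` with `P = (N-1)/2`. -/
def hFun (N : ℕ) (g : ℂ → ℂ) (x : ℂ) : ℂ := (x ^ ((N - 1) / 2))⁻¹ * (g x / g 1)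

/-! ### The Weyl algebra `W_N`, its coproduct and its representations -/

inductive WeylGen
  | E | Einv | D

/-- The relations `E E⁻¹ = E⁻¹ E = 1`, `E D = ω D E`. -/
inductive WeylRel (N : ℕ) : FreeAlgebra ℂ WeylGen → FreeAlgebra ℂ WeylGen → Prop
  | mul_inv : WeylRel N (FreeAlgebra.ι ℂ WeylGen.E * FreeAlgebra.ι ℂ WeylGen.Einv) 1
  | inv_mul : WeylRel N (FreeAlgebra.ι ℂ WeylGen.Einv * FreeAlgebra.ι ℂ WeylGen.E) 1
  | comm : WeylRel N (FreeAlgebra.ι ℂ WeylGen.E * FreeAlgebra.ι ℂ WeylGen.D)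
      (root N • (FreeAlgebra.ι ℂ WeylGen.D * FreeAlgebra.ι ℂ WeylGen.E))

/-- The Weyl algebra `W_N`. -/
abbrev Weyl (N : ℕ) : Type := RingQuot (WeylRel N)

/-- The class of a generator in `W_N`. -/
def Weyl.gen (N : ℕ) (x : WeylGen) : Weyl N :=
  RingQuot.mkAlgHom ℂ (WeylRel N) (FreeAlgebra.ι ℂ x)

theorem Weyl.gen_mul_inv (N : ℕ) : Weyl.gen N .E * Weyl.gen N .Einv = 1 := by
  have := RingQuot.mkAlgHom_rel ℂ (WeylRel.mul_inv (N := N))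
  simpa [Weyl.gen] using this

theorem Weyl.gen_inv_mul (N : ℕ) : Weyl.gen N .Einv * Weyl.gen N .E = 1 := by
  have := RingQuot.mkAlgHom_rel ℂ (WeylRel.inv_mul (N := N))
  simpa [Weyl.gen] using this

theorem Weyl.gen_comm (N : ℕ) :
    Weyl.gen N .E * Weyl.gen N .D = root N • (Weyl.gen N .D * Weyl.gen N .E) := by
  have := RingQuot.mkAlgHom_rel ℂ (WeylRel.comm (N := N))
  simpa [Weyl.gen] using this

/-- The universal property of `W_N`. -/
def Weyl.lift {N : ℕ} {A : Type*} [Ring A] [Algebra ℂ A] (e einv d : A)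
    (h₁ : e * einv = 1) (h₂ : einv * e = 1) (h₃ : e * d = root N • (d * e)) :
    Weyl N →ₐ[ℂ] A :=
  RingQuot.liftAlgHom ℂ ⟨FreeAlgebra.lift ℂ (fun x : WeylGen => match x with
    | .E => e
    | .Einv => einv
    | .D => d), by
      intro x y h
      cases h with
      | mul_inv => simpa using h₁
      | inv_mul => simpa using h₂
      | comm => simpa using h₃⟩

/-- The coproduct `Δ(E) = E ⊗ E`, `Δ(D) = E ⊗ D + D ⊗ 1`. -/
def Weyl.comul (N : ℕ) : Weyl N →ₐ[ℂ] Weyl N ⊗[ℂ] Weyl N :=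
  Weyl.lift (Weyl.gen N .E ⊗ₜ[ℂ] Weyl.gen N .E) (Weyl.gen N .Einv ⊗ₜ[ℂ] Weyl.gen N .Einv)
    (Weyl.gen N .E ⊗ₜ[ℂ] Weyl.gen N .D + Weyl.gen N .D ⊗ₜ[ℂ] 1)
    (by simp [Weyl.gen_mul_inv, Algebra.TensorProduct.one_def])
    (by simp [Weyl.gen_inv_mul, Algebra.TensorProduct.one_def])
    (by
      simp only [mul_add, add_mul, Algebra.TensorProduct.tmul_mul_tmul, Weyl.gen_comm, mul_one,
        one_mul, smul_add, TensorProduct.tmul_smul, TensorProduct.smul_tmul'])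

/-- The tensor product `a ↦ (π₁ ⊗ π₂)(Δ(a))` of two matrix representations of `W_N`, on the
Kronecker product of the two underlying spaces. -/
def tensorRep {N : ℕ} {m n : Type} [Fintype m] [DecidableEq m] [Fintype n] [DecidableEq n]
    (π₁ : Weyl N →ₐ[ℂ] Matrix m m ℂ) (π₂ : Weyl N →ₐ[ℂ] Matrix n n ℂ) :
    Weyl N →ₐ[ℂ] Matrix (m × n) (m × n) ℂ :=
  ((Matrix.kroneckerAlgEquiv m n ℂ : _ →ₐ[ℂ] _).comp (Algebra.TensorProduct.map π₁ π₂)).comp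
    (Weyl.comul N)

/-- A representation of `W_N` is cyclic when `E` and `D` act invertibly. -/
def IsCyclic {N : ℕ} {m : Type} [Fintype m] [DecidableEq m]
    (π : Weyl N →ₐ[ℂ] Matrix m m ℂ) : Prop :=
  IsUnit (π (Weyl.gen N .E)) ∧ IsUnit (π (Weyl.gen N .D))

/-- The multiplicity module `{U : V₁ → V₂ | U π₁(a) = π₂(a) U for all a ∈ W_N}`. -/
def intertwiners {N : ℕ} {m n : Type} [Fintype m] [DecidableEq m] [Fintype n] [DecidableEq n]
    (π₁ : Weyl N →ₐ[ℂ] Matrix m m ℂ) (π₂ : Weyl N →ₐ[ℂ] Matrix n n ℂ) :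
    Submodule ℂ (Matrix n m ℂ) where
  carrier := {U | ∀ a : Weyl N, U * π₁ a = π₂ a * U}
  add_mem' := by
    intro U V hU hV a
    rw [Matrix.add_mul, Matrix.mul_add, hU a, hV a]
  zero_mem' := by intro a; simp
  smul_mem' := by
    intro c U hU a
    rw [Matrix.smul_mul, Matrix.mul_smul, hU a]

/-- The family `v` is a basis of the subspace `S`. -/
def IsBasisOf {ι V : Type} [AddCommGroup V] [Module ℂ V] (v : ι → V) (S : Submodule ℂ V) : Prop :=
  LinearIndependent ℂ v ∧ Submodule.span ℂ (Set.range v) = S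

/-! ### The matrices `Z`, `X`, `Y` -/

/-- `Z_{ij} = ω^i δ(i - j)`. -/
def Zmat (N : ℕ) : Matrix (ZMod N) (ZMod N) ℂ := Matrix.diagonal (wpow N)

/-- `X_{ij} = δ(i - j - 1)`. -/
def Xmat (N : ℕ) : Matrix (ZMod N) (ZMod N) ℂ :=
  Matrix.of fun i j => if i = j + 1 then 1 else 0

/-- `Y = ω^{1/2} X Z`. -/
def Ymat (N : ℕ) [NeZero N] : Matrix (ZMod N) (ZMod N) ℂ := wpow N (half N) • (Xmat N * Zmat N)

theorem root_pow (N : ℕ) [NeZero N] : root N ^ N = 1 :=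
  (Complex.isPrimitiveRoot_exp N (NeZero.ne N)).pow_eq_one

theorem root_ne_zero (N : ℕ) : root N ≠ 0 := Complex.exp_ne_zero _

theorem wpow_ne_zero (N : ℕ) (k : ZMod N) : wpow N k ≠ 0 := pow_ne_zero _ (root_ne_zero N)

theorem wpow_add (N : ℕ) [NeZero N] (k l : ZMod N) : wpow N (k + l) = wpow N k * wpow N l := by
  unfold wpow
  rw [ZMod.val_add, ← pow_add, ← pow_mod_orderOf, ← pow_mod_orderOf (root N) (k.val + l.val)]
  have h : orderOf (root N) ∣ N := orderOf_dvd_of_pow_eq_one (root_pow N)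
  rw [Nat.mod_mod_of_dvd _ h]

theorem wpow_one (N : ℕ) [NeZero N] : wpow N 1 = root N := by
  unfold wpow
  rw [ZMod.val_one_eq_one_mod]
  rcases Nat.lt_or_ge 1 N with h | h
  · rw [Nat.mod_eq_of_lt h, pow_one]
  · have h1 : N = 1 := le_antisymm h (NeZero.pos N)
    have := root_pow N
    subst h1
    simpa using this.symm

theorem Zmat_mul_Xmat (N : ℕ) [NeZero N] : Zmat N * Xmat N = root N • (Xmat N * Zmat N) := by
  ext i j
  rw [Matrix.smul_apply, Zmat, Matrix.diagonal_mul, Matrix.mul_diagonal, Xmat]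
  by_cases h : i = j + 1
  · subst h
    simp [wpow_add, wpow_one, mul_comm]
  · simp [h]

theorem isUnit_Zmat (N : ℕ) [NeZero N] : IsUnit (Zmat N) := by
  rw [Matrix.isUnit_iff_isUnit_det, Zmat, Matrix.det_diagonal, isUnit_iff_ne_zero]
  exact Finset.prod_ne_zero_iff.mpr fun i _ => wpow_ne_zero N i

theorem isUnit_Xmat (N : ℕ) [NeZero N] : IsUnit (Xmat N) := by
  apply IsUnit.of_mul_eq_one (Xmat N).transpose
  ext i j
  simp [Matrix.mul_apply, Xmat, Matrix.one_apply, ← sub_eq_iff_eq_add, eq_comm]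

theorem isUnit_Ymat (N : ℕ) [NeZero N] : IsUnit (Ymat N) := by
  unfold Ymat
  exact ((isUnit_Xmat N).mul (isUnit_Zmat N)).smul (Units.mk0 _ (wpow_ne_zero N (half N)))

/-! ### Standard representations of `W_N` -/

/-- The parameters `a_ρ, y_ρ ∈ ℂ*` of a standard representation. -/
structure StdRep where
  a : ℂ
  y : ℂ
  a_ne : a ≠ 0
  y_ne : y ≠ 0

/-- The standard representation `ρ(E) = a_ρ² Z`, `ρ(D) = a_ρ y_ρ X` on `ℂ^N`. -/
def StdRep.hom (N : ℕ) [NeZero N] (ρ : StdRep) : Weyl N →ₐ[ℂ] Matrix (ZMod N) (ZMod N) ℂ :=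
  Weyl.lift (ρ.a ^ 2 • Zmat N) ((ρ.a ^ 2)⁻¹ • (Zmat N)⁻¹) ((ρ.a * ρ.y) • Xmat N)
    (by
      have h := (Matrix.isUnit_iff_isUnit_det _).mp (isUnit_Zmat N)
      rw [smul_mul_smul_comm, Matrix.mul_nonsing_inv _ h, mul_inv_cancel₀ (pow_ne_zero 2 ρ.a_ne),
        one_smul])
    (by
      have h := (Matrix.isUnit_iff_isUnit_det _).mp (isUnit_Zmat N)
      rw [smul_mul_smul_comm, Matrix.nonsing_inv_mul _ h, inv_mul_cancel₀ (pow_ne_zero 2 ρ.a_ne),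
        one_smul])
    (by
      rw [smul_mul_smul_comm, smul_mul_smul_comm, Zmat_mul_Xmat, smul_comm,
        mul_comm (ρ.a ^ 2)])

/-- The triple `(ρ, μ, ν)` is regular: all tensor products of consecutive terms are cyclic. -/
def IsRegularTriple (N : ℕ) [NeZero N] (ρ μ ν : StdRep) : Prop :=
  IsCyclic (tensorRep (ρ.hom N) (μ.hom N)) ∧ IsCyclic (tensorRep (μ.hom N) (ν.hom N)) ∧
    IsCyclic (tensorRep (tensorRep (ρ.hom N) (μ.hom N)) (ν.hom N))

/-- `σ` is a standard representation `ρμ`: `a_σ = a_ρ a_μ`, and `y_σ` is one of the `N`-th roots of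
`a_ρ^N y_μ^N + y_ρ^N / a_μ^N`. -/
def IsProduct (N : ℕ) (ρ μ σ : StdRep) : Prop :=
  σ.a = ρ.a * μ.a ∧ σ.y ^ N = ρ.a ^ N * μ.y ^ N + ρ.y ^ N / μ.a ^ N

/-! ### Clebsch–Gordan operators and `6j`-symbols -/

/-- The argument `y_{ρμ} / (a_ρ y_μ)` attached to a pair with product `σ = ρμ`. -/
def pairArg (ρ μ σ : StdRep) : ℂ := σ.y / (ρ.a * μ.y)

/-- The standard Clebsch–Gordan operators `K_α(ρ,μ) : V_{ρμ} → V_ρ ⊗ V_μ`, where `σ = ρμ`,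
`K_α(ρ,μ)_{i,j}^k = h_{ρ,μ} ω^{αj} ω(a_ρ y_μ, y_ρ/a_μ, y_{ρμ} | i, α) δ(i + j - k)`,
with `h_{ρ,μ} = h(y_{ρμ} / (a_ρ y_μ))`; the row index is `(i, j)`, the column index is `k`. -/
def stdCGO (N : ℕ) (g : ℂ → ℂ) (ρ μ σ : StdRep) (α : ZMod N) :
    Matrix (ZMod N × ZMod N) (ZMod N) ℂ :=
  Matrix.of fun p k => if p.1 + p.2 = k then
    hFun N g (pairArg ρ μ σ) * wpow N (α * p.2) *
      cdil₂ N (ρ.a * μ.y) (ρ.y / μ.a) σ.y p.1 α else 0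

/-- The composites `K_α(ρ,μ) K_β(ρμ,ν) : V_{ρμν} → (V_ρ ⊗ V_μ) ⊗ V_ν`, indexed by `(α, β)`. -/
def leftComposite (N : ℕ) [NeZero N] (g : ℂ → ℂ) (ρ μ ν ρμ ρμν : StdRep) (p : ZMod N × ZMod N) :
    Matrix ((ZMod N × ZMod N) × ZMod N) (ZMod N) ℂ :=
  (stdCGO N g ρ μ ρμ p.1 ⊗ₖ (1 : Matrix (ZMod N) (ZMod N) ℂ)) * stdCGO N g ρμ ν ρμν p.2

/-- The composites `K_δ(μ,ν) K_γ(ρ,μν) : V_{ρμν} → V_ρ ⊗ (V_μ ⊗ V_ν)`, indexed by `(γ, δ)`. -/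
def rightComposite (N : ℕ) [NeZero N] (g : ℂ → ℂ) (ρ μ ν μν ρμν : StdRep) (p : ZMod N × ZMod N) :
    Matrix (ZMod N × (ZMod N × ZMod N)) (ZMod N) ℂ :=
  ((1 : Matrix (ZMod N) (ZMod N) ℂ) ⊗ₖ stdCGO N g μ ν μν p.2) * stdCGO N g ρ μν ρμν p.1

/-- `R` is the matrix, in the standard bases of Clebsch–Gordan operators, of the `6j`-symbol
`R(ρ,μ,ν)` given by the associativity isomorphism `(V_ρ ⊗ V_μ) ⊗ V_ν ≅ V_ρ ⊗ (V_μ ⊗ V_ν)`: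
`K_α(ρ,μ) K_β(ρμ,ν) = ∑_{γ,δ} R_{α,β}^{γ,δ} K_δ(μ,ν) K_γ(ρ,μν)`.
The row index of `R` is `(α, β)` and its column index is `(γ, δ)`. -/
def IsSixJ (N : ℕ) [NeZero N] (g : ℂ → ℂ) (ρ μ ν ρμ μν ρμν : StdRep)
    (R : Matrix (ZMod N × ZMod N) (ZMod N × ZMod N) ℂ) : Prop :=
  ∀ p : ZMod N × ZMod N, leftComposite N g ρ μ ν ρμ ρμν p =
    ∑ q : ZMod N × ZMod N, R p q •
      (rightComposite N g ρ μ ν μν ρμν q).submatrix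
        (Equiv.prodAssoc (ZMod N) (ZMod N) (ZMod N)) id

/-- The argument `y_{ρμ} y_{μν} / (y_{ρμν} y_μ)` attached to a triple. -/
def tripleArg (μ ρμ μν ρμν : StdRep) : ℂ := ρμ.y * μν.y / (ρμν.y * μ.y)

/-- The matrix with entries
`h ω^{αδ} ω(y_{ρμν} y_μ, y_ρ y_ν, y_{ρμ} y_{μν} | γ, α) δ(γ + δ - β)`
in row `(α, β)` and column `(γ, δ)`. -/
def sixJ (N : ℕ) (h : ℂ) (ρ μ ν ρμ μν ρμν : StdRep) :
    Matrix (ZMod N × ZMod N) (ZMod N × ZMod N) ℂ :=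
  Matrix.of fun p q => if q.1 + q.2 = p.2 then
    h * wpow N (p.1 * q.2) *
      cdil₂ N (ρμν.y * μ.y) (ρ.y * ν.y) (ρμ.y * μν.y) q.1 p.1 else 0

/-- The matrix with entries
`([y_{ρμν} y_μ / (y_{ρμ} y_{μν})] / h) ω^{-αδ} δ(γ + δ - β) /
  ω(y_{ρμν} y_μ / ω, y_ρ y_ν, y_{ρμ} y_{μν} | γ, α)`
in row `(γ, δ)` and column `(α, β)`. -/
def sixJBar (N : ℕ) (h : ℂ) (ρ μ ν ρμ μν ρμν : StdRep) :
    Matrix (ZMod N × ZMod N) (ZMod N × ZMod N) ℂ :=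
  Matrix.of fun q p => if q.1 + q.2 = p.2 then
    bracket N (ρμν.y * μ.y / (ρμ.y * μν.y)) / h * wpow N (-(p.1 * q.2)) /
      cdil₂ N (ρμν.y * μ.y / root N) (ρ.y * ν.y) (ρμ.y * μν.y) q.1 p.1 else 0

/-! ### The Heisenberg double and the twisted dilogarithm operator -/

inductive HeisGen
  | E | Einv | Eb | Ebinv | D | Db

/-- The relations of the integral form of the Heisenberg double of the quantized Borel algebra,
specialized at `q = ω⁻¹`, together with `D D̄ = q D̄ D`. -/
inductive HeisRel (N : ℕ) : FreeAlgebra ℂ HeisGen → FreeAlgebra ℂ HeisGen → Prop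
  | E_mul_inv : HeisRel N (FreeAlgebra.ι ℂ HeisGen.E * FreeAlgebra.ι ℂ HeisGen.Einv) 1
  | E_inv_mul : HeisRel N (FreeAlgebra.ι ℂ HeisGen.Einv * FreeAlgebra.ι ℂ HeisGen.E) 1
  | Eb_mul_inv : HeisRel N (FreeAlgebra.ι ℂ HeisGen.Eb * FreeAlgebra.ι ℂ HeisGen.Ebinv) 1
  | Eb_inv_mul : HeisRel N (FreeAlgebra.ι ℂ HeisGen.Ebinv * FreeAlgebra.ι ℂ HeisGen.Eb) 1
  | D_E : HeisRel N (FreeAlgebra.ι ℂ HeisGen.D * FreeAlgebra.ι ℂ HeisGen.E)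
      ((root N)⁻¹ • (FreeAlgebra.ι ℂ HeisGen.E * FreeAlgebra.ι ℂ HeisGen.D))
  | Db_Eb : HeisRel N (FreeAlgebra.ι ℂ HeisGen.Db * FreeAlgebra.ι ℂ HeisGen.Eb)
      ((root N)⁻¹ • (FreeAlgebra.ι ℂ HeisGen.Eb * FreeAlgebra.ι ℂ HeisGen.Db))
  | E_Eb : HeisRel N (FreeAlgebra.ι ℂ HeisGen.E * FreeAlgebra.ι ℂ HeisGen.Eb)
      ((root N)⁻¹ • (FreeAlgebra.ι ℂ HeisGen.Eb * FreeAlgebra.ι ℂ HeisGen.E))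
  | D_Eb : HeisRel N (FreeAlgebra.ι ℂ HeisGen.D * FreeAlgebra.ι ℂ HeisGen.Eb)
      (FreeAlgebra.ι ℂ HeisGen.Eb * FreeAlgebra.ι ℂ HeisGen.D)
  | E_Db : HeisRel N (FreeAlgebra.ι ℂ HeisGen.E * FreeAlgebra.ι ℂ HeisGen.Db)
      ((root N)⁻¹ • (FreeAlgebra.ι ℂ HeisGen.Db * FreeAlgebra.ι ℂ HeisGen.E))
  | D_Db : HeisRel N (FreeAlgebra.ι ℂ HeisGen.D * FreeAlgebra.ι ℂ HeisGen.Db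
        - FreeAlgebra.ι ℂ HeisGen.Db * FreeAlgebra.ι ℂ HeisGen.D)
      ((1 - (root N)⁻¹) • FreeAlgebra.ι ℂ HeisGen.E)
  | D_Db' : HeisRel N (FreeAlgebra.ι ℂ HeisGen.D * FreeAlgebra.ι ℂ HeisGen.Db)
      ((root N)⁻¹ • (FreeAlgebra.ι ℂ HeisGen.Db * FreeAlgebra.ι ℂ HeisGen.D))

/-- The quotient of the Heisenberg double at `q = ω⁻¹` on which the dilogarithm operator lives. -/
abbrev Heis (N : ℕ) : Type := RingQuot (HeisRel N)

/-- The class of a generator. -/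
def Heis.gen (N : ℕ) (x : HeisGen) : Heis N :=
  RingQuot.mkAlgHom ℂ (HeisRel N) (FreeAlgebra.ι ℂ x)

theorem Zmat_mul_Ymat (N : ℕ) [NeZero N] : Zmat N * Ymat N = root N • (Ymat N * Zmat N) := by
  unfold Ymat
  rw [Matrix.mul_smul, ← Matrix.mul_assoc, Zmat_mul_Xmat, Matrix.smul_mul, Matrix.smul_mul,
    smul_comm]

/-- The normal representation with parameters `a, y`:
`E ↦ a⁻² Z⁻¹`, `D ↦ -(y/a) Y⁻¹`, `Ē ↦ a⁻² Y`, `D̄ ↦ (a y)⁻¹ Z⁻¹ Y`. -/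
def normalRep (N : ℕ) [NeZero N] (ρ : StdRep) : Heis N →ₐ[ℂ] Matrix (ZMod N) (ZMod N) ℂ :=
  RingQuot.liftAlgHom ℂ ⟨FreeAlgebra.lift ℂ (fun x : HeisGen => match x with
    | .E => (ρ.a ^ 2)⁻¹ • (Zmat N)⁻¹
    | .Einv => ρ.a ^ 2 • Zmat N
    | .Eb => (ρ.a ^ 2)⁻¹ • Ymat N
    | .Ebinv => ρ.a ^ 2 • (Ymat N)⁻¹
    | .D => (-(ρ.y / ρ.a)) • (Ymat N)⁻¹
    | .Db => (ρ.a * ρ.y)⁻¹ • ((Zmat N)⁻¹ * Ymat N)), by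
      have hZ := (Matrix.isUnit_iff_isUnit_det _).mp (isUnit_Zmat N)
      have hY := (Matrix.isUnit_iff_isUnit_det _).mp (isUnit_Ymat N)
      have z1 := Matrix.mul_nonsing_inv _ hZ
      have z2 := Matrix.nonsing_inv_mul _ hZ
      have y1 := Matrix.mul_nonsing_inv _ hY
      have y2 := Matrix.nonsing_inv_mul _ hY
      have hzy := Zmat_mul_Ymat N
      have hw := root_ne_zero N
      have ha := ρ.a_ne
      have hy := ρ.y_ne
      generalize Zmat N = z at *
      generalize Ymat N = y at *
      generalize hzi : z⁻¹ = zi at *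
      generalize hyi : y⁻¹ = yi at *
      have hyz : y * z = (root N)⁻¹ • (z * y) := by rw [hzy, smul_smul, inv_mul_cancel₀ hw, one_smul]
      have c1 : zi * y = (root N)⁻¹ • (y * zi) := by
        calc zi * y = zi * (y * z) * zi := by rw [mul_assoc, mul_assoc, z1, mul_one]
          _ = (root N)⁻¹ • (y * zi) := by
            rw [hyz, mul_smul_comm, smul_mul_assoc, ← mul_assoc, z2, one_mul]
      have c2 : yi * zi = (root N)⁻¹ • (zi * yi) := by
        calc yi * zi = yi * (zi * y) * yi := by rw [mul_assoc, mul_assoc, y1, mul_one]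
          _ = (root N)⁻¹ • (zi * yi) := by
            rw [c1, mul_smul_comm, smul_mul_assoc, ← mul_assoc, y2, one_mul]
      have c3 : yi * (zi * y) = (root N)⁻¹ • zi := by
        rw [c1, mul_smul_comm, ← mul_assoc, y2, one_mul]
      have c4 : zi * y * yi = zi := by rw [mul_assoc, y1, mul_one]
      have c5 : y * zi = root N • (zi * y) := by
        rw [c1, smul_smul, mul_inv_cancel₀ hw, one_smul]
      intro u v h
      cases h with
      | E_mul_inv => simp [smul_smul, z2, ha]
      | E_inv_mul => simp [smul_smul, z1, ha]
      | Eb_mul_inv => simp [smul_smul, y1, ha]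
      | Eb_inv_mul => simp [smul_smul, y2, ha]
      | D_E =>
        simp only [map_mul, map_smul, FreeAlgebra.lift_ι_apply, smul_mul_smul_comm, c2, smul_smul]
        congr 1
        ring
      | Db_Eb =>
        simp only [map_mul, map_smul, FreeAlgebra.lift_ι_apply, smul_mul_smul_comm]
        rw [c1, smul_mul_assoc, mul_smul_comm, smul_smul, smul_smul, smul_smul, mul_assoc y zi y, c1,
          mul_smul_comm, smul_smul]
        congr 1
        ring
      | E_Eb =>
        simp only [map_mul, map_smul, FreeAlgebra.lift_ι_apply, smul_mul_smul_comm, c1, smul_smul]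
        congr 1
        ring
      | D_Eb =>
        simp only [map_mul, FreeAlgebra.lift_ι_apply, smul_mul_smul_comm, y1, y2]
        congr 1
        ring
      | E_Db =>
        simp only [map_mul, map_smul, FreeAlgebra.lift_ι_apply, smul_mul_smul_comm]
        rw [mul_assoc zi y zi, c5, mul_smul_comm, smul_smul, smul_smul]
        congr 1
        field_simp
      | D_Db =>
        simp only [map_mul, map_sub, map_smul, FreeAlgebra.lift_ι_apply, smul_mul_smul_comm, c3, c4,
          smul_smul, ← sub_smul]
        congr 1
        field_simp
        ring
      | D_Db' =>
        simp only [map_mul, map_smul, FreeAlgebra.lift_ι_apply, smul_mul_smul_comm, c3, c4,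
          smul_smul]
        congr 1
        field_simp⟩

/-- A cyclic representation of the twisted dilogarithm operator `R_ω = Υ_ω · Ψ_ω`: two cyclic
representations `π₁`, `π₂` of the Heisenberg double at `q = ω⁻¹`, together with their extension to
the `N`-th roots of the central elements that occur in `R_ω`. These are `c_E` with `c_E^N = E^N` (on
the first factor), `c_Ē` with `c_Ē^N = Ē^N` (on the second factor), and
`b = (1 - (D ⊗ D̄)^N)^{1/N}`. The scalar `norm ≠ 0` is the normalization of the dilogarithm. -/
structure RomegaRep (N : ℕ) [NeZero N] where
  π₁ : Heis N →ₐ[ℂ] Matrix (ZMod N) (ZMod N) ℂ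
  π₂ : Heis N →ₐ[ℂ] Matrix (ZMod N) (ZMod N) ℂ
  cyclic₁ : ∀ x : HeisGen, IsUnit (π₁ (Heis.gen N x))
  cyclic₂ : ∀ x : HeisGen, IsUnit (π₂ (Heis.gen N x))
  cE : ℂ
  cEb : ℂ
  b : ℂ
  norm : ℂ
  cE_pow : π₁ (Heis.gen N .E) ^ N = (cE ^ N) • (1 : Matrix (ZMod N) (ZMod N) ℂ)
  cEb_pow : π₂ (Heis.gen N .Eb) ^ N = (cEb ^ N) • (1 : Matrix (ZMod N) (ZMod N) ℂ)
  b_pow : (π₁ (Heis.gen N .D) ⊗ₖ π₂ (Heis.gen N .Db)) ^ N =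
    (1 - b ^ N) • (1 : Matrix (ZMod N × ZMod N) (ZMod N × ZMod N) ℂ)
  norm_ne : norm ≠ 0

/-- The image of `Υ_ω = N⁻¹ ∑_{i,j} ω^{ij} (E')^i ⊗ (Ē')^j`, where `E' = c_E⁻¹ E` and
`Ē' = c_Ē⁻¹ Ē`. -/
def RomegaRep.upsilon {N : ℕ} [NeZero N] (T : RomegaRep N) :
    Matrix (ZMod N × ZMod N) (ZMod N × ZMod N) ℂ :=
  (N : ℂ)⁻¹ • ∑ i ∈ Finset.range N, ∑ j ∈ Finset.range N,
    root N ^ (i * j) • (((T.cE⁻¹ • T.π₁ (Heis.gen N .E)) ^ i) ⊗ₖ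
      ((T.cEb⁻¹ • T.π₂ (Heis.gen N .Eb)) ^ j))

/-- The image of the cyclic dilogarithm `Ψ_ω = Ψ(A)`, `A = D ⊗ D̄`, with the given normalization:
`Ψ(A) = norm ∑_{t=0}^{N-1} A^t ∏_{s=1}^t 1 / (1 - ω^{-s} b)`. It is, up to the scalar
`norm`, the solution of `b Ψ(ω⁻¹ A) = (1 - A) Ψ(A)`. -/
def RomegaRep.psi {N : ℕ} [NeZero N] (T : RomegaRep N) :
    Matrix (ZMod N × ZMod N) (ZMod N × ZMod N) ℂ :=
  T.norm • ∑ t ∈ Finset.range N, (∏ s ∈ Finset.range t, 1 / (1 - (root N)⁻¹ ^ (s + 1) * T.b)) •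
    (T.π₁ (Heis.gen N .D) ⊗ₖ T.π₂ (Heis.gen N .Db)) ^ t

/-- The image of `R_ω = Υ_ω · Ψ_ω`. -/
def RomegaRep.image {N : ℕ} [NeZero N] (T : RomegaRep N) :
    Matrix (ZMod N × ZMod N) (ZMod N × ZMod N) ℂ :=
  T.upsilon * T.psi

/-- `T` is built from the normal representations with parameters `ρ`, `μ` (with `σ = ρμ`), with the
corresponding choice of central roots, `c_E = a_ρ⁻²`, `c_Ē = a_μ⁻²`, `b = y_{ρμ}/(a_ρ y_μ)`. -/
def RomegaRep.IsNormal {N : ℕ} [NeZero N] (T : RomegaRep N) (ρ μ σ : StdRep) : Prop :=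
  T.π₁ = normalRep N ρ ∧ T.π₂ = normalRep N μ ∧ T.cE = (ρ.a ^ 2)⁻¹ ∧ T.cEb = (μ.a ^ 2)⁻¹ ∧
    T.b = pairArg ρ μ σ

end

end CyclicSixJ

open CyclicSixJ

namespace CyclicSixJ

set_option linter.unusedSectionVars false

/-! ### Powers of `ω` with exponents modulo `N`, and sums and products over them. -/

variable {N : ℕ} [NeZero N]

/-! Everything is governed by one function, the cyclic dilogarithm `fd N t s` at a point of the
Fermat curve `t^N + s^N = 1`. It is, up to a scalar, the only solution on `ℤ/N` of `(ω^n - t) u(n) =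
s u(n-1)`; the Fermat equation is what lets the recurrence close up after `N` steps (`fd_rec`,
`eq_mul_fd_of_rec`).

Bases. Commuting with `E` fixes the support of an intertwiner, and commuting with `D` becomes, after
a Fourier transform in one index, this recurrence; hence `isBasisOf_stdCGO`. The Clebsch–Gordan
coefficients and the asserted 6j-symbol are entries of the same matrix `cycMat`, whose inverse
`cycMatBar` comes from an orthogonality relation of dilogarithms (`sum_fd_div`). That inverse also
makes the composites bases and yields the inverse 6j-symbol.

6j-symbol. Entrywise, the defining relation is a five-term identity: a sum over `γ` of three
dilogarithms is a constant times a product of two. The sum satisfies the recurrences that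
characterize the product (`fiveSum_eq`). Read as an identity of matrices, it has Vandermonde-like
determinants, which give the `N`-th power of the constant (`fiveSum_pow`). So the constant is the
expected quotient of values of `h`, up to an `N`-th root of unity `ζ`.

The value of `ζ`. With principal determinations, let `fiveRatio` be the quotient of the two sides of
the five-term identity, the claimed power of `ω` included. It is an `N`-th root of unity. It is also
continuous when `t₁, s₁` are fixed and `t₂, t₃` stay off the cuts: when `t₂/t₃` or `t₁t₃/t₂` crosses
a cut, the jump of `h` is cancelled by that of the quadratic exponent
(`FiveData.tendsto_fiveRatio`). Hence it is constant when `s₃` shrinks to `0` along a ray with `t₂,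
t₃` the principal roots, and in the limit it is `1`. Other choices of the roots are reached by
multiplying `t₂, t₃` by `ω`, which changes both sides compatibly; exceptional positions of `s₃` are
reached by a small rotation.

Dilogarithm operator. In suitable normal representations `Υ` and `Ψ` are explicit, and their product
is `cycMat` (`dilogRep_image`). -/

theorem root_isPrimitiveRoot (N : ℕ) [NeZero N] : IsPrimitiveRoot (root N) N :=
  Complex.isPrimitiveRoot_exp N (NeZero.ne N)

theorem wpow_zero (N : ℕ) [NeZero N] : wpow N 0 = 1 := by simp [wpow]

theorem wpow_natCast (n : ℕ) : wpow N (n : ZMod N) = root N ^ n := by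
  rw [wpow, ZMod.val_natCast]
  exact (pow_eq_pow_mod n (root_pow N)).symm

theorem wpow_neg (k : ZMod N) : wpow N (-k) = (wpow N k)⁻¹ := by
  apply eq_inv_of_mul_eq_one_left
  rw [← wpow_add, neg_add_cancel, wpow_zero]

theorem wpow_sub (k l : ZMod N) : wpow N (k - l) = wpow N k / wpow N l := by
  rw [sub_eq_add_neg, wpow_add, wpow_neg, div_eq_mul_inv]

theorem wpow_pow (k : ZMod N) (n : ℕ) : wpow N k ^ n = wpow N (n * k) := by
  induction n with
  | zero => simp [wpow_zero]
  | succ n ih => rw [pow_succ, ih, ← wpow_add]; congr 1; push_cast; ring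

theorem wpow_pow_card (k : ZMod N) : wpow N k ^ N = 1 := by
  rw [wpow_pow]; simp [wpow_zero]

theorem wpow_injective (N : ℕ) [NeZero N] : Function.Injective (wpow N) := by
  intro a b h
  exact ZMod.val_injective N
    ((root_isPrimitiveRoot N).pow_inj (ZMod.val_lt a) (ZMod.val_lt b) h)

theorem exists_wpow_eq {z : ℂ} (hz : z ^ N = 1) : ∃ k : ZMod N, wpow N k = z := by
  obtain ⟨i, -, hi⟩ := (root_isPrimitiveRoot N).eq_pow_of_pow_eq_one hz
  exact ⟨i, by rw [wpow_natCast, hi]⟩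

theorem exists_eq_wpow_mul {x y : ℂ} (hy : y ≠ 0) (h : x ^ N = y ^ N) :
    ∃ k : ZMod N, x = wpow N k * y := by
  obtain ⟨k, hk⟩ := exists_wpow_eq (N := N) (z := x / y)
    (by rw [div_pow, h, div_self (pow_ne_zero _ hy)])
  exact ⟨k, by rw [hk, div_mul_cancel₀ _ hy]⟩

theorem two_mul_half (hN : Odd N) : 2 * half N = 1 := by
  obtain ⟨k, hk⟩ := hN
  have h : (N + 1) / 2 = k + 1 := by omega
  have h2 : ((N : ℕ) : ZMod N) = 0 := ZMod.natCast_self N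
  rw [half, h]
  have : ((2 * k + 1 : ℕ) : ZMod N) = 0 := by rw [← hk]; exact h2
  push_cast at this ⊢
  linear_combination this

theorem prod_zmod_eq_prod_range {M : Type*} [CommMonoid M] (f : ℕ → M) :
    ∏ k : ZMod N, f k.val = ∏ j ∈ Finset.range N, f j := by
  refine Finset.prod_nbij' (fun k => k.val) (fun j => (j : ZMod N)) ?_ ?_ ?_ ?_ ?_
  · intro k _; simpa using ZMod.val_lt k
  · intro j _; simp
  · intro k _; simp
  · intro j hj; simpa using ZMod.val_cast_of_lt (Finset.mem_range.mp hj)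
  · intro k _; rfl

theorem sum_zmod_eq_sum_range {M : Type*} [AddCommMonoid M] (f : ℕ → M) :
    ∑ k : ZMod N, f k.val = ∑ j ∈ Finset.range N, f j := by
  refine Finset.sum_nbij' (fun k => k.val) (fun j => (j : ZMod N)) ?_ ?_ ?_ ?_ ?_
  · intro k _; simpa using ZMod.val_lt k
  · intro j _; simp
  · intro k _; simp
  · intro j hj; simpa using ZMod.val_cast_of_lt (Finset.mem_range.mp hj)
  · intro k _; rfl

theorem sum_wpow_mul (m : ZMod N) :
    ∑ n : ZMod N, wpow N (m * n) = if m = 0 then (N : ℂ) else 0 := by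
  split_ifs with h
  · simp [h, wpow_zero, ZMod.card]
  · have key : wpow N m * ∑ n : ZMod N, wpow N (m * n) = ∑ n : ZMod N, wpow N (m * n) := by
      rw [Finset.mul_sum]
      refine Fintype.sum_equiv (Equiv.addRight 1) _ _ fun n => ?_
      rw [← wpow_add]; congr 1; simp; ring
    have hne : wpow N m ≠ 1 := fun h1 => h (wpow_injective N (h1.trans (wpow_zero N).symm))
    have : (wpow N m - 1) * ∑ n : ZMod N, wpow N (m * n) = 0 := by rw [sub_mul, key]; ring
    exact (mul_eq_zero.mp this).resolve_left (sub_ne_zero.mpr hne)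

theorem pow_sub_pow_eq_prod_zmod (x y : ℂ) :
    x ^ N - y ^ N = ∏ k : ZMod N, (x - wpow N k * y) := by
  rw [(root_isPrimitiveRoot N).pow_sub_pow_eq_prod_sub_mul x y (NeZero.pos N)]
  symm
  refine Finset.prod_nbij (wpow N) ?_ ?_ ?_ ?_
  · intro k _
    rw [Polynomial.mem_nthRootsFinset (NeZero.pos N)]
    exact wpow_pow_card k
  · exact fun a _ b _ h => wpow_injective N h
  · intro z hz
    obtain ⟨k, hk⟩ := exists_wpow_eq ((Polynomial.mem_nthRootsFinset (NeZero.pos N) _).mp hz)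
    exact ⟨k, by simp, hk⟩
  · intro k _; rfl

theorem one_sub_pow_eq_prod_zmod (t : ℂ) :
    1 - t ^ N = ∏ k : ZMod N, (1 - t * wpow N k) := by
  have := pow_sub_pow_eq_prod_zmod (N := N) 1 t
  simpa [mul_comm] using this

theorem one_sub_pow_eq_prod_wpow_sub (hN : Odd N) (t : ℂ) :
    1 - t ^ N = ∏ k : ZMod N, (wpow N k - t) := by
  have h := pow_sub_pow_eq_prod_zmod (N := N) t 1
  have h2 : ∏ k : ZMod N, (wpow N k - t) = (-1) ^ N * ∏ k : ZMod N, (t - wpow N k * 1) := by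
    have h3 : ∀ k : ZMod N, wpow N k - t = (-1) * (t - wpow N k * 1) := fun k => by ring
    simp_rw [h3]
    rw [Finset.prod_mul_distrib, Finset.prod_const, Finset.card_univ, ZMod.card]
  rw [h2, ← h, hN.neg_one_pow]; ring

theorem wpow_sub_ne_zero {t : ℂ} (h : t ^ N ≠ 1) (k : ZMod N) : wpow N k - t ≠ 0 := by
  intro h0
  apply h
  rw [← sub_eq_zero.mp h0, wpow_pow_card]

/-! ### The cyclic dilogarithm on the Fermat curve and its recurrence. -/

/-- The product `∏_{j=1}^n s / (ω^j - t)`, the cyclic dilogarithm in affine coordinates. -/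
noncomputable def fd (N : ℕ) (t s : ℂ) (n : ZMod N) : ℂ :=
  ∏ j ∈ Finset.range n.val, s / (root N ^ (j + 1) - t)

theorem cdil_eq_fd {x : ℂ} (hx : x ≠ 0) (y z : ℂ) (n : ZMod N) :
    cdil N x y z n = fd N (z / x) (-(y / x)) n := by
  refine Finset.prod_congr rfl fun j _ => ?_
  have h : root N ^ (j + 1) - z / x = -(z - x * root N ^ (j + 1)) / x := by field_simp; ring
  rw [h]
  by_cases h0 : z - x * root N ^ (j + 1) = 0
  · simp [h0]
  · field_simp

@[simp] theorem fd_zero (N : ℕ) (t s : ℂ) : fd N t s 0 = 1 := by simp [fd]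

theorem fd_natCast_lt {n : ℕ} (hn : n < N) (t s : ℂ) :
    fd N t s (n : ZMod N) = ∏ j ∈ Finset.range n, s / (root N ^ (j + 1) - t) := by
  rw [fd, ZMod.val_cast_of_lt hn]

theorem pow_ne_one_of_add {t s : ℂ} (hs : s ≠ 0) (h : t ^ N + s ^ N = 1) : t ^ N ≠ 1 := by
  intro h1
  rw [h1] at h
  exact hs (pow_eq_zero_iff (NeZero.ne N) |>.mp (by linear_combination h))

theorem fd_ne_zero {t s : ℂ} (hs : s ≠ 0) (h : t ^ N + s ^ N = 1) (n : ZMod N) :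
    fd N t s n ≠ 0 := by
  refine Finset.prod_ne_zero_iff.mpr fun j _ => div_ne_zero hs ?_
  rw [← wpow_natCast]
  exact wpow_sub_ne_zero (pow_ne_one_of_add hs h) _

theorem fd_rec (hN : Odd N) {t s : ℂ} (hs : s ≠ 0) (h : t ^ N + s ^ N = 1) (n : ZMod N) :
    (wpow N n - t) * fd N t s n = s * fd N t s (n - 1) := by
  have ht := pow_ne_one_of_add hs h
  obtain ⟨m, hm, rfl⟩ : ∃ m < N, (m : ZMod N) = n := ⟨n.val, ZMod.val_lt n, by simp⟩
  -- At `n = 0` the index `n - 1` wraps around to `N - 1`; the cycle closes because the product of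
  -- all `ω^j - t` is `1 - t^N = s^N`.
  rcases m with _ | m
  · obtain ⟨M, rfl⟩ : ∃ M, N = M + 1 := ⟨N - 1, by have := NeZero.pos N; omega⟩
    have e : ((0 : ℕ) : ZMod (M + 1)) - 1 = (M : ZMod (M + 1)) := by
      have := ZMod.natCast_self (M + 1)
      push_cast at this ⊢
      linear_combination -this
    rw [e, fd_natCast_lt (Nat.lt_succ_self M)]
    have hp := one_sub_pow_eq_prod_wpow_sub hN t
    have hp2 : ∏ k : ZMod (M + 1), (wpow (M + 1) k - t)
        = ∏ j ∈ Finset.range (M + 1), (root (M + 1) ^ j - t) :=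
      prod_zmod_eq_prod_range (N := M + 1) (fun j => root (M + 1) ^ j - t)
    rw [hp2, Finset.prod_range_succ', pow_zero] at hp
    rw [Finset.prod_div_distrib, Finset.prod_const, Finset.card_range]
    simp only [Nat.cast_zero, wpow_zero, fd_zero, mul_one]
    have hne : ∏ k ∈ Finset.range M, (root (M + 1) ^ (k + 1) - t) ≠ 0 := by
      refine Finset.prod_ne_zero_iff.mpr fun j _ => ?_
      rw [← wpow_natCast]
      exact wpow_sub_ne_zero ht _
    field_simp
    rw [mul_comm, ← hp, ← pow_succ']
    linear_combination -h
  · have e : ((m + 1 : ℕ) : ZMod N) - 1 = (m : ZMod N) := by push_cast; ring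
    rw [e, fd_natCast_lt hm, fd_natCast_lt (by omega), Finset.prod_range_succ, wpow_natCast]
    have := wpow_sub_ne_zero ht ((m + 1 : ℕ) : ZMod N)
    rw [wpow_natCast] at this
    field_simp

/-- The recurrence is of first order and `ω^n - t` never vanishes, so the value at `0` determines a
solution. This is the tool that identifies unknown functions as dilogarithms. -/
theorem eq_mul_fd_of_rec (hN : Odd N) {t s : ℂ} (hs : s ≠ 0) (h : t ^ N + s ^ N = 1)
    {u : ZMod N → ℂ} (hu : ∀ n, (wpow N n - t) * u n = s * u (n - 1)) (n : ZMod N) :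
    u n = u 0 * fd N t s n := by
  have ht := pow_ne_one_of_add hs h
  have key : ∀ m : ℕ, u (m : ZMod N) = u 0 * fd N t s (m : ZMod N) := by
    intro m
    induction m with
    | zero => simp
    | succ m ih =>
      have h1 := hu ((m + 1 : ℕ) : ZMod N)
      have h2 := fd_rec hN hs h ((m + 1 : ℕ) : ZMod N)
      have e : ((m + 1 : ℕ) : ZMod N) - 1 = (m : ZMod N) := by push_cast; ring
      rw [e] at h1 h2
      apply mul_left_cancel₀ (wpow_sub_ne_zero ht ((m + 1 : ℕ) : ZMod N))
      rw [h1, ih]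
      linear_combination (-u 0) * h2
  simpa using key n.val

/-! ### The five-term identity up to its constant. -/

/-- The summand of the five-term sum. -/
noncomputable def fiveTerm (N : ℕ) (s₁ s₃ t₁ t₂ t₃ : ℂ) (i j γ : ZMod N) : ℂ :=
  wpow N (γ * (γ + j)) * fd N (t₁ * t₃ / t₂) (s₁ / t₂) γ * fd N t₃ s₃ (j + γ) *
    fd N (t₂ / t₃) (-(s₁ * s₃ / t₃)) (i - γ)

/-- The sum over one index in the five-term identity of cyclic dilogarithms. -/
noncomputable def fiveSum (N : ℕ) [NeZero N] (s₁ s₃ t₁ t₂ t₃ : ℂ) (i j : ZMod N) : ℂ :=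
  ∑ γ : ZMod N, fiveTerm N s₁ s₃ t₁ t₂ t₃ i j γ

/-- Points on Fermat curves which are the arguments of the five-term identity. -/
structure FiveData (N : ℕ) (s₁ s₃ t₁ t₂ t₃ : ℂ) : Prop where
  s₁_ne : s₁ ≠ 0
  s₃_ne : s₃ ≠ 0
  t₁_ne : t₁ ≠ 0
  t₂_ne : t₂ ≠ 0
  t₃_ne : t₃ ≠ 0
  eq₁ : t₁ ^ N + s₁ ^ N = 1
  eq₂ : t₂ ^ N + (t₁ * s₃) ^ N = 1
  eq₃ : t₃ ^ N + s₃ ^ N = 1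

namespace FiveData

variable {s₁ s₃ t₁ t₂ t₃ : ℂ}

theorem s₂_ne (d : FiveData N s₁ s₃ t₁ t₂ t₃) : t₁ * s₃ ≠ 0 := mul_ne_zero d.t₁_ne d.s₃_ne

theorem s₄_ne (d : FiveData N s₁ s₃ t₁ t₂ t₃) : -(s₁ * s₃ / t₃) ≠ 0 :=
  neg_ne_zero.mpr (div_ne_zero (mul_ne_zero d.s₁_ne d.s₃_ne) d.t₃_ne)

theorem s₅_ne (d : FiveData N s₁ s₃ t₁ t₂ t₃) : s₁ / t₂ ≠ 0 := div_ne_zero d.s₁_ne d.t₂_ne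

theorem t₄_ne (d : FiveData N s₁ s₃ t₁ t₂ t₃) : t₂ / t₃ ≠ 0 := div_ne_zero d.t₂_ne d.t₃_ne

theorem t₅_ne (d : FiveData N s₁ s₃ t₁ t₂ t₃) : t₁ * t₃ / t₂ ≠ 0 :=
  div_ne_zero (mul_ne_zero d.t₁_ne d.t₃_ne) d.t₂_ne

theorem eq₄ (hN : Odd N) (d : FiveData N s₁ s₃ t₁ t₂ t₃) :
    (t₂ / t₃) ^ N + (-(s₁ * s₃ / t₃)) ^ N = 1 := by
  have h1 := d.eq₁
  have h2 := d.eq₂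
  have h3 := d.eq₃
  have := pow_ne_zero N d.t₃_ne
  rw [hN.neg_pow, div_pow, div_pow, mul_pow]
  rw [mul_pow] at h2
  field_simp
  linear_combination h2 - h3 - s₃ ^ N * h1

theorem eq₅ (d : FiveData N s₁ s₃ t₁ t₂ t₃) :
    (t₁ * t₃ / t₂) ^ N + (s₁ / t₂) ^ N = 1 := by
  have h1 := d.eq₁
  have h2 := d.eq₂
  have h3 := d.eq₃
  have := pow_ne_zero N d.t₂_ne
  rw [div_pow, div_pow, mul_pow]
  rw [mul_pow] at h2
  field_simp
  linear_combination t₁ ^ N * h3 + h1 - h2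

/-- Each of the three dilogarithms in the summand contributes its recurrence. The factor `ω^{-γ}` is
isolated because it depends on the summation index and has to be eliminated before summing. -/
theorem fiveTerm_rec₃ (hN : Odd N) (d : FiveData N s₁ s₃ t₁ t₂ t₃) (i j γ : ZMod N) :
    t₃ * wpow N (-γ) * fiveTerm N s₁ s₃ t₁ t₂ t₃ i j γ =
      wpow N j * fiveTerm N s₁ s₃ t₁ t₂ t₃ i j γ -
        s₃ * fiveTerm N s₁ s₃ t₁ t₂ t₃ i (j - 1) γ := by
  have h := fd_rec hN d.s₃_ne d.eq₃ (j + γ)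
  have e1 : j - 1 + γ = j + γ - 1 := by ring
  have e2 : wpow N (γ * (γ + (j - 1))) = wpow N (-γ) * wpow N (γ * (γ + j)) := by
    rw [← wpow_add]; congr 1; ring
  have e3 : wpow N j = wpow N (-γ) * wpow N (j + γ) := by
    rw [← wpow_add]; congr 1; ring
  unfold fiveTerm
  rw [e1, e2, e3]
  linear_combination (-wpow N (-γ) * wpow N (γ * (γ + j)) *
    fd N (t₁ * t₃ / t₂) (s₁ / t₂) γ * fd N (t₂ / t₃) (-(s₁ * s₃ / t₃)) (i - γ)) * h

theorem fiveTerm_rec₄ (hN : Odd N) (d : FiveData N s₁ s₃ t₁ t₂ t₃) (i j γ : ZMod N) :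
    t₂ * fiveTerm N s₁ s₃ t₁ t₂ t₃ i j γ =
      t₃ * wpow N (i - γ) * fiveTerm N s₁ s₃ t₁ t₂ t₃ i j γ +
        s₁ * s₃ * fiveTerm N s₁ s₃ t₁ t₂ t₃ (i - 1) j γ := by
  have h := fd_rec hN d.s₄_ne (d.eq₄ hN) (i - γ)
  have e1 : i - 1 - γ = i - γ - 1 := by ring
  have h3 := d.t₃_ne
  unfold fiveTerm
  rw [e1]
  have h' : t₂ * fd N (t₂ / t₃) (-(s₁ * s₃ / t₃)) (i - γ) =
      t₃ * wpow N (i - γ) * fd N (t₂ / t₃) (-(s₁ * s₃ / t₃)) (i - γ) +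
        s₁ * s₃ * fd N (t₂ / t₃) (-(s₁ * s₃ / t₃)) (i - γ - 1) := by
    have e2 : t₂ = t₃ * (t₂ / t₃) := by field_simp
    have e3 : s₁ * s₃ = t₃ * (s₁ * s₃ / t₃) := by field_simp
    generalize fd N (t₂ / t₃) (-(s₁ * s₃ / t₃)) (i - γ) = u at *
    generalize fd N (t₂ / t₃) (-(s₁ * s₃ / t₃)) (i - γ - 1) = v at *
    rw [e3]
    nth_rewrite 1 [e2]
    linear_combination (-t₃) * h
  linear_combination (wpow N (γ * (γ + j)) * fd N (t₁ * t₃ / t₂) (s₁ / t₂) γ *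
    fd N t₃ s₃ (j + γ)) * h'

theorem fiveTerm_rec₅ (hN : Odd N) (d : FiveData N s₁ s₃ t₁ t₂ t₃) (i j γ : ZMod N) :
    t₁ * (t₃ * wpow N (-γ) * fiveTerm N s₁ s₃ t₁ t₂ t₃ i j γ) =
      t₂ * fiveTerm N s₁ s₃ t₁ t₂ t₃ i j γ -
        s₁ * wpow N j * fiveTerm N s₁ s₃ t₁ t₂ t₃ (i - 1) (j + 1) (γ - 1) := by
  have h := fd_rec hN d.s₅_ne d.eq₅ γ
  have e1 : i - 1 - (γ - 1) = i - γ := by ring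
  have e2 : j + 1 + (γ - 1) = j + γ := by ring
  have e3 : wpow N j * wpow N ((γ - 1) * (γ - 1 + (j + 1))) =
      wpow N (-γ) * wpow N (γ * (γ + j)) := by
    rw [← wpow_add, ← wpow_add]; congr 1; ring
  have e4 : wpow N γ * wpow N (-γ) = 1 := by rw [← wpow_add, add_neg_cancel, wpow_zero]
  have h2 := d.t₂_ne
  unfold fiveTerm
  rw [e1, e2]
  have h' : t₁ * t₃ * fd N (t₁ * t₃ / t₂) (s₁ / t₂) γ =
      t₂ * wpow N γ * fd N (t₁ * t₃ / t₂) (s₁ / t₂) γ -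
        s₁ * fd N (t₁ * t₃ / t₂) (s₁ / t₂) (γ - 1) := by
    have e5 : t₁ * t₃ = t₂ * (t₁ * t₃ / t₂) := by field_simp
    have e6 : s₁ = t₂ * (s₁ / t₂) := by field_simp
    generalize fd N (t₁ * t₃ / t₂) (s₁ / t₂) γ = u at *
    generalize fd N (t₁ * t₃ / t₂) (s₁ / t₂) (γ - 1) = v at *
    rw [e5]
    nth_rewrite 1 [e6]
    linear_combination (-t₂) * h
  generalize fd N (t₁ * t₃ / t₂) (s₁ / t₂) γ = u at *
  generalize fd N (t₁ * t₃ / t₂) (s₁ / t₂) (γ - 1) = v at *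
  generalize fd N t₃ s₃ (j + γ) = p at *
  generalize fd N (t₂ / t₃) (-(s₁ * s₃ / t₃)) (i - γ) = q at *
  linear_combination (wpow N (-γ) * wpow N (γ * (γ + j)) * p * q) * h' +
    (t₂ * wpow N (γ * (γ + j)) * u * p * q) * e4 + (s₁ * v * p * q) * e3

/-- Eliminates `ω^{-γ}` between the relations of the second and third dilogarithms; the rest has
coefficients free of `γ` and can be summed. -/
theorem fiveSum_recA (hN : Odd N) (d : FiveData N s₁ s₃ t₁ t₂ t₃) (i j : ZMod N) :
    (wpow N (i + j) - t₂) * fiveSum N s₁ s₃ t₁ t₂ t₃ i j =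
      s₃ * (wpow N i * fiveSum N s₁ s₃ t₁ t₂ t₃ i (j - 1) -
        s₁ * fiveSum N s₁ s₃ t₁ t₂ t₃ (i - 1) j) := by
  simp only [fiveSum, Finset.mul_sum, ← Finset.sum_sub_distrib]
  refine Finset.sum_congr rfl fun γ _ => ?_
  have h3 := fiveTerm_rec₃ hN d i j γ
  have h4 := fiveTerm_rec₄ hN d i j γ
  rw [sub_eq_add_neg i γ, wpow_add] at h4
  rw [wpow_add]
  linear_combination (-1) * h4 - wpow N i * h3

/-- Eliminates `ω^{-γ}` between the relations of the first and second dilogarithms; the shift of `γ`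
disappears in a cyclic sum. -/
theorem fiveSum_recC (hN : Odd N) (d : FiveData N s₁ s₃ t₁ t₂ t₃) (i j : ZMod N) :
    t₁ * (wpow N j * fiveSum N s₁ s₃ t₁ t₂ t₃ i j - s₃ * fiveSum N s₁ s₃ t₁ t₂ t₃ i (j - 1)) =
      t₂ * fiveSum N s₁ s₃ t₁ t₂ t₃ i j -
        s₁ * wpow N j * fiveSum N s₁ s₃ t₁ t₂ t₃ (i - 1) (j + 1) := by
  have e : fiveSum N s₁ s₃ t₁ t₂ t₃ (i - 1) (j + 1) =
      ∑ γ : ZMod N, fiveTerm N s₁ s₃ t₁ t₂ t₃ (i - 1) (j + 1) (γ - 1) :=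
    (Fintype.sum_equiv (Equiv.subRight 1) _ _ fun γ => by simp).symm
  rw [e]
  simp only [fiveSum, Finset.mul_sum, ← Finset.sum_sub_distrib]
  refine Finset.sum_congr rfl fun γ _ => ?_
  have h3 := fiveTerm_rec₃ hN d i j γ
  have h5 := fiveTerm_rec₅ hN d i j γ
  linear_combination h5 - t₁ * h3

theorem prod_wpow (hN : Odd N) : ∏ k : ZMod N, wpow N k = 1 := by
  have h := one_sub_pow_eq_prod_wpow_sub hN 0
  simpa [NeZero.ne N] using h.symm

/-- The defect `B` of this relation satisfies `ω^j B(j) = s₃ B(j-1)` by the two previous relations.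
Multiplying over all `j` gives `(1 - s₃^N) ∏ B = 0`, and `1 - s₃^N = t₃^N ≠ 0`; so `B` vanishes
somewhere, hence everywhere. -/
theorem fiveSum_recB (hN : Odd N) (d : FiveData N s₁ s₃ t₁ t₂ t₃) (i j : ZMod N) :
    (wpow N i - t₁) * fiveSum N s₁ s₃ t₁ t₂ t₃ i j =
      s₁ * fiveSum N s₁ s₃ t₁ t₂ t₃ (i - 1) (j + 1) := by
  set B : ZMod N → ℂ := fun j => (wpow N i - t₁) * fiveSum N s₁ s₃ t₁ t₂ t₃ i j -
      s₁ * fiveSum N s₁ s₃ t₁ t₂ t₃ (i - 1) (j + 1) with hB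
  have hrec : ∀ j, wpow N j * B j = s₃ * B (j - 1) := by
    intro j
    have hA := fiveSum_recA hN d i j
    have hC := fiveSum_recC hN d i j
    simp only [hB, sub_add_cancel]
    rw [wpow_add] at hA
    linear_combination hA - hC
  have hprod : ∏ j : ZMod N, wpow N j * B j = ∏ j : ZMod N, s₃ * B (j - 1) :=
    Finset.prod_congr rfl fun j _ => hrec j
  rw [Finset.prod_mul_distrib, Finset.prod_mul_distrib, prod_wpow hN, one_mul, Finset.prod_const,
    Finset.card_univ, ZMod.card,
    (Fintype.prod_equiv (Equiv.subRight 1) (fun j => B (j - 1)) B fun j => by simp)] at hprod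
  have h0 : ∏ j : ZMod N, B j = 0 := by
    have h1 : (1 - s₃ ^ N) * ∏ j : ZMod N, B j = 0 := by linear_combination hprod
    refine (mul_eq_zero.mp h1).resolve_left ?_
    have := pow_ne_zero N d.t₃_ne
    rwa [← d.eq₃, add_sub_cancel_right]
  obtain ⟨j₀, -, hj₀⟩ := Finset.prod_eq_zero_iff.mp h0
  have hall : ∀ n : ℕ, B (j₀ + n) = 0 := by
    intro n
    induction n with
    | zero => simpa using hj₀
    | succ n ih =>
      have h := hrec (j₀ + (n + 1 : ℕ))
      have e : j₀ + ((n + 1 : ℕ) : ZMod N) - 1 = j₀ + n := by push_cast; ring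
      rw [e, ih, mul_zero] at h
      exact (mul_eq_zero.mp h).resolve_left (wpow_ne_zero N _)
  have := hall (j - j₀).val
  rw [ZMod.natCast_zmod_val, add_sub_cancel] at this
  exact sub_eq_zero.mp this

/-- The five-term identity of cyclic dilogarithms, up to its constant. -/
theorem fiveSum_eq (hN : Odd N) (d : FiveData N s₁ s₃ t₁ t₂ t₃) (i j : ZMod N) :
    fiveSum N s₁ s₃ t₁ t₂ t₃ i j =
      fiveSum N s₁ s₃ t₁ t₂ t₃ 0 0 * fd N t₁ s₁ i * fd N t₂ (t₁ * s₃) (i + j) := by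
  -- With `i + j = s` fixed, `fiveSum_recB` is the recurrence of the dilogarithm at `(t₁, s₁)`.
  have h1 : ∀ s i, fiveSum N s₁ s₃ t₁ t₂ t₃ i (s - i) =
      fiveSum N s₁ s₃ t₁ t₂ t₃ 0 s * fd N t₁ s₁ i := by
    intro s i
    have := eq_mul_fd_of_rec hN d.s₁_ne d.eq₁ (u := fun i => fiveSum N s₁ s₃ t₁ t₂ t₃ i (s - i))
      (fun n => by
        have e : s - (n - 1) = s - n + 1 := by ring
        rw [e]
        exact fiveSum_recB hN d n (s - n)) i
    simpa using this
  -- At `i = 0`, `fiveSum_recB` replaces the term at `(-1, n)` in `fiveSum_recA` by one at `(0,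
  -- n-1)`; what is left is the recurrence at `(t₂, t₁s₃)`.
  have h2 : ∀ s, fiveSum N s₁ s₃ t₁ t₂ t₃ 0 s =
      fiveSum N s₁ s₃ t₁ t₂ t₃ 0 0 * fd N t₂ (t₁ * s₃) s := by
    refine eq_mul_fd_of_rec hN d.s₂_ne d.eq₂ fun n => ?_
    have hA := fiveSum_recA hN d 0 n
    have hB := fiveSum_recB hN d 0 (n - 1)
    rw [sub_add_cancel, wpow_zero] at hB
    rw [zero_add, wpow_zero] at hA
    linear_combination hA + s₃ * hB
  have h3 := h1 (i + j) i
  rw [add_sub_cancel_left, h2] at h3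
  rw [h3]; ring

end FiveData

/-! ### Determinants, and the `N`-th power of the five-term constant. -/

/-- The bijection between `Fin N` and `ZMod N` given by the representatives `0, …, N - 1`. -/
def finZMod (N : ℕ) [NeZero N] : Fin N ≃ ZMod N where
  toFun i := (i.val : ZMod N)
  invFun k := ⟨k.val, ZMod.val_lt k⟩
  left_inv i := by ext; simpa using ZMod.val_cast_of_lt i.isLt
  right_inv k := by simp

theorem finZMod_val (i : Fin N) : (finZMod N i).val = i.val := ZMod.val_cast_of_lt i.isLt

theorem det_eval_eq_det_vandermonde (P : ℕ → Polynomial ℂ) (hdeg : ∀ j, (P j).natDegree = j)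
    (hmonic : ∀ j, (P j).Monic) (v : ZMod N → ℂ) :
    Matrix.det (Matrix.of fun i j : ZMod N => (P j.val).eval (v i)) =
      (Matrix.vandermonde fun i : Fin N => v (finZMod N i)).det := by
  rw [Matrix.det_eval_matrixOfPolynomials_eq_det_vandermonde _ (fun j : Fin N => P j.val)
    (fun j => hdeg _) (fun j => hmonic _), ← Matrix.det_submatrix_equiv_self (finZMod N)]
  congr 1
  ext i j
  simp [finZMod_val]

theorem prod_X_sub_C_monic (r : ℕ → ℂ) (j : ℕ) :
    (∏ k ∈ Finset.range j, (Polynomial.X - Polynomial.C (r k))).Monic :=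
  Polynomial.monic_prod_of_monic _ _ fun _ _ => Polynomial.monic_X_sub_C _

theorem prod_X_sub_C_natDegree (r : ℕ → ℂ) (j : ℕ) :
    (∏ k ∈ Finset.range j, (Polynomial.X - Polynomial.C (r k))).natDegree = j := by
  rw [Polynomial.natDegree_prod_of_monic _ _ fun _ _ => Polynomial.monic_X_sub_C _]
  simp

theorem prod_range_prod_range {M : Type*} [CommMonoid M] (a : ℕ → M) (n : ℕ) :
    ∏ m ∈ Finset.range n, ∏ j ∈ Finset.range m, a j =
      ∏ j ∈ Finset.range n, a (n - 1 - j) ^ j := by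
  have h : ∏ m ∈ Finset.range n, ∏ j ∈ Finset.range m, a j =
      ∏ j ∈ Finset.range n, a j ^ (n - 1 - j) := by
    induction n with
    | zero => simp
    | succ n ih =>
      rw [Finset.prod_range_succ, ih, Finset.prod_range_succ, ← Finset.prod_mul_distrib]
      simp only [Nat.add_sub_cancel, Nat.sub_self, pow_zero, mul_one]
      refine Finset.prod_congr rfl fun j hj => ?_
      rw [← pow_succ]
      congr 1
      have := Finset.mem_range.mp hj
      omega
  rw [h, ← Finset.prod_range_reflect]
  refine Finset.prod_congr rfl fun j hj => ?_
  congr 1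
  have := Finset.mem_range.mp hj
  omega

/-- The triangular number `0 + 1 + ⋯ + (N - 1)`. -/
def tri (N : ℕ) : ℕ := ∑ j ∈ Finset.range N, j

theorem tri_eq (hN : Odd N) : tri N = (N - 1) / 2 * N := by
  obtain ⟨k, rfl⟩ := hN
  have h := Finset.sum_range_id_mul_two (2 * k + 1)
  have h2 : (2 * k + 1 - 1) / 2 = k := by omega
  rw [tri, h2]
  have h3 : 2 * k + 1 - 1 = 2 * k := by omega
  rw [h3] at h
  nlinarith

theorem prod_pow_val (a : ℂ) : ∏ j : ZMod N, a ^ j.val = a ^ tri N := by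
  rw [prod_zmod_eq_prod_range (fun j => a ^ j), Finset.prod_pow_eq_pow_sum, tri]

/-- The product of the `ω ^ (j ^ 2)`. -/
noncomputable def sqPhase (N : ℕ) : ℂ := ∏ j ∈ Finset.range N, root N ^ (j ^ 2)

theorem sqPhase_ne_zero (N : ℕ) : sqPhase N ≠ 0 :=
  Finset.prod_ne_zero_iff.mpr fun _ _ => pow_ne_zero _ (root_ne_zero N)

theorem sqPhase_eq (N : ℕ) [NeZero N] : sqPhase N = ∏ k : ZMod N, wpow N (k ^ 2) := by
  rw [sqPhase, ← prod_zmod_eq_prod_range (fun j => root N ^ (j ^ 2))]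
  refine Finset.prod_congr rfl fun k _ => ?_
  rw [← wpow_natCast]
  simp

theorem root_pow_sub {j : ℕ} (hj : j < N) : root N ^ (N - 1 - j + 1) = (root N ^ j)⁻¹ := by
  apply eq_inv_of_mul_eq_one_left
  rw [← pow_add]
  have : N - 1 - j + 1 + j = N := by omega
  rw [this, root_pow]

/-- In the product over `n` the factor with index `j + 1` occurs `N - 1 - j` times; after reflection
of the index, the denominator is the product whose `N`-th roots are the values of `g`. -/
theorem prod_fd (t s : ℂ) :
    ∏ n : ZMod N, fd N t s n =
      s ^ tri N * sqPhase N / ∏ j ∈ Finset.range N, (1 - t * root N ^ j) ^ j := by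
  have h1 : ∏ n : ZMod N, fd N t s n =
      ∏ n ∈ Finset.range N, ∏ j ∈ Finset.range n, s / (root N ^ (j + 1) - t) :=
    prod_zmod_eq_prod_range (fun n => ∏ j ∈ Finset.range n, s / (root N ^ (j + 1) - t))
  rw [h1, prod_range_prod_range, tri, ← Finset.prod_pow_eq_pow_sum, sqPhase,
    ← Finset.prod_mul_distrib, ← Finset.prod_div_distrib]
  refine Finset.prod_congr rfl fun j hj => ?_
  rw [root_pow_sub (Finset.mem_range.mp hj), sq, pow_mul, ← mul_pow, ← div_pow]
  congr 1
  have hw : root N ^ j ≠ 0 := pow_ne_zero _ (root_ne_zero N)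
  have h2 : (root N ^ j)⁻¹ - t = (1 - t * root N ^ j) / root N ^ j := by field_simp
  rw [h2, div_div_eq_mul_div]

theorem fd_sub_natCast (hN : Odd N) {t s : ℂ} (hs : s ≠ 0) (h : t ^ N + s ^ N = 1) (i : ZMod N)
    (m : ℕ) : fd N t s (i - m) =
      fd N t s i * ∏ k ∈ Finset.range m, ((wpow N (i - k) - t) / s) := by
  induction m with
  | zero => simp
  | succ m ih =>
    have h1 := fd_rec hN hs h (i - m)
    have e : i - ((m + 1 : ℕ) : ZMod N) = i - m - 1 := by push_cast; ring
    rw [e, Finset.prod_range_succ, ← mul_assoc, ← ih]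
    field_simp
    linear_combination -h1

/-- By the recurrence, the entry is `fd N t s i` times a polynomial in `ω^i` of degree `j`. Rows and
leading coefficients factor out, and monic polynomials of increasing degree give a Vandermonde
determinant, in which `t` no longer appears. -/
theorem det_fd_sub (hN : Odd N) {t s : ℂ} (hs : s ≠ 0) (h : t ^ N + s ^ N = 1) :
    Matrix.det (Matrix.of fun i j : ZMod N => fd N t s (i - j)) =
      (∏ n : ZMod N, fd N t s n) * (s⁻¹ ^ tri N *
        (∏ j : ZMod N, ∏ k ∈ Finset.range j.val, wpow N (-(k : ZMod N))) *
        (Matrix.vandermonde fun i : Fin N => wpow N (finZMod N i)).det) := by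
  rw [← det_eval_eq_det_vandermonde
    (fun j => ∏ k ∈ Finset.range j, (Polynomial.X - Polynomial.C (t * wpow N k)))
    (prod_X_sub_C_natDegree _) (prod_X_sub_C_monic _), ← prod_pow_val, ← Finset.prod_mul_distrib,
    ← Matrix.det_mul_row, ← Matrix.det_mul_column]
  congr 1
  ext i j
  simp only [Matrix.of_apply]
  have := fd_sub_natCast hN hs h i j.val
  rw [ZMod.natCast_zmod_val] at this
  rw [this]
  congr 1
  rw [Polynomial.eval_prod, ← Finset.card_range j.val, ← Finset.prod_const, Finset.card_range,
    ← Finset.prod_mul_distrib, ← Finset.prod_mul_distrib]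
  refine Finset.prod_congr rfl fun k _ => ?_
  have hw := wpow_ne_zero N k
  simp only [Polynomial.eval_sub, Polynomial.eval_X, Polynomial.eval_C]
  rw [wpow_sub, wpow_neg]
  field_simp

/-- The same argument with `ω^{i(i-j)} = ω^{i²} (ω^{-i})^j`: distributing one `ω^{-i}` to each of
the `j` factors makes the column a polynomial in `ω^{-i}`, with roots `ω^{-k}/t`. -/
theorem det_wpow_mul_fd_sub (hN : Odd N) {t s : ℂ} (hs : s ≠ 0) (ht : t ≠ 0)
    (h : t ^ N + s ^ N = 1) :
    Matrix.det (Matrix.of fun i j : ZMod N => wpow N (i * (i - j)) * fd N t s (i - j)) =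
      (sqPhase N * ∏ n : ZMod N, fd N t s n) * ((-(t / s)) ^ tri N *
        (Matrix.vandermonde fun i : Fin N => wpow N (-(finZMod N i))).det) := by
  rw [← det_eval_eq_det_vandermonde
    (fun j => ∏ k ∈ Finset.range j, (Polynomial.X - Polynomial.C (wpow N (-(k : ZMod N)) / t)))
    (prod_X_sub_C_natDegree _) (prod_X_sub_C_monic _) (fun i => wpow N (-i)), ← prod_pow_val,
    sqPhase_eq, ← Finset.prod_mul_distrib, ← Matrix.det_mul_row, ← Matrix.det_mul_column]
  congr 1
  ext i j
  simp only [Matrix.of_apply]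
  have := fd_sub_natCast hN hs h i j.val
  rw [ZMod.natCast_zmod_val] at this
  have e : wpow N (i * (i - j)) = wpow N (i ^ 2) * ∏ k ∈ Finset.range j.val, wpow N (-i) := by
    rw [Finset.prod_const, Finset.card_range, wpow_pow, ← wpow_add, ZMod.natCast_zmod_val]
    congr 1; ring
  have e2 : (-(t / s)) ^ j.val = ∏ k ∈ Finset.range j.val, (-(t / s)) := by simp
  rw [this, e, Polynomial.eval_prod, e2, ← Finset.prod_mul_distrib]
  have e3 : ∏ k ∈ Finset.range j.val, (-(t / s) * Polynomial.eval (wpow N (-i))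
      (Polynomial.X - Polynomial.C (wpow N (-(k : ZMod N)) / t))) =
      (∏ k ∈ Finset.range j.val, wpow N (-i)) *
        ∏ k ∈ Finset.range j.val, ((wpow N (i - k) - t) / s) := by
    rw [← Finset.prod_mul_distrib]
    refine Finset.prod_congr rfl fun k _ => ?_
    have hw := wpow_ne_zero N k
    have hw2 := wpow_ne_zero N i
    simp only [Polynomial.eval_sub, Polynomial.eval_X, Polynomial.eval_C]
    rw [wpow_sub, wpow_neg, wpow_neg]
    field_simp
    ring
  rw [e3]
  ring

theorem prod_fin_prod_Ioi {M : Type*} [CommMonoid M] (n : ℕ) (f : ℕ → ℕ → M) :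
    ∏ i : Fin n, ∏ j ∈ Finset.Ioi i, f i j = ∏ j ∈ Finset.range n, ∏ i ∈ Finset.range j, f i j := by
  rw [Finset.prod_sigma', Finset.prod_sigma']
  refine Finset.prod_bij' (fun p _ => ⟨p.2.val, p.1.val⟩)
    (fun q hq => ⟨⟨q.2, ?_⟩, ⟨q.1, ?_⟩⟩) ?_ ?_ ?_ ?_ ?_
  all_goals simp_all
  all_goals omega

/-- Up to explicit phases this is the `N`-th power of `g(1)`, which accounts for the division by
`g(1)` in `h`. -/
theorem det_vandermonde_wpow_neg (N : ℕ) [NeZero N] :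
    (Matrix.vandermonde fun i : Fin N => wpow N (-(finZMod N i))).det =
      (-1) ^ tri N * (sqPhase N)⁻¹ ^ 2 * ∏ j ∈ Finset.range N, (1 - 1 * root N ^ j) ^ j := by
  have hr := root_ne_zero N
  rw [Matrix.det_vandermonde]
  have h1 : ∀ i : Fin N, wpow N (-(finZMod N i)) = (root N ^ i.val)⁻¹ := fun i => by
    rw [wpow_neg]; congr 1; exact wpow_natCast _
  simp only [h1]
  rw [prod_fin_prod_Ioi N (fun i j => (root N ^ j)⁻¹ - (root N ^ i)⁻¹)]
  have h2 : ∀ j ∈ Finset.range N, ∏ i ∈ Finset.range j, ((root N ^ j)⁻¹ - (root N ^ i)⁻¹) =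
      (root N ^ (j ^ 2))⁻¹ * ∏ d ∈ Finset.range j, (1 - root N ^ (d + 1)) := by
    intro j _
    have e0 : (root N ^ (j ^ 2))⁻¹ = ∏ d ∈ Finset.range j, (root N ^ j)⁻¹ := by
      rw [Finset.prod_const, Finset.card_range, sq, pow_mul, inv_pow (root N ^ j)]
    rw [← Finset.prod_range_reflect (fun d => 1 - root N ^ (d + 1)), e0, ← Finset.prod_mul_distrib]
    refine Finset.prod_congr rfl fun i hi => ?_
    have := Finset.mem_range.mp hi
    have e : root N ^ j = root N ^ (j - 1 - i + 1) * root N ^ i := by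
      rw [← pow_add]; congr 1; omega
    rw [e]
    field_simp
  rw [Finset.prod_congr rfl h2, Finset.prod_mul_distrib, Finset.prod_inv_distrib,
    prod_range_prod_range, tri, ← Finset.prod_pow_eq_pow_sum, ← sqPhase]
  have h3 : ∏ j ∈ Finset.range N, (1 - root N ^ (N - 1 - j + 1)) ^ j =
      (∏ j ∈ Finset.range N, (-1 : ℂ) ^ j) * (sqPhase N)⁻¹ *
        ∏ j ∈ Finset.range N, (1 - 1 * root N ^ j) ^ j := by
    rw [sqPhase, ← Finset.prod_inv_distrib, ← Finset.prod_mul_distrib, ← Finset.prod_mul_distrib]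
    refine Finset.prod_congr rfl fun j hj => ?_
    rw [root_pow_sub (Finset.mem_range.mp hj), sq, pow_mul,
      ← inv_pow (root N ^ j), ← mul_pow, ← mul_pow]
    congr 1
    have hw : root N ^ j ≠ 0 := pow_ne_zero _ hr
    field_simp
    ring
  rw [h3]
  ring

/-- The exponent `P = (N-1)/2` in `h` is chosen so that `P N` is the triangular number `tri N`, the
exponent occurring in the determinants. -/
theorem hFun_pow (hN : Odd N) {g : ℂ → ℂ} (hg : IsDetermination N g) (x : ℂ) :
    hFun N g x ^ N = (x ^ tri N)⁻¹ * ((∏ j ∈ Finset.range N, (1 - x * root N ^ j) ^ j) /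
      ∏ j ∈ Finset.range N, (1 - 1 * root N ^ j) ^ j) := by
  rw [hFun, mul_pow, div_pow, hg, hg, inv_pow, ← pow_mul, ← tri_eq hN]

theorem prod_one_sub_pow_ne_zero {t : ℂ} (h : t ^ N ≠ 1) :
    ∏ j ∈ Finset.range N, (1 - t * root N ^ j) ^ j ≠ 0 := by
  refine Finset.prod_ne_zero_iff.mpr fun j _ => pow_ne_zero _ fun h0 => h ?_
  have h1 : t * root N ^ j = 1 := (sub_eq_zero.mp h0).symm
  rw [← wpow_natCast] at h1
  have := congrArg (· ^ N) h1
  simpa [mul_pow, wpow_pow_card] using this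

theorem prod_one_sub_root_ne_zero (N : ℕ) [NeZero N] :
    ∏ j ∈ Finset.range N, (1 - 1 * root N ^ j) ^ j ≠ 0 := by
  refine Finset.prod_ne_zero_iff.mpr fun j hj => ?_
  rcases j with _ | j
  · simp
  · refine pow_ne_zero _ fun h0 => ?_
    refine (root_isPrimitiveRoot N).pow_ne_one_of_pos_of_lt (Nat.succ_ne_zero j)
      (Finset.mem_range.mp hj) ?_
    rw [Nat.succ_eq_add_one]
    linear_combination -h0

theorem hFun_ne_zero (hN : Odd N) {g : ℂ → ℂ} (hg : IsDetermination N g) {x : ℂ} (hx : x ≠ 0)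
    (h : x ^ N ≠ 1) : hFun N g x ≠ 0 := by
  intro h0
  have h1 := hFun_pow hN hg x
  rw [h0, zero_pow (NeZero.ne N)] at h1
  exact mul_ne_zero (inv_ne_zero (pow_ne_zero _ hx)) (div_ne_zero (prod_one_sub_pow_ne_zero h)
    (prod_one_sub_root_ne_zero N)) h1.symm

namespace FiveData

variable {s₁ s₃ t₁ t₂ t₃ : ℂ}

/-- With `j` replaced by `-j` the five-term identity is an equality of matrix products: diagonal
times circulant on one side; circulant, diagonal and twisted circulant on the other. -/
theorem fiveSum_det (hN : Odd N) (d : FiveData N s₁ s₃ t₁ t₂ t₃) :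
    fiveSum N s₁ s₃ t₁ t₂ t₃ 0 0 ^ N * (∏ n : ZMod N, fd N t₁ s₁ n) *
      ((∏ n : ZMod N, fd N t₂ (t₁ * s₃) n) * (t₁ * s₃)⁻¹ ^ tri N) =
    ((∏ n : ZMod N, fd N (t₂ / t₃) (-(s₁ * s₃ / t₃)) n) * (-(s₁ * s₃ / t₃))⁻¹ ^ tri N) *
      (∏ n : ZMod N, fd N (t₁ * t₃ / t₂) (s₁ / t₂) n) *
      ((sqPhase N * ∏ n : ZMod N, fd N t₃ s₃ n) * ((-(t₃ / s₃)) ^ tri N *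
        (Matrix.vandermonde fun i : Fin N => wpow N (-(finZMod N i))).det)) := by
  have hM : (Matrix.of fun i j : ZMod N => (fiveSum N s₁ s₃ t₁ t₂ t₃ 0 0 * fd N t₁ s₁ i) *
        (Matrix.of fun i j : ZMod N => fd N t₂ (t₁ * s₃) (i - j)) i j) =
      (Matrix.of fun i j : ZMod N => fd N (t₂ / t₃) (-(s₁ * s₃ / t₃)) (i - j)) *
        (Matrix.of fun i j : ZMod N => fd N (t₁ * t₃ / t₂) (s₁ / t₂) i *
          (Matrix.of fun i j : ZMod N => wpow N (i * (i - j)) * fd N t₃ s₃ (i - j)) i j) := by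
    ext i j
    have h := d.fiveSum_eq hN i (-j)
    rw [← sub_eq_add_neg] at h
    rw [Matrix.of_apply, Matrix.of_apply, ← h, fiveSum, Matrix.mul_apply]
    refine Finset.sum_congr rfl fun γ _ => ?_
    simp only [Matrix.of_apply, fiveTerm]
    have e : -j + γ = γ - j := by ring
    rw [e, ← sub_eq_add_neg]
    ring
  have h := congrArg Matrix.det hM
  rw [Matrix.det_mul, Matrix.det_mul_column, Matrix.det_mul_column, det_fd_sub hN d.s₂_ne d.eq₂,
    det_fd_sub hN d.s₄_ne (d.eq₄ hN), det_wpow_mul_fd_sub hN d.s₃_ne d.t₃_ne d.eq₃,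
    Finset.prod_mul_distrib, Finset.prod_const, Finset.card_univ, ZMod.card] at h
  -- These two factors occur once on each side and cancel, so only the Vandermonde determinant in
  -- the `ω^{-i}` has to be evaluated.
  have hk : ∏ j : ZMod N, ∏ k ∈ Finset.range j.val, wpow N (-(k : ZMod N)) ≠ 0 :=
    Finset.prod_ne_zero_iff.mpr fun j _ => Finset.prod_ne_zero_iff.mpr fun k _ => wpow_ne_zero N _
  have hV : (Matrix.vandermonde fun i : Fin N => wpow N (finZMod N i)).det ≠ 0 := by
    rw [Matrix.det_vandermonde_ne_zero_iff]
    exact (wpow_injective N).comp (finZMod N).injective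
  refine mul_right_cancel₀ (mul_ne_zero hk hV) ?_
  linear_combination h

theorem fiveSum_pow (hN : Odd N) (d : FiveData N s₁ s₃ t₁ t₂ t₃) {g : ℂ → ℂ}
    (hg : IsDetermination N g) :
    (fiveSum N s₁ s₃ t₁ t₂ t₃ 0 0 *
      (hFun N g (t₁ * t₃ / t₂) * hFun N g t₃ * hFun N g (t₂ / t₃))) ^ N =
      (hFun N g t₁ * hFun N g t₂) ^ N := by
  have h := d.fiveSum_det hN
  have hκ := sqPhase_ne_zero N
  have g1 := prod_one_sub_root_ne_zero N
  have p1 := prod_one_sub_pow_ne_zero (pow_ne_one_of_add d.s₁_ne d.eq₁)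
  have p2 := prod_one_sub_pow_ne_zero (pow_ne_one_of_add d.s₂_ne d.eq₂)
  have p3 := prod_one_sub_pow_ne_zero (pow_ne_one_of_add d.s₃_ne d.eq₃)
  have p4 := prod_one_sub_pow_ne_zero (pow_ne_one_of_add d.s₄_ne (d.eq₄ hN))
  have p5 := prod_one_sub_pow_ne_zero (pow_ne_one_of_add d.s₅_ne d.eq₅)
  rw [det_vandermonde_wpow_neg] at h
  simp only [prod_fd] at h
  simp only [mul_pow, hFun_pow hN hg]
  generalize ∏ j ∈ Finset.range N, (1 - 1 * root N ^ j) ^ j = γ₀ at *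
  generalize ∏ j ∈ Finset.range N, (1 - t₁ * root N ^ j) ^ j = γ₁ at *
  generalize ∏ j ∈ Finset.range N, (1 - t₂ * root N ^ j) ^ j = γ₂ at *
  generalize ∏ j ∈ Finset.range N, (1 - t₃ * root N ^ j) ^ j = γ₃ at *
  generalize ∏ j ∈ Finset.range N, (1 - t₂ / t₃ * root N ^ j) ^ j = γ₄ at *
  generalize ∏ j ∈ Finset.range N, (1 - t₁ * t₃ / t₂ * root N ^ j) ^ j = γ₅ at *
  generalize fiveSum N s₁ s₃ t₁ t₂ t₃ 0 0 ^ N = c at *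
  generalize sqPhase N = κ at *
  generalize tri N = n at *
  have a1 := pow_ne_zero n d.s₁_ne
  have a2 := pow_ne_zero n d.s₃_ne
  have a3 := pow_ne_zero n d.t₁_ne
  have a4 := pow_ne_zero n d.t₂_ne
  have a5 := pow_ne_zero n d.t₃_ne
  have hm : ((-1 : ℂ) ^ n) * (-1) ^ n = 1 := by rw [← mul_pow]; simp
  have hm0 : ((-1 : ℂ) ^ n) ≠ 0 := pow_ne_zero _ (by norm_num)
  simp only [neg_pow (s₁ * s₃ / t₃), neg_pow (t₃ / s₃), inv_pow, mul_pow, div_pow] at h ⊢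
  generalize s₁ ^ n = a₁ at *
  generalize s₃ ^ n = a₃ at *
  generalize t₁ ^ n = b₁ at *
  generalize t₂ ^ n = b₂ at *
  generalize t₃ ^ n = b₃ at *
  generalize (-1 : ℂ) ^ n = m at *
  have hh : c * γ₃ * γ₄ * γ₅ * b₂ = γ₁ * γ₂ * γ₀ * b₃ := by
    field_simp at h
    linear_combination h + (γ₁ * γ₂ * b₃ * γ₀) * hm
  field_simp
  linear_combination hh

end FiveData

/-! ### Intertwiners of representations of the Weyl algebra. -/

section Weyl

variable {m n p : Type} [Fintype m] [DecidableEq m] [Fintype n] [DecidableEq n]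
  [Fintype p] [DecidableEq p]

/-- Commutation passes to products and sums, and from `E` to its inverse, so two generators suffice.
-/
theorem mem_intertwiners_iff {π₁ : Weyl N →ₐ[ℂ] Matrix m m ℂ} {π₂ : Weyl N →ₐ[ℂ] Matrix n n ℂ}
    {U : Matrix n m ℂ} : U ∈ intertwiners π₁ π₂ ↔
      U * π₁ (Weyl.gen N .E) = π₂ (Weyl.gen N .E) * U ∧
      U * π₁ (Weyl.gen N .D) = π₂ (Weyl.gen N .D) * U := by
  constructor
  · intro h
    exact ⟨h _, h _⟩
  · rintro ⟨hE, hD⟩ a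
    have hI : U * π₁ (Weyl.gen N .Einv) = π₂ (Weyl.gen N .Einv) * U := by
      have h1 : π₁ (Weyl.gen N .E) * π₁ (Weyl.gen N .Einv) = 1 := by
        rw [← map_mul, Weyl.gen_mul_inv, map_one]
      have h2 : π₂ (Weyl.gen N .Einv) * π₂ (Weyl.gen N .E) = 1 := by
        rw [← map_mul, Weyl.gen_inv_mul, map_one]
      calc U * π₁ (Weyl.gen N .Einv)
          = π₂ (Weyl.gen N .Einv) * (π₂ (Weyl.gen N .E) * U) * π₁ (Weyl.gen N .Einv) := by
            rw [← Matrix.mul_assoc, h2, Matrix.one_mul]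
        _ = π₂ (Weyl.gen N .Einv) * U := by
            rw [← hE, Matrix.mul_assoc, Matrix.mul_assoc, h1, Matrix.mul_one]
    obtain ⟨b, rfl⟩ := RingQuot.mkAlgHom_surjective ℂ (WeylRel N) a
    induction b using FreeAlgebra.induction with
    | grade0 r =>
      rw [AlgHom.commutes, AlgHom.commutes, AlgHom.commutes, Algebra.algebraMap_eq_smul_one,
        Algebra.algebraMap_eq_smul_one, Matrix.mul_smul, Matrix.smul_mul, Matrix.mul_one,
        Matrix.one_mul]
    | grade1 x => cases x <;> assumption
    | mul x y hx hy =>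
      rw [map_mul, map_mul, map_mul, ← Matrix.mul_assoc, hx, Matrix.mul_assoc, hy,
        Matrix.mul_assoc]
    | add x y hx hy => rw [map_add, map_add, map_add, Matrix.mul_add, Matrix.add_mul, hx, hy]

theorem tensorRep_E (π₁ : Weyl N →ₐ[ℂ] Matrix m m ℂ) (π₂ : Weyl N →ₐ[ℂ] Matrix n n ℂ) :
    tensorRep π₁ π₂ (Weyl.gen N .E) = π₁ (Weyl.gen N .E) ⊗ₖ π₂ (Weyl.gen N .E) := by
  simp [tensorRep, Weyl.comul, Weyl.lift, Weyl.gen]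

theorem tensorRep_D (π₁ : Weyl N →ₐ[ℂ] Matrix m m ℂ) (π₂ : Weyl N →ₐ[ℂ] Matrix n n ℂ) :
    tensorRep π₁ π₂ (Weyl.gen N .D) =
      π₁ (Weyl.gen N .E) ⊗ₖ π₂ (Weyl.gen N .D) + π₁ (Weyl.gen N .D) ⊗ₖ 1 := by
  simp [tensorRep, Weyl.comul, Weyl.lift, Weyl.gen]

theorem mul_mem_intertwiners {π₁ : Weyl N →ₐ[ℂ] Matrix m m ℂ} {π₂ : Weyl N →ₐ[ℂ] Matrix n n ℂ}
    {π₃ : Weyl N →ₐ[ℂ] Matrix p p ℂ} {U : Matrix p n ℂ} {V : Matrix n m ℂ}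
    (hU : U ∈ intertwiners π₂ π₃) (hV : V ∈ intertwiners π₁ π₂) : U * V ∈ intertwiners π₁ π₃ := by
  intro a
  rw [Matrix.mul_assoc, hV a, ← Matrix.mul_assoc, hU a, Matrix.mul_assoc]

theorem kronecker_one_mem_intertwiners {π₁ : Weyl N →ₐ[ℂ] Matrix m m ℂ}
    {π₂ : Weyl N →ₐ[ℂ] Matrix n n ℂ} (π₃ : Weyl N →ₐ[ℂ] Matrix p p ℂ) {U : Matrix n m ℂ}
    (hU : U ∈ intertwiners π₁ π₂) :
    U ⊗ₖ (1 : Matrix p p ℂ) ∈ intertwiners (tensorRep π₁ π₃) (tensorRep π₂ π₃) := by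
  rw [mem_intertwiners_iff] at hU ⊢
  simp only [tensorRep_E, tensorRep_D, Matrix.mul_add, Matrix.add_mul, ← Matrix.mul_kronecker_mul,
    hU.1, hU.2, Matrix.mul_one, Matrix.one_mul, and_self]

theorem one_kronecker_mem_intertwiners {π₁ : Weyl N →ₐ[ℂ] Matrix m m ℂ}
    {π₂ : Weyl N →ₐ[ℂ] Matrix n n ℂ} (π₃ : Weyl N →ₐ[ℂ] Matrix p p ℂ) {U : Matrix n m ℂ}
    (hU : U ∈ intertwiners π₁ π₂) :
    (1 : Matrix p p ℂ) ⊗ₖ U ∈ intertwiners (tensorRep π₃ π₁) (tensorRep π₃ π₂) := by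
  rw [mem_intertwiners_iff] at hU ⊢
  simp only [tensorRep_E, tensorRep_D, Matrix.mul_add, Matrix.add_mul, ← Matrix.mul_kronecker_mul,
    hU.1, hU.2, Matrix.mul_one, Matrix.one_mul, and_self]

/-- The hypotheses say that the `A α` assemble to an isomorphism from copies of `π₁` onto `π₂`; the
`B α` are the components of its inverse. -/
theorem mem_intertwiners_of_inverse {ι : Type} [Fintype ι] [DecidableEq ι]
    {π₁ : Weyl N →ₐ[ℂ] Matrix m m ℂ} {π₂ : Weyl N →ₐ[ℂ] Matrix n n ℂ}
    {A : ι → Matrix n m ℂ} {B : ι → Matrix m n ℂ} (hA : ∀ α, A α ∈ intertwiners π₁ π₂)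
    (hBA : ∀ α β, B α * A β = if α = β then 1 else 0) (hAB : ∑ α, A α * B α = 1) (α : ι) :
    B α ∈ intertwiners π₂ π₁ := by
  intro a
  calc B α * π₂ a = B α * (π₂ a * ∑ β, A β * B β) := by rw [hAB, Matrix.mul_one]
    _ = ∑ β, (B α * A β) * (π₁ a * B β) := by
      rw [Matrix.mul_sum, Matrix.mul_sum]
      refine Finset.sum_congr rfl fun β _ => ?_
      rw [← Matrix.mul_assoc (π₂ a), ← hA β a, Matrix.mul_assoc (A β), ← Matrix.mul_assoc]
    _ = π₁ a * B α := by
      simp only [hBA]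
      rw [Finset.sum_eq_single α]
      · simp
      · intro b _ hb
        simp [Ne.symm hb]
      · simp

/-- Since `π₂` is a direct sum of copies of `π₁` through the `A α`, a morphism into it is a family
of morphisms into `π₁`, with components `B α * U`. -/
theorem isBasisOf_mul {ι κ : Type} [Fintype ι] [DecidableEq ι] [Fintype κ] [DecidableEq κ]
    {π₁ : Weyl N →ₐ[ℂ] Matrix m m ℂ} {π₂ : Weyl N →ₐ[ℂ] Matrix n n ℂ}
    {π₃ : Weyl N →ₐ[ℂ] Matrix p p ℂ}
    {A : ι → Matrix n m ℂ} {B : ι → Matrix m n ℂ} (hA : ∀ α, A α ∈ intertwiners π₁ π₂)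
    (hBA : ∀ α β, B α * A β = if α = β then 1 else 0) (hAB : ∑ α, A α * B α = 1)
    {K : κ → Matrix m p ℂ} (hK : IsBasisOf K (intertwiners π₃ π₁)) :
    IsBasisOf (fun q : ι × κ => A q.1 * K q.2) (intertwiners π₃ π₂) := by
  refine ⟨?_, le_antisymm ?_ ?_⟩
  · rw [Fintype.linearIndependent_iff]
    rintro c hc ⟨α, β⟩
    refine Fintype.linearIndependent_iff.mp hK.1 (fun β => c (α, β)) ?_ β
    have h := congrArg (fun M => B α * M) hc
    simp only [Matrix.mul_zero, Matrix.mul_sum, Matrix.mul_smul, ← Matrix.mul_assoc, hBA] at h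
    rw [Fintype.sum_prod_type, Finset.sum_eq_single α] at h
    · simpa using h
    · intro b _ hb
      simp [Ne.symm hb]
    · simp
  · rw [Submodule.span_le]
    rintro _ ⟨q, rfl⟩
    exact mul_mem_intertwiners (hA _) (hK.2 ▸ Submodule.subset_span ⟨_, rfl⟩)
  · intro U hU
    have h1 : U = ∑ α, A α * (B α * U) := by
      simp only [← Matrix.mul_assoc]
      rw [← Matrix.sum_mul, hAB, Matrix.one_mul]
    rw [h1]
    refine Submodule.sum_mem _ fun α _ => ?_
    have h2 : B α * U ∈ Submodule.span ℂ (Set.range K) := by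
      rw [hK.2]
      exact mul_mem_intertwiners (mem_intertwiners_of_inverse hA hBA hAB α) hU
    generalize B α * U = V at h2
    induction h2 using Submodule.span_induction with
    | mem x hx =>
      obtain ⟨β, rfl⟩ := hx
      exact Submodule.subset_span ⟨(α, β), rfl⟩
    | zero => simp
    | add x y _ _ hx hy => rw [Matrix.mul_add]; exact add_mem hx hy
    | smul c x _ hx => rw [Matrix.mul_smul]; exact Submodule.smul_mem _ _ hx

theorem IsBasisOf.comp_equiv {ι κ V : Type} [AddCommGroup V] [Module ℂ V] {v : ι → V}
    {S : Submodule ℂ V} (h : IsBasisOf v S) (e : κ ≃ ι) : IsBasisOf (v ∘ e) S :=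
  ⟨h.1.comp e e.injective, by rw [e.surjective.range_comp, h.2]⟩

end Weyl

/-! ### Clebsch–Gordan operators and their inverses. -/

theorem StdRep.hom_E (ρ : StdRep) : ρ.hom N (Weyl.gen N .E) = ρ.a ^ 2 • Zmat N := by
  simp [StdRep.hom, Weyl.lift, Weyl.gen]

theorem StdRep.hom_D (ρ : StdRep) : ρ.hom N (Weyl.gen N .D) = (ρ.a * ρ.y) • Xmat N := by
  simp [StdRep.hom, Weyl.lift, Weyl.gen]

/-- The parameter `-y_ρ / (a_ρ a_μ y_μ)` attached to a pair. -/
noncomputable def pairS (ρ μ : StdRep) : ℂ := -(ρ.y / (ρ.a * μ.a * μ.y))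

theorem pairS_ne_zero (ρ μ : StdRep) : pairS ρ μ ≠ 0 :=
  neg_ne_zero.mpr (div_ne_zero ρ.y_ne (mul_ne_zero (mul_ne_zero ρ.a_ne μ.a_ne) μ.y_ne))

theorem pairArg_ne_zero (ρ μ σ : StdRep) : pairArg ρ μ σ ≠ 0 :=
  div_ne_zero σ.y_ne (mul_ne_zero ρ.a_ne μ.y_ne)

/-- The equation for `y_σ` says that the pair determines a point of the Fermat curve; `N` odd
absorbs the sign in `pairS`. -/
theorem pairArg_pow_add (hN : Odd N) {ρ μ σ : StdRep} (h : IsProduct N ρ μ σ) :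
    pairArg ρ μ σ ^ N + pairS ρ μ ^ N = 1 := by
  have := pow_ne_zero N ρ.a_ne
  have := pow_ne_zero N μ.a_ne
  have := pow_ne_zero N μ.y_ne
  rw [pairArg, pairS, hN.neg_pow, div_pow, div_pow, h.2, mul_pow, mul_pow, mul_pow]
  field_simp
  ring

theorem cdil_pair (ρ μ σ : StdRep) (n : ZMod N) :
    cdil N (ρ.a * μ.y) (ρ.y / μ.a) σ.y n = fd N (pairArg ρ μ σ) (pairS ρ μ) n := by
  have h1 := ρ.a_ne
  have h2 := μ.y_ne
  have h3 := μ.a_ne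
  rw [cdil_eq_fd (mul_ne_zero h1 h2), pairArg, pairS]
  congr 2
  field_simp

/-- The matrix with entries `h ω^{αδ} ω(t,s|γ - α) ω^{α²/2} δ(γ + δ - β)`. -/
noncomputable def cycMat (N : ℕ) (h t s : ℂ) :
    Matrix (ZMod N × ZMod N) (ZMod N × ZMod N) ℂ :=
  Matrix.of fun p q => if q.1 + q.2 = p.2 then
    h * wpow N (p.1 * q.2) * (fd N t s (q.1 - p.1) * wpow N (half N * p.1 ^ 2)) else 0

/-- The inverse of `cycMat`. -/
noncomputable def cycMatBar (N : ℕ) (h t s : ℂ) :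
    Matrix (ZMod N × ZMod N) (ZMod N × ZMod N) ℂ :=
  Matrix.of fun q p => if q.1 + q.2 = p.2 then
    bracket N (1 / t) / h * wpow N (-(p.1 * q.2)) /
      (fd N (root N * t) (root N * s) (q.1 - p.1) * wpow N (half N * p.1 ^ 2)) else 0

/-- Expand `1/(ω^n - t)` as a finite geometric sum over `1 - t^N`; summation over `n` keeps only the
term `i = 0`. -/
theorem sum_inv_wpow_sub {t : ℂ} (ht : t ^ N ≠ 1) :
    ∑ n : ZMod N, 1 / (wpow N n - t) = N * t ^ (N - 1) / (1 - t ^ N) := by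
  have h1 : ∀ n : ZMod N, 1 / (wpow N n - t) =
      (∑ i ∈ Finset.range N, wpow N (i * n) * t ^ (N - 1 - i)) / (1 - t ^ N) := by
    intro n
    have hg := geom_sum₂_mul (wpow N n) t N
    rw [wpow_pow_card] at hg
    rw [div_eq_div_iff (wpow_sub_ne_zero ht n) (sub_ne_zero.mpr (Ne.symm ht)), one_mul, ← hg]
    simp only [wpow_pow]
  simp only [h1]
  rw [← Finset.sum_div, Finset.sum_comm]
  congr 1
  simp only [← Finset.sum_mul, sum_wpow_mul]
  rw [Finset.sum_eq_single 0]
  · simp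
  · intro i hi h0
    have : (i : ZMod N) ≠ 0 := by
      intro h
      rw [ZMod.natCast_eq_zero_iff] at h
      exact h0 (Nat.eq_zero_of_dvd_of_lt h (Finset.mem_range.mp hi))
    simp [this]
  · intro h
    exact absurd (Finset.mem_range.mpr (NeZero.pos N)) h

theorem fd_root_mul_add {t s : ℂ} (h : t ^ N + s ^ N = 1) :
    (root N * t) ^ N + (root N * s) ^ N = 1 := by
  rw [mul_pow, mul_pow, root_pow, one_mul, one_mul, h]

theorem fd_root_mul_rec (hN : Odd N) {t s : ℂ} (hs : s ≠ 0) (h : t ^ N + s ^ N = 1) (n : ZMod N) :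
    (wpow N (n - 1) - t) * fd N (root N * t) (root N * s) n =
      s * fd N (root N * t) (root N * s) (n - 1) := by
  have hr := root_ne_zero N
  have h1 := fd_rec hN (mul_ne_zero hr hs) (fd_root_mul_add h) n
  rw [wpow_sub, wpow_one]
  field_simp
  linear_combination h1

/-- The function `(1 - t)/(ω^n - t)` times the denominator satisfies the recurrence of the numerator
and has the same value at `0`. -/
theorem fd_div_fd_root_mul (hN : Odd N) {t s : ℂ} (hs : s ≠ 0) (h : t ^ N + s ^ N = 1)
    (n : ZMod N) :
    fd N t s n / fd N (root N * t) (root N * s) n = (1 - t) / (wpow N n - t) := by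
  have hr := root_ne_zero N
  have ht := pow_ne_one_of_add hs h
  have h2 : ∀ n, fd N (root N * t) (root N * s) n ≠ 0 :=
    fd_ne_zero (mul_ne_zero hr hs) (fd_root_mul_add h)
  have h3 := eq_mul_fd_of_rec hN hs h
    (u := fun n => (1 - t) / (wpow N n - t) * fd N (root N * t) (root N * s) n) (fun n => by
      have h4 := fd_root_mul_rec hN hs h n
      have h5 := wpow_sub_ne_zero ht n
      have h6 := wpow_sub_ne_zero ht (n - 1)
      generalize fd N (root N * t) (root N * s) = F at *
      field_simp
      linear_combination (1 - t) * h4) n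
  have h5 := wpow_sub_ne_zero ht 0
  rw [wpow_zero] at h5
  simp only [fd_zero, mul_one, wpow_zero, div_self h5, one_mul] at h3
  rw [← h3, mul_div_cancel_right₀ _ (h2 n)]

/-- Orthogonality of dilogarithms. For `m = 0` the quotients are `(1 - t)/(ω^n - t)`, and their sum
is what `bracket` normalizes. For `m ≠ 0` a shift of the summation index shows that the sum is
killed by a nonzero scalar. -/
theorem sum_fd_div (hN : Odd N) (hN1 : 1 < N) {t s : ℂ} (ht0 : t ≠ 0) (hs : s ≠ 0)
    (h : t ^ N + s ^ N = 1) (m : ZMod N) :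
    bracket N (1 / t) * ∑ n : ZMod N,
      wpow N (-(m * n)) * fd N t s (n - m) / fd N (root N * t) (root N * s) n =
        if m = 0 then 1 else 0 := by
  have hr := root_ne_zero N
  have ht := pow_ne_one_of_add hs h
  have h2 : ∀ n, fd N (root N * t) (root N * s) n ≠ 0 :=
    fd_ne_zero (mul_ne_zero hr hs) (fd_root_mul_add h)
  split_ifs with hm
  · subst hm
    simp only [zero_mul, neg_zero, wpow_zero, one_mul, sub_zero, fd_div_fd_root_mul hN hs h]
    have h3 : ∀ n : ZMod N, (1 - t) / (wpow N n - t) = (1 - t) * (1 / (wpow N n - t)) :=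
      fun n => by ring
    simp only [h3]
    rw [← Finset.mul_sum, sum_inv_wpow_sub ht, bracket]
    have h5 := wpow_sub_ne_zero ht 0
    rw [wpow_zero] at h5
    have h6 : 1 - t ^ N ≠ 0 := sub_ne_zero.mpr (Ne.symm ht)
    have h7 : t - 1 ≠ 0 := fun h0 => h5 (by linear_combination -h0)
    have h8 : t ^ N = t * t ^ (N - 1) := by rw [← pow_succ']; congr 1; omega
    have hNN : (N : ℂ) ≠ 0 := Nat.cast_ne_zero.mpr (NeZero.ne N)
    have h9 : 1 - 1 / t = (t - 1) / t := by field_simp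
    have h10 : 1 - (1 / t) ^ N = -(1 - t ^ N) / t ^ N := by
      rw [one_div, inv_pow]
      field_simp
      ring
    have h11 := pow_ne_zero (N - 1) ht0
    rw [h9, h10]
    field_simp
    rw [h8]
    ring
  · set S := ∑ n : ZMod N, wpow N (-(m * n)) * fd N t s (n - m) / fd N (root N * t) (root N * s) n
      with hS
    -- The factor `ω^n - t` moves the denominator to `n + 1`; after relabelling, the recurrence of
    -- the numerator returns the original summand with `t` replaced by `ω^m t`. The difference of
    -- the two sides is `t(ω^m - 1) S`.
    have key : ∑ n : ZMod N, (wpow N n - t) *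
        (wpow N (-(m * n)) * fd N t s (n - m) / fd N (root N * t) (root N * s) n) =
        ∑ n : ZMod N, (wpow N n - wpow N m * t) *
        (wpow N (-(m * n)) * fd N t s (n - m) / fd N (root N * t) (root N * s) n) := by
      have h3 : ∀ n : ZMod N, (wpow N n - t) *
        (wpow N (-(m * n)) * fd N t s (n - m) / fd N (root N * t) (root N * s) n) =
        s * wpow N (-(m * n)) * fd N t s (n - m) / fd N (root N * t) (root N * s) (n + 1) := by
        intro n
        have h4 := fd_root_mul_rec hN hs h (n + 1)
        rw [add_sub_cancel_right] at h4
        have := h2 n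
        have := h2 (n + 1)
        generalize fd N (root N * t) (root N * s) = F at *
        field_simp
        linear_combination wpow N (-(m * n)) * fd N t s (n - m) * h4
      rw [Finset.sum_congr rfl fun n _ => h3 n]
      refine Fintype.sum_equiv (Equiv.addRight 1) _ _ fun n => ?_
      have h5 := fd_rec hN hs h (n + 1 - m)
      have e : n + 1 - m - 1 = n - m := by ring
      have e2 : wpow N (n + 1) = wpow N (n + 1 - m) * wpow N m := by
        rw [← wpow_add]; congr 1; ring
      have e3 : wpow N (-(m * n)) = wpow N m * wpow N (-(m * (n + 1))) := by
        rw [← wpow_add]; congr 1; ring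
      rw [e] at h5
      simp only [Equiv.coe_addRight]
      rw [e2, e3]
      have := h2 (n + 1)
      generalize fd N (root N * t) (root N * s) = F at *
      field_simp
      linear_combination (-(wpow N m * wpow N (-(m * (n + 1))))) * h5
    have h6 : t * (wpow N m - 1) * S = 0 := by
      rw [hS, Finset.mul_sum]
      rw [← sub_eq_zero, ← Finset.sum_sub_distrib] at key
      rw [← key]
      refine Finset.sum_congr rfl fun n _ => by ring
    have h7 : wpow N m - 1 ≠ 0 :=
      sub_ne_zero.mpr fun h1 => hm (wpow_injective N (h1.trans (wpow_zero N).symm))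
    rw [(mul_eq_zero.mp h6).resolve_left (mul_ne_zero ht0 h7), mul_zero]

theorem cycMat_mul_cycMatBar (hN : Odd N) (hN1 : 1 < N) {h t s : ℂ} (hh : h ≠ 0) (ht0 : t ≠ 0)
    (hs : s ≠ 0) (hts : t ^ N + s ^ N = 1) : cycMat N h t s * cycMatBar N h t s = 1 := by
  ext ⟨α, β⟩ ⟨α', β'⟩
  have h2 : ∀ n, fd N (root N * t) (root N * s) n ≠ 0 :=
    fd_ne_zero (mul_ne_zero (root_ne_zero N) hs) (fd_root_mul_add hts)
  rw [Matrix.mul_apply, Fintype.sum_prod_type, Matrix.one_apply]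
  have h3 : ∀ γ δ : ZMod N, cycMat N h t s (α, β) (γ, δ) * cycMatBar N h t s (γ, δ) (α', β') =
      if δ = β - γ then (if β = β' then h * wpow N (α * δ) * (fd N t s (γ - α) *
        wpow N (half N * α ^ 2)) * (bracket N (1 / t) / h * wpow N (-(α' * δ)) /
      (fd N (root N * t) (root N * s) (γ - α') * wpow N (half N * α' ^ 2))) else 0) else 0 := by
    intro γ δ
    simp only [cycMat, cycMatBar, Matrix.of_apply]
    by_cases e1 : δ = β - γ
    · subst e1
      simp only [add_sub_cancel, if_true]
      split_ifs <;> simp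
    · have : γ + δ ≠ β := fun h => e1 (by rw [← h]; ring)
      simp [e1, this]
  simp only [h3, Finset.sum_ite_eq', Finset.mem_univ, if_true]
  by_cases hβ : β = β'
  · subst hβ
    simp only [if_true, Prod.mk.injEq, and_true]
    have h4 := sum_fd_div hN hN1 ht0 hs hts (α - α')
    simp only [sub_eq_zero] at h4
    -- The inserted phases equal `1` where the indicator is nonzero; they match those left over when
    -- `γ` is shifted by `α'`.
    have h5 : (if α = α' then (1 : ℂ) else 0) = wpow N (half N * (α ^ 2 - α' ^ 2)) *
        wpow N ((α - α') * (β - α')) * (if α = α' then (1 : ℂ) else 0) := by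
      split_ifs with e
      · simp [e, wpow_zero]
      · simp
    rw [h5, ← h4, Finset.mul_sum, Finset.mul_sum]
    refine Fintype.sum_equiv (Equiv.subRight α') _ _ fun γ => ?_
    simp only [Equiv.subRight_apply]
    have e1 : γ - α' - (α - α') = γ - α := by ring
    have e2 : wpow N (half N * (α ^ 2 - α' ^ 2)) =
        wpow N (half N * α ^ 2) / wpow N (half N * α' ^ 2) := by
      rw [← wpow_sub]; congr 1; ring
    have e3 : wpow N (α * (β - γ)) * wpow N (-(α' * (β - γ))) =
        wpow N ((α - α') * (β - α')) * wpow N (-((α - α') * (γ - α'))) := by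
      rw [← wpow_add, ← wpow_add]; congr 1; ring
    have h6 := wpow_ne_zero N (half N * α' ^ 2)
    have h7 := h2 (γ - α')
    generalize fd N (root N * t) (root N * s) (γ - α') = F at *
    generalize bracket N (1 / t) = b at *
    rw [e1, e2]
    field_simp
    linear_combination (fd N t s (γ - α) * wpow N (half N * α ^ 2) * b) * e3
  · simp [hβ]

/-- The Clebsch–Gordan coefficients form, up to arrangement of the indices, the same matrix as the
6j-symbol, so `cycMatBar` inverts both. -/
theorem stdCGO_apply (g : ℂ → ℂ) (ρ μ σ : StdRep) (α : ZMod N) (p : ZMod N × ZMod N) (k : ZMod N) :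
    stdCGO N g ρ μ σ α p k =
      cycMat N (hFun N g (pairArg ρ μ σ)) (pairArg ρ μ σ) (pairS ρ μ) (α, k) p := by
  simp only [stdCGO, cycMat, Matrix.of_apply, cdil₂, cdil_pair]

/-- `E` acts diagonally with eigenvalues proportional to `ω^{i+j}` and `ω^k`, which forces the
support; the relation for `D`, divided by its common scalar, is a recurrence in the point `(pairArg,
pairS)`. -/
theorem mem_intertwiners_pair_iff {ρ μ σ : StdRep} (hσ : σ.a = ρ.a * μ.a)
    {U : Matrix (ZMod N × ZMod N) (ZMod N) ℂ} :
    U ∈ intertwiners (σ.hom N) (tensorRep (ρ.hom N) (μ.hom N)) ↔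
      (∀ i j k, i + j ≠ k → U (i, j) k = 0) ∧
      ∀ i j k, pairArg ρ μ σ * U (i, j) (k + 1) =
        wpow N i * U (i, j - 1) k - pairS ρ μ * U (i - 1, j) k := by
  have h1 := ρ.a_ne
  have h2 := μ.a_ne
  have h3 := μ.y_ne
  rw [mem_intertwiners_iff, tensorRep_E, tensorRep_D]
  simp only [StdRep.hom_E, StdRep.hom_D, hσ]
  rw [← Matrix.ext_iff, ← Matrix.ext_iff]
  have hX : ∀ i k : ZMod N, Xmat N i k = if k = i - 1 then 1 else 0 := fun i k => by
    simp only [Xmat, Matrix.of_apply, eq_sub_iff_add_eq, eq_comm]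
  refine and_congr ?_ ?_
  · constructor
    · intro h i j k hk
      have := h (i, j) k
      simp only [Zmat, Matrix.mul_smul, Matrix.smul_apply, Matrix.mul_diagonal, smul_eq_mul,
        Matrix.smul_kronecker, Matrix.kronecker_smul, Matrix.smul_mul,
        Matrix.diagonal_kronecker_diagonal, Matrix.diagonal_mul] at this
      have h4 : wpow N k - wpow N (i + j) ≠ 0 :=
        sub_ne_zero.mpr fun e => hk (wpow_injective N e).symm
      rw [wpow_add] at h4
      have h5 : (ρ.a ^ 2 * μ.a ^ 2) * ((wpow N k - wpow N i * wpow N j) * U (i, j) k) = 0 := by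
        linear_combination this
      have h6 : ρ.a ^ 2 * μ.a ^ 2 ≠ 0 := by positivity
      exact (mul_eq_zero.mp ((mul_eq_zero.mp h5).resolve_left h6)).resolve_left h4
    · rintro h ⟨i, j⟩ k
      simp only [Zmat, Matrix.mul_smul, Matrix.smul_apply, Matrix.mul_diagonal, smul_eq_mul,
        Matrix.smul_kronecker, Matrix.kronecker_smul, Matrix.smul_mul,
        Matrix.diagonal_kronecker_diagonal, Matrix.diagonal_mul]
      by_cases hk : i + j = k
      · subst hk
        rw [wpow_add]; ring
      · rw [h i j k hk]; ring
  · rw [Prod.forall]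
    refine forall_congr' fun i => forall_congr' fun j => forall_congr' fun k => ?_
    have e1 : (U * ((ρ.a * μ.a * σ.y) • Xmat N)) (i, j) k =
        ρ.a * μ.a * σ.y * U (i, j) (k + 1) := by
      rw [Matrix.mul_smul, Matrix.smul_apply, Matrix.mul_apply]
      simp [Xmat]
    have e2 : (((ρ.a ^ 2 • Zmat N) ⊗ₖ ((μ.a * μ.y) • Xmat N) +
        ((ρ.a * ρ.y) • Xmat N) ⊗ₖ (1 : Matrix (ZMod N) (ZMod N) ℂ)) * U) (i, j) k =
        ρ.a ^ 2 * (μ.a * μ.y) * wpow N i * U (i, j - 1) k + ρ.a * ρ.y * U (i - 1, j) k := by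
      rw [Matrix.add_mul, Matrix.add_apply, Matrix.mul_apply, Matrix.mul_apply,
        Fintype.sum_prod_type, Fintype.sum_prod_type]
      simp [Matrix.kroneckerMap_apply, Zmat, Matrix.diagonal_apply, hX, Matrix.one_apply]
      left; ring
    rw [e1, e2, pairArg, pairS]
    constructor
    · intro h
      field_simp
      apply mul_left_cancel₀ h1
      linear_combination h
    · intro h
      field_simp at h
      linear_combination ρ.a * h

theorem stdCGO_mem_intertwiners (hN : Odd N) (g : ℂ → ℂ) {ρ μ σ : StdRep}
    (hσ : IsProduct N ρ μ σ) (α : ZMod N) :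
    stdCGO N g ρ μ σ α ∈ intertwiners (σ.hom N) (tensorRep (ρ.hom N) (μ.hom N)) := by
  rw [mem_intertwiners_pair_iff hσ.1]
  constructor
  · intro i j k hk
    simp [stdCGO_apply, cycMat, hk]
  · intro i j k
    have h := fd_rec hN (pairS_ne_zero ρ μ) (pairArg_pow_add hN hσ) (i - α)
    simp only [stdCGO_apply, cycMat, Matrix.of_apply]
    by_cases hk : i + j = k + 1
    · have e1 : i + (j - 1) = k := by rw [add_sub, hk]; ring
      have e2 : i - 1 + j = k := by rw [sub_add_eq_add_sub, hk]; ring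
      have e3 : i - 1 - α = i - α - 1 := by ring
      have e4 : wpow N i * wpow N (α * (j - 1)) = wpow N (α * j) * wpow N (i - α) := by
        rw [← wpow_add, ← wpow_add]; congr 1; ring
      simp only [hk, e1, e2, if_true, e3]
      linear_combination (-hFun N g (pairArg ρ μ σ) * wpow N (α * j) *
        wpow N (half N * α ^ 2)) * h - (hFun N g (pairArg ρ μ σ) *
        fd N (pairArg ρ μ σ) (pairS ρ μ) (i - α) * wpow N (half N * α ^ 2)) * e4
    · have e1 : i + (j - 1) ≠ k := fun h => hk (by rw [← h]; ring)
      have e2 : i - 1 + j ≠ k := fun h => hk (by rw [← h]; ring)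
      simp [hk, e1, e2]

/-- The left inverses of the Clebsch–Gordan operators. -/
noncomputable def stdCGOInv (N : ℕ) (g : ℂ → ℂ) (ρ μ σ : StdRep) (α : ZMod N) :
    Matrix (ZMod N) (ZMod N × ZMod N) ℂ :=
  Matrix.of fun k p =>
    cycMatBar N (hFun N g (pairArg ρ μ σ)) (pairArg ρ μ σ) (pairS ρ μ) p (α, k)

theorem hFun_pairArg_ne_zero (hN : Odd N) {g : ℂ → ℂ} (hg : IsDetermination N g)
    {ρ μ σ : StdRep} (hσ : IsProduct N ρ μ σ) : hFun N g (pairArg ρ μ σ) ≠ 0 :=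
  hFun_ne_zero hN hg (pairArg_ne_zero ρ μ σ)
    (pow_ne_one_of_add (pairS_ne_zero ρ μ) (pairArg_pow_add hN hσ))

theorem stdCGOInv_mul_stdCGO (hN : Odd N) (hN1 : 1 < N) {g : ℂ → ℂ} (hg : IsDetermination N g)
    {ρ μ σ : StdRep} (hσ : IsProduct N ρ μ σ) (α β : ZMod N) :
    stdCGOInv N g ρ μ σ α * stdCGO N g ρ μ σ β = if α = β then 1 else 0 := by
  have h := cycMat_mul_cycMatBar hN hN1 (hFun_pairArg_ne_zero hN hg hσ) (pairArg_ne_zero ρ μ σ)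
    (pairS_ne_zero ρ μ) (pairArg_pow_add hN hσ)
  ext k k'
  have h1 := congrFun (congrFun h (β, k')) (α, k)
  rw [Matrix.mul_apply] at h1
  rw [Matrix.mul_apply]
  simp only [stdCGO_apply, stdCGOInv, Matrix.of_apply]
  rw [← Finset.sum_congr rfl (fun p _ => mul_comm _ _), h1, Matrix.one_apply]
  split_ifs <;> simp_all [Matrix.one_apply, eq_comm]

theorem sum_stdCGO_mul_stdCGOInv (hN : Odd N) (hN1 : 1 < N) {g : ℂ → ℂ}
    (hg : IsDetermination N g) {ρ μ σ : StdRep} (hσ : IsProduct N ρ μ σ) :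
    ∑ α, stdCGO N g ρ μ σ α * stdCGOInv N g ρ μ σ α = 1 := by
  have h := mul_eq_one_comm.mp <| cycMat_mul_cycMatBar hN hN1 (hFun_pairArg_ne_zero hN hg hσ)
    (pairArg_ne_zero ρ μ σ) (pairS_ne_zero ρ μ) (pairArg_pow_add hN hσ)
  ext p p'
  have h1 := congrFun (congrFun h p') p
  rw [Matrix.mul_apply, Fintype.sum_prod_type, Matrix.one_apply] at h1
  rw [Matrix.sum_apply, Matrix.one_apply]
  simp only [Matrix.mul_apply, stdCGO_apply, stdCGOInv, Matrix.of_apply]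
  simp only [mul_comm, eq_comm] at h1 ⊢
  exact h1

theorem isBasisOf_stdCGO (hN : Odd N) (hN1 : 1 < N) {g : ℂ → ℂ} (hg : IsDetermination N g)
    {ρ μ σ : StdRep} (hσ : IsProduct N ρ μ σ) :
    IsBasisOf (stdCGO N g ρ μ σ) (intertwiners (σ.hom N) (tensorRep (ρ.hom N) (μ.hom N))) := by
  refine ⟨?_, le_antisymm ?_ ?_⟩
  · rw [Fintype.linearIndependent_iff]
    intro c hc α
    have h := congrArg (fun M => stdCGOInv N g ρ μ σ α * M) hc
    simp only [Matrix.mul_zero, Matrix.mul_sum, Matrix.mul_smul,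
      stdCGOInv_mul_stdCGO hN hN1 hg hσ] at h
    rw [Finset.sum_eq_single α] at h
    · simpa using h
    · intro b _ hb
      simp [Ne.symm hb]
    · simp
  · rw [Submodule.span_le]
    rintro _ ⟨q, rfl⟩
    exact stdCGO_mem_intertwiners hN g hσ q
  · intro U hU
    rw [mem_intertwiners_pair_iff hσ.1] at hU
    obtain ⟨hsupp, hrec⟩ := hU
    have hNN : (N : ℂ) ≠ 0 := Nat.cast_ne_zero.mpr (NeZero.ne N)
    -- Fourier transform in `j` along the support `k = i + j`: it turns the shift of `j` into a
    -- scalar, so that only the recurrence in `i` remains.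
    set c : ZMod N → ZMod N → ℂ := fun α i =>
      ∑ j : ZMod N, wpow N (-(α * j)) * U (i, j) (i + j) with hc
    have hc_rec : ∀ α i, (wpow N (i - α) - pairArg ρ μ σ) * c α i = pairS ρ μ * c α (i - 1) := by
      intro α i
      have e0 : wpow N (i - α) * c α i =
          ∑ j : ZMod N, wpow N (i - α) * (wpow N (-(α * (j - 1))) * U (i, j - 1) (i + (j - 1))) := by
        rw [hc, Finset.mul_sum]
        exact (Fintype.sum_equiv (Equiv.subRight 1) _ _ fun j => by simp).symm
      rw [sub_mul, e0, hc, Finset.mul_sum, Finset.mul_sum, ← Finset.sum_sub_distrib]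
      refine Finset.sum_congr rfl fun j _ => ?_
      have h := hrec i j (i + j - 1)
      have e1 : i + (j - 1) = i + j - 1 := by ring
      have e2 : i - 1 + j = i + j - 1 := by ring
      have e3 : wpow N (i - α) * wpow N (-(α * (j - 1))) = wpow N i * wpow N (-(α * j)) := by
        rw [← wpow_add, ← wpow_add]; congr 1; ring
      rw [sub_add_cancel] at h
      rw [e1, e2]
      linear_combination (U (i, j - 1) (i + j - 1)) * e3 - wpow N (-(α * j)) * h
    -- For each frequency `α` the transform is a multiple of the dilogarithm in `i - α`, which is
    -- the shape of the operator with label `α`.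
    have hc_eq : ∀ α i, c α i = c α α * fd N (pairArg ρ μ σ) (pairS ρ μ) (i - α) := by
      intro α i
      have := eq_mul_fd_of_rec hN (pairS_ne_zero ρ μ) (pairArg_pow_add hN hσ)
        (u := fun n => c α (n + α)) (fun n => by
          have := hc_rec α (n + α)
          rw [add_sub_cancel_right] at this
          rw [this]
          congr 2; ring) (i - α)
      simpa using this
    have hinv : ∀ i j, U (i, j) (i + j) = (N : ℂ)⁻¹ * ∑ α, wpow N (α * j) * c α i := by
      intro i j
      simp only [hc, Finset.mul_sum]
      rw [Finset.sum_comm]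
      have : ∀ j', ∑ α : ZMod N, (N : ℂ)⁻¹ * (wpow N (α * j) *
          (wpow N (-(α * j')) * U (i, j') (i + j'))) =
          if j' = j then U (i, j') (i + j') else 0 := by
        intro j'
        have h1 : ∀ α : ZMod N, (N : ℂ)⁻¹ * (wpow N (α * j) *
          (wpow N (-(α * j')) * U (i, j') (i + j'))) =
          wpow N ((j - j') * α) * ((N : ℂ)⁻¹ * U (i, j') (i + j')) := by
          intro α
          have : wpow N ((j - j') * α) = wpow N (α * j) * wpow N (-(α * j')) := by
            rw [← wpow_add]; congr 1; ring
          rw [this]; ring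
        simp only [h1]
        rw [← Finset.sum_mul, sum_wpow_mul]
        simp only [sub_eq_zero]
        by_cases hj : j = j'
        · subst hj
          simp only [if_true]
          field_simp
        · simp [hj, Ne.symm hj]
      simp only [this]
      simp
    have hh := hFun_pairArg_ne_zero hN hg hσ
    -- The coefficients come from Fourier inversion, divided by the normalization and the phase
    -- `ω^{α²/2}` built into the operators.
    have hU : U = ∑ α, ((N : ℂ)⁻¹ * c α α / (hFun N g (pairArg ρ μ σ) *
        wpow N (half N * α ^ 2))) • stdCGO N g ρ μ σ α := by
      ext ⟨i, j⟩ k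
      rw [Matrix.sum_apply]
      simp only [Matrix.smul_apply, smul_eq_mul, stdCGO_apply, cycMat, Matrix.of_apply]
      by_cases hk : i + j = k
      · subst hk
        simp only [if_true]
        rw [hinv, Finset.mul_sum]
        refine Finset.sum_congr rfl fun α _ => ?_
        rw [hc_eq α i]
        have := wpow_ne_zero N (half N * α ^ 2)
        field_simp
      · simp [hk, hsupp i j k hk]
    rw [hU]
    exact Submodule.sum_mem _ fun α _ => Submodule.smul_mem _ _ (Submodule.subset_span ⟨α, rfl⟩)

theorem isBasisOf_leftComposite (hN : Odd N) (hN1 : 1 < N) {g : ℂ → ℂ} (hg : IsDetermination N g)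
    {ρ μ ν ρμ ρμν : StdRep} (h₁ : IsProduct N ρ μ ρμ) (h₂ : IsProduct N ρμ ν ρμν) :
    IsBasisOf (leftComposite N g ρ μ ν ρμ ρμν)
      (intertwiners (ρμν.hom N) (tensorRep (tensorRep (ρ.hom N) (μ.hom N)) (ν.hom N))) :=
  isBasisOf_mul (A := fun α => stdCGO N g ρ μ ρμ α ⊗ₖ (1 : Matrix (ZMod N) (ZMod N) ℂ))
    (B := fun α => stdCGOInv N g ρ μ ρμ α ⊗ₖ (1 : Matrix (ZMod N) (ZMod N) ℂ))
    (fun α => kronecker_one_mem_intertwiners _ (stdCGO_mem_intertwiners hN g h₁ α))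
    (fun α β => by
      rw [← Matrix.mul_kronecker_mul, stdCGOInv_mul_stdCGO hN hN1 hg h₁]
      split_ifs <;> simp)
    (by
      simp only [← Matrix.mul_kronecker_mul, Matrix.mul_one]
      rw [← Matrix.one_kronecker_one, ← sum_stdCGO_mul_stdCGOInv hN hN1 hg h₁]
      ext p q
      simp [Matrix.sum_apply, Matrix.kroneckerMap_apply, Finset.sum_mul])
    (isBasisOf_stdCGO hN hN1 hg h₂)

/-- The inner operator carries the second label, so the general statement gives the pairs in the
order `(δ, γ)`; a final swap restores `(γ, δ)`. -/
theorem isBasisOf_rightComposite (hN : Odd N) (hN1 : 1 < N) {g : ℂ → ℂ}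
    (hg : IsDetermination N g) {ρ μ ν μν ρμν : StdRep} (h₁ : IsProduct N μ ν μν)
    (h₂ : IsProduct N ρ μν ρμν) :
    IsBasisOf (rightComposite N g ρ μ ν μν ρμν)
      (intertwiners (ρμν.hom N) (tensorRep (ρ.hom N) (tensorRep (μ.hom N) (ν.hom N)))) :=
  (isBasisOf_mul (A := fun α => (1 : Matrix (ZMod N) (ZMod N) ℂ) ⊗ₖ stdCGO N g μ ν μν α)
    (B := fun α => (1 : Matrix (ZMod N) (ZMod N) ℂ) ⊗ₖ stdCGOInv N g μ ν μν α)
    (fun α => one_kronecker_mem_intertwiners _ (stdCGO_mem_intertwiners hN g h₁ α))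
    (fun α β => by
      rw [← Matrix.mul_kronecker_mul, stdCGOInv_mul_stdCGO hN hN1 hg h₁]
      split_ifs <;> simp)
    (by
      simp only [← Matrix.mul_kronecker_mul, Matrix.mul_one]
      rw [← Matrix.one_kronecker_one, ← sum_stdCGO_mul_stdCGOInv hN hN1 hg h₁]
      ext p q
      simp [Matrix.sum_apply, Matrix.kroneckerMap_apply, Finset.mul_sum])
    (isBasisOf_stdCGO hN hN1 hg h₂)).comp_equiv (Equiv.prodComm _ _)

/-! ### From the five-term identity to the 6j-symbol. -/

/-- The parameter `-y_ρ y_ν / (y_{ρμν} y_μ)` attached to a triple. -/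
noncomputable def tripleS (ρ μ ν ρμν : StdRep) : ℂ := -(ρ.y * ν.y / (ρμν.y * μ.y))

section Triple

variable {ρ μ ν ρμ μν ρμν : StdRep}

/-- This identity and the next four form the dictionary between a triple and the five-term identity.
The pairs `(ρ,μ)`, `(ρμ,ν)`, `(μ,ν)` give the points with index 1, 2, 3; `(ρ,μν)` and the triple
itself give the two derived points `t₂/t₃` and `t₁t₃/t₂`. -/
theorem pairArg_mul_pairS (h : ρμ.a = ρ.a * μ.a) :
    pairArg ρ μ ρμ * pairS μ ν = pairS ρμ ν := by
  have := ρ.a_ne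
  have := μ.y_ne
  rw [pairArg, pairS, pairS, h]
  field_simp

theorem pairArg_div_pairArg (h₁ : ρμ.a = ρ.a * μ.a) :
    pairArg ρμ ν ρμν / pairArg μ ν μν = pairArg ρ μν ρμν := by
  have := ρ.a_ne
  have := μ.a_ne
  have := ν.y_ne
  have := μν.y_ne
  rw [pairArg, pairArg, pairArg, h₁]
  field_simp

theorem pairS_mul_div (h : μν.a = μ.a * ν.a) :
    -(pairS ρ μ * pairS μ ν / pairArg μ ν μν) = pairS ρ μν := by
  have := ρ.a_ne
  have := μ.a_ne
  have := ν.a_ne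
  have := ν.y_ne
  have := μ.y_ne
  have := μν.y_ne
  rw [pairArg, pairS, pairS, pairS, h]
  field_simp

theorem pairArg_mul_div (h : ρμ.a = ρ.a * μ.a) :
    pairArg ρ μ ρμ * pairArg μ ν μν / pairArg ρμ ν ρμν = tripleArg μ ρμ μν ρμν := by
  have := ρ.a_ne
  have := μ.a_ne
  have := ν.y_ne
  have := μ.y_ne
  have := ρμν.y_ne
  rw [pairArg, pairArg, pairArg, tripleArg, h]
  field_simp

theorem pairS_div_pairArg (h : ρμ.a = ρ.a * μ.a) :
    pairS ρ μ / pairArg ρμ ν ρμν = tripleS ρ μ ν ρμν := by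
  have := ρ.a_ne
  have := μ.a_ne
  have := ν.y_ne
  have := μ.y_ne
  have := ρμν.y_ne
  rw [pairArg, pairS, tripleS, h]
  field_simp

theorem IsProduct.assoc (h₁ : IsProduct N ρ μ ρμ) (h₂ : IsProduct N μ ν μν)
    (h₃ : IsProduct N ρμ ν ρμν) : IsProduct N ρ μν ρμν := by
  refine ⟨by rw [h₃.1, h₁.1, h₂.1]; ring, ?_⟩
  have := pow_ne_zero N μ.a_ne
  have := pow_ne_zero N ν.a_ne
  rw [h₃.2, h₂.2, h₁.2, h₁.1, h₂.1, mul_pow, mul_pow]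
  field_simp
  ring

theorem fiveData_of_isProduct (hN : Odd N) (h₁ : IsProduct N ρ μ ρμ) (h₂ : IsProduct N μ ν μν)
    (h₃ : IsProduct N ρμ ν ρμν) :
    FiveData N (pairS ρ μ) (pairS μ ν) (pairArg ρ μ ρμ) (pairArg ρμ ν ρμν) (pairArg μ ν μν) where
  s₁_ne := pairS_ne_zero _ _
  s₃_ne := pairS_ne_zero _ _
  t₁_ne := pairArg_ne_zero _ _ _
  t₂_ne := pairArg_ne_zero _ _ _
  t₃_ne := pairArg_ne_zero _ _ _
  eq₁ := pairArg_pow_add hN h₁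
  eq₂ := by rw [pairArg_mul_pairS h₁.1]; exact pairArg_pow_add hN h₃
  eq₃ := pairArg_pow_add hN h₂

theorem tripleS_ne_zero (ρ μ ν ρμν : StdRep) : tripleS ρ μ ν ρμν ≠ 0 :=
  neg_ne_zero.mpr (div_ne_zero (mul_ne_zero ρ.y_ne ν.y_ne) (mul_ne_zero ρμν.y_ne μ.y_ne))

theorem tripleArg_ne_zero (μ ρμ μν ρμν : StdRep) : tripleArg μ ρμ μν ρμν ≠ 0 :=
  div_ne_zero (mul_ne_zero ρμ.y_ne μν.y_ne) (mul_ne_zero ρμν.y_ne μ.y_ne)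

theorem tripleArg_pow_add (hN : Odd N) (h₁ : IsProduct N ρ μ ρμ) (h₂ : IsProduct N μ ν μν)
    (h₃ : IsProduct N ρμ ν ρμν) :
    tripleArg μ ρμ μν ρμν ^ N + tripleS ρ μ ν ρμν ^ N = 1 := by
  rw [← pairArg_mul_div h₁.1, ← pairS_div_pairArg h₁.1]
  exact (fiveData_of_isProduct hN h₁ h₂ h₃).eq₅

theorem sixJ_eq_cycMat (h : ℂ) : sixJ N h ρ μ ν ρμ μν ρμν =
    cycMat N h (tripleArg μ ρμ μν ρμν) (tripleS ρ μ ν ρμν) := by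
  ext p q
  simp only [sixJ, cycMat, Matrix.of_apply, cdil₂,
    cdil_eq_fd (mul_ne_zero ρμν.y_ne μ.y_ne), tripleArg, tripleS]

theorem sixJBar_eq_cycMatBar (h : ℂ) : sixJBar N h ρ μ ν ρμ μν ρμν =
    cycMatBar N h (tripleArg μ ρμ μν ρμν) (tripleS ρ μ ν ρμν) := by
  have h1 := ρμν.y_ne
  have h2 := μ.y_ne
  have h3 := root_ne_zero N
  have e1 : ρμ.y * μν.y / (ρμν.y * μ.y / root N) = root N * (ρμ.y * μν.y / (ρμν.y * μ.y)) := by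
    field_simp
  have e2 : -(ρ.y * ν.y / (ρμν.y * μ.y / root N)) = root N * -(ρ.y * ν.y / (ρμν.y * μ.y)) := by
    field_simp
  ext p q
  simp only [sixJBar, cycMatBar, Matrix.of_apply, cdil₂, tripleArg, tripleS,
    cdil_eq_fd (div_ne_zero (mul_ne_zero h1 h2) h3), e1, e2, one_div_div]

theorem leftComposite_apply (g : ℂ → ℂ) (α β i j l k : ZMod N) :
    leftComposite N g ρ μ ν ρμ ρμν (α, β) ((i, j), l) k =
      stdCGO N g ρ μ ρμ α (i, j) (i + j) * stdCGO N g ρμ ν ρμν β (i + j, l) k := by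
  rw [leftComposite, Matrix.mul_apply, Fintype.sum_prod_type,
    Finset.sum_eq_single (i + j)]
  · simp [Matrix.kroneckerMap_apply, Matrix.one_apply]
  · intro m _ hm
    refine Finset.sum_eq_zero fun l' _ => ?_
    simp [Matrix.kroneckerMap_apply, stdCGO, Ne.symm hm]
  · simp

theorem rightComposite_apply (g : ℂ → ℂ) (γ δ i j l k : ZMod N) :
    rightComposite N g ρ μ ν μν ρμν (γ, δ) (i, (j, l)) k =
      stdCGO N g μ ν μν δ (j, l) (j + l) * stdCGO N g ρ μν ρμν γ (i, j + l) k := by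
  rw [rightComposite, Matrix.mul_apply, Fintype.sum_prod_type_right,
    Finset.sum_eq_single (j + l)]
  · simp [Matrix.kroneckerMap_apply, Matrix.one_apply]
  · intro m _ hm
    refine Finset.sum_eq_zero fun l' _ => ?_
    simp [Matrix.kroneckerMap_apply, stdCGO, Ne.symm hm]
  · simp

/-- The constant of the five-term identity attached to a triple. -/
noncomputable def tripleConst (N : ℕ) [NeZero N] (ρ μ ν ρμ μν ρμν : StdRep) : ℂ :=
  fiveSum N (pairS ρ μ) (pairS μ ν) (pairArg ρ μ ρμ) (pairArg ρμ ν ρμν) (pairArg μ ν μν) 0 0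

/-- Both sides are supported on `i + j + l = k`, where the delta in the 6j-symbol leaves a sum over
`γ`. After the shift `γ ↦ γ - α` it is the five-term sum at `(i - α, j - β + α)`, and `hc` matches
the constants. -/
theorem isSixJ_cycMat (hN : Odd N) (h₁ : IsProduct N ρ μ ρμ) (h₂ : IsProduct N μ ν μν)
    (h₃ : IsProduct N ρμ ν ρμν) (g : ℂ → ℂ) {c : ℂ}
    (hc : c * (tripleConst N ρ μ ν ρμ μν ρμν *
      (hFun N g (pairArg μ ν μν) * hFun N g (pairArg ρ μν ρμν))) =
      hFun N g (pairArg ρ μ ρμ) * hFun N g (pairArg ρμ ν ρμν)) :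
    IsSixJ N g ρ μ ν ρμ μν ρμν
      (cycMat N c (tripleArg μ ρμ μν ρμν) (tripleS ρ μ ν ρμν)) := by
  rintro ⟨α, β⟩
  ext ⟨⟨i, j⟩, l⟩ k
  rw [Matrix.sum_apply, Fintype.sum_prod_type]
  simp only [Matrix.smul_apply, smul_eq_mul, Matrix.submatrix_apply, Equiv.prodAssoc_apply, id,
    leftComposite_apply, rightComposite_apply]
  have hδ : ∀ γ δ : ZMod N, cycMat N c (tripleArg μ ρμ μν ρμν) (tripleS ρ μ ν ρμν) (α, β) (γ, δ) =
      if δ = β - γ then c * wpow N (α * δ) *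
        (fd N (tripleArg μ ρμ μν ρμν) (tripleS ρ μ ν ρμν) (γ - α) * wpow N (half N * α ^ 2))
      else 0 := by
    intro γ δ
    simp only [cycMat, Matrix.of_apply, eq_sub_iff_add_eq, add_comm δ γ]
  simp only [hδ, ite_mul, zero_mul, Finset.sum_ite_eq', Finset.mem_univ, if_true]
  simp only [stdCGO_apply, cycMat, Matrix.of_apply, if_true]
  by_cases hk : i + j + l = k
  · have hk2 : i + (j + l) = k := by rw [← add_assoc, hk]
    simp only [hk, hk2, if_true]
    have h5 := (fiveData_of_isProduct hN h₁ h₂ h₃).fiveSum_eq hN (i - α) (j - β + α)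
    have e1 : i - α + (j - β + α) = i + j - β := by ring
    rw [e1, fiveSum, pairArg_mul_pairS h₁.1] at h5
    change _ = tripleConst N ρ μ ν ρμ μν ρμν * _ * _ at h5
    have h6 : ∀ γ : ZMod N, c * wpow N (α * (β - γ)) *
        (fd N (tripleArg μ ρμ μν ρμν) (tripleS ρ μ ν ρμν) (γ - α) * wpow N (half N * α ^ 2)) *
        (hFun N g (pairArg μ ν μν) * wpow N ((β - γ) * l) *
          (fd N (pairArg μ ν μν) (pairS μ ν) (j - (β - γ)) * wpow N (half N * (β - γ) ^ 2)) *
        (hFun N g (pairArg ρ μν ρμν) * wpow N (γ * (j + l)) *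
          (fd N (pairArg ρ μν ρμν) (pairS ρ μν) (i - γ) * wpow N (half N * γ ^ 2)))) =
        c * (hFun N g (pairArg μ ν μν) * hFun N g (pairArg ρ μν ρμν)) *
          (wpow N (α * j) * wpow N (half N * α ^ 2) * wpow N (β * l) * wpow N (half N * β ^ 2)) *
        fiveTerm N (pairS ρ μ) (pairS μ ν) (pairArg ρ μ ρμ) (pairArg ρμ ν ρμν) (pairArg μ ν μν)
          (i - α) (j - β + α) (γ - α) := by
      intro γ
      have e2 : j - β + α + (γ - α) = j - (β - γ) := by ring
      have e3 : i - α - (γ - α) = i - γ := by ring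
      rw [fiveTerm, pairArg_mul_div h₁.1, pairS_div_pairArg h₁.1, pairArg_div_pairArg h₁.1,
        pairS_mul_div h₂.1, e2, e3]
      -- The half squares of `β - γ` and `γ` combine to `β²/2 + γ² - βγ`, which produces the
      -- quadratic phase of the five-term summand.
      have e4 : wpow N (α * (β - γ)) * wpow N ((β - γ) * l) * wpow N (half N * (β - γ) ^ 2) *
          wpow N (γ * (j + l)) * wpow N (half N * γ ^ 2) =
          wpow N (α * j) * wpow N (β * l) * wpow N (half N * β ^ 2) *
            wpow N ((γ - α) * (γ - α + (j - β + α))) := by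
        simp only [← wpow_add]
        congr 1
        linear_combination (γ ^ 2 - β * γ) * two_mul_half hN
      linear_combination (c * fd N (tripleArg μ ρμ μν ρμν) (tripleS ρ μ ν ρμν) (γ - α) *
        wpow N (half N * α ^ 2) * hFun N g (pairArg μ ν μν) *
        fd N (pairArg μ ν μν) (pairS μ ν) (j - (β - γ)) * hFun N g (pairArg ρ μν ρμν) *
        fd N (pairArg ρ μν ρμν) (pairS ρ μν) (i - γ)) * e4
    rw [Finset.sum_congr rfl fun γ _ => h6 γ, ← Finset.mul_sum,
      Fintype.sum_equiv (Equiv.subRight α) (fun γ => fiveTerm N (pairS ρ μ) (pairS μ ν)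
        (pairArg ρ μ ρμ) (pairArg ρμ ν ρμν) (pairArg μ ν μν) (i - α) (j - β + α) (γ - α))
        (fiveTerm N (pairS ρ μ) (pairS μ ν) (pairArg ρ μ ρμ) (pairArg ρμ ν ρμν) (pairArg μ ν μν)
          (i - α) (j - β + α)) (fun γ => rfl), h5]
    linear_combination (-(wpow N (α * j) * wpow N (half N * α ^ 2) * wpow N (β * l) *
      wpow N (half N * β ^ 2) * fd N (pairArg ρ μ ρμ) (pairS ρ μ) (i - α) *
      fd N (pairArg ρμ ν ρμν) (pairS ρμ ν) (i + j - β))) * hc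
  · have hk2 : ¬ i + (j + l) = k := by rwa [← add_assoc]
    simp [hk, hk2]

/-- Rows of the 6j-symbol are coordinates with respect to the right composites, which are linearly
independent. -/
theorem IsSixJ.unique (hN : Odd N) (hN1 : 1 < N) {g : ℂ → ℂ} (hg : IsDetermination N g)
    (h₂ : IsProduct N μ ν μν) (h₃ : IsProduct N ρ μν ρμν)
    {R R' : Matrix (ZMod N × ZMod N) (ZMod N × ZMod N) ℂ}
    (hR : IsSixJ N g ρ μ ν ρμ μν ρμν R) (hR' : IsSixJ N g ρ μ ν ρμ μν ρμν R') : R = R' := by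
  ext p q
  have hlin := Fintype.linearIndependent_iff.mp (isBasisOf_rightComposite hN hN1 hg h₂ h₃).1
    (fun q => R p q - R' p q) ?_ q
  · exact sub_eq_zero.mp hlin
  · ext x k
    have h := congrFun (congrFun ((hR p).symm.trans (hR' p))
      ((Equiv.prodAssoc (ZMod N) (ZMod N) (ZMod N)).symm x)) k
    rw [Matrix.sum_apply, Matrix.sum_apply] at h
    rw [Matrix.sum_apply]
    simp only [Matrix.smul_apply, smul_eq_mul, Matrix.submatrix_apply, Equiv.apply_symm_apply,
      id] at h
    simp only [Matrix.smul_apply, smul_eq_mul, sub_mul, Finset.sum_sub_distrib, h, sub_self,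
      Matrix.zero_apply]

end Triple

/-! ### The twisted dilogarithm operator in normal representations. -/

section Dilogarithm

/-- The powers of `Y`. -/
noncomputable def YPow (N : ℕ) [NeZero N] (a : ZMod N) : Matrix (ZMod N) (ZMod N) ℂ :=
  Matrix.of fun i j => if i = j + a then wpow N (a * j + half N * a ^ 2) else 0

/-- The powers of `Z⁻¹ Y`. -/
noncomputable def ZYPow (N : ℕ) [NeZero N] (a : ZMod N) : Matrix (ZMod N) (ZMod N) ℂ :=
  Matrix.of fun i j => if i = j + a then wpow N (-(half N * a)) else 0

theorem YPow_zero (N : ℕ) [NeZero N] : YPow N 0 = 1 := by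
  ext i j
  simp [YPow, Matrix.one_apply, wpow_zero]

theorem ZYPow_zero (N : ℕ) [NeZero N] : ZYPow N 0 = 1 := by
  ext i j
  simp [ZYPow, Matrix.one_apply, wpow_zero]

theorem YPow_add (hN : Odd N) (a b : ZMod N) : YPow N (a + b) = YPow N a * YPow N b := by
  ext i j
  rw [Matrix.mul_apply, Finset.sum_eq_single (j + b)]
  · simp only [YPow, Matrix.of_apply, if_true, ite_mul, zero_mul, ← wpow_add]
    have e : j + (a + b) = j + b + a := by ring
    rw [e]
    split_ifs
    · congr 1
      linear_combination (a * b) * two_mul_half hN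
    · rfl
  · intro m _ hm
    simp [YPow, hm]
  · simp

theorem ZYPow_add (a b : ZMod N) : ZYPow N (a + b) = ZYPow N a * ZYPow N b := by
  ext i j
  rw [Matrix.mul_apply, Finset.sum_eq_single (j + b)]
  · simp only [ZYPow, Matrix.of_apply, if_true, ite_mul, zero_mul, ← wpow_add]
    have e : j + (a + b) = j + b + a := by ring
    rw [e]
    split_ifs
    · congr 1
      ring
    · rfl
  · intro m _ hm
    simp [ZYPow, hm]
  · simp

theorem YPow_pow (hN : Odd N) (a : ZMod N) (n : ℕ) : YPow N a ^ n = YPow N (n * a) := by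
  induction n with
  | zero => simp [YPow_zero]
  | succ n ih => rw [pow_succ, ih, ← YPow_add hN]; congr 1; push_cast; ring

theorem ZYPow_pow (a : ZMod N) (n : ℕ) : ZYPow N a ^ n = ZYPow N (n * a) := by
  induction n with
  | zero => simp [ZYPow_zero]
  | succ n ih => rw [pow_succ, ih, ← ZYPow_add]; congr 1; push_cast; ring

theorem Ymat_eq (N : ℕ) [NeZero N] : Ymat N = YPow N 1 := by
  ext i j
  simp only [Ymat, Xmat, Zmat, YPow, Matrix.smul_apply, Matrix.mul_diagonal, Matrix.of_apply]
  split_ifs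
  · rw [one_mul, smul_eq_mul, ← wpow_add]
    congr 1
    ring
  · simp

theorem Ymat_inv (hN : Odd N) : (Ymat N)⁻¹ = YPow N (-1) := by
  apply Matrix.inv_eq_right_inv
  rw [Ymat_eq, ← YPow_add hN, add_neg_cancel, YPow_zero]

theorem Zmat_inv (N : ℕ) [NeZero N] : (Zmat N)⁻¹ = Matrix.diagonal fun i => wpow N (-i) := by
  apply Matrix.inv_eq_right_inv
  rw [Zmat, Matrix.diagonal_mul_diagonal, ← Matrix.diagonal_one]
  congr 1
  ext i
  rw [← wpow_add, add_neg_cancel, wpow_zero]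

theorem Zmat_inv_mul_Ymat (hN : Odd N) : (Zmat N)⁻¹ * Ymat N = ZYPow N 1 := by
  ext i j
  rw [Zmat_inv, Ymat_eq, Matrix.diagonal_mul]
  simp only [YPow, ZYPow, Matrix.of_apply]
  split_ifs with h
  · rw [← wpow_add, h]
    congr 1
    linear_combination two_mul_half hN
  · simp

theorem kronecker_pow {m n : Type} [Fintype m] [DecidableEq m] [Fintype n] [DecidableEq n]
    (A : Matrix m m ℂ) (B : Matrix n n ℂ) (k : ℕ) : (A ⊗ₖ B) ^ k = (A ^ k) ⊗ₖ (B ^ k) := by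
  induction k with
  | zero => simp
  | succ k ih => rw [pow_succ, pow_succ, pow_succ, ih, Matrix.mul_kronecker_mul]

theorem normalRep_gen (ρ : StdRep) (x : HeisGen) : normalRep N ρ (Heis.gen N x) = match x with
    | .E => (ρ.a ^ 2)⁻¹ • (Zmat N)⁻¹
    | .Einv => ρ.a ^ 2 • Zmat N
    | .Eb => (ρ.a ^ 2)⁻¹ • Ymat N
    | .Ebinv => ρ.a ^ 2 • (Ymat N)⁻¹
    | .D => (-(ρ.y / ρ.a)) • (Ymat N)⁻¹
    | .Db => (ρ.a * ρ.y)⁻¹ • ((Zmat N)⁻¹ * Ymat N) := by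
  cases x <;> simp [normalRep, Heis.gen]

theorem isUnit_smul_matrix {m : Type} [Fintype m] [DecidableEq m] {c : ℂ} (hc : c ≠ 0)
    {A : Matrix m m ℂ} (hA : IsUnit A) : IsUnit (c • A) :=
  hA.smul (Units.mk0 c hc)

theorem isUnit_normalRep_gen (ρ : StdRep) (x : HeisGen) :
    IsUnit (normalRep N ρ (Heis.gen N x)) := by
  have ha := pow_ne_zero 2 ρ.a_ne
  have hZ := isUnit_Zmat N
  have hY := isUnit_Ymat N
  have hZ' : IsUnit (Zmat N)⁻¹ := Matrix.isUnit_nonsing_inv_iff.mpr hZ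
  have hY' : IsUnit (Ymat N)⁻¹ := Matrix.isUnit_nonsing_inv_iff.mpr hY
  rw [normalRep_gen]
  cases x
  · exact isUnit_smul_matrix (inv_ne_zero ha) hZ'
  · exact isUnit_smul_matrix ha hZ
  · exact isUnit_smul_matrix (inv_ne_zero ha) hY
  · exact isUnit_smul_matrix ha hY'
  · exact isUnit_smul_matrix (neg_ne_zero.mpr (div_ne_zero ρ.y_ne ρ.a_ne)) hY'
  · exact isUnit_smul_matrix (inv_ne_zero (mul_ne_zero ρ.a_ne ρ.y_ne)) (hZ'.mul hY)

/-- The representation of the dilogarithm operator with parameters `-s`, `1` on the two factors and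
central root `t`. -/
noncomputable def dilogRep (hN : Odd N) {t s : ℂ} (hs : s ≠ 0) (h : t ^ N + s ^ N = 1) {c : ℂ}
    (hc : c ≠ 0) : RomegaRep N where
  π₁ := normalRep N ⟨1, -s, one_ne_zero, neg_ne_zero.mpr hs⟩
  π₂ := normalRep N ⟨1, 1, one_ne_zero, one_ne_zero⟩
  cyclic₁ := isUnit_normalRep_gen _
  cyclic₂ := isUnit_normalRep_gen _
  cE := 1
  cEb := 1
  b := t
  norm := c
  cE_pow := by
    simp only [normalRep_gen, Zmat_inv, one_pow, inv_one, one_smul, Matrix.diagonal_pow]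
    rw [← Matrix.diagonal_one]
    congr 1
    ext i
    simp [wpow_pow_card]
  cEb_pow := by
    simp only [normalRep_gen, one_pow, inv_one, one_smul]
    rw [Ymat_eq, YPow_pow hN]
    simp [YPow_zero]
  b_pow := by
    simp only [normalRep_gen, mul_one, inv_one, one_smul, div_one, neg_neg, Matrix.smul_kronecker,
      smul_pow, kronecker_pow, Zmat_inv_mul_Ymat hN, Ymat_inv hN, YPow_pow hN, ZYPow_pow]
    rw [← h]
    simp [YPow_zero, ZYPow_zero]
  norm_ne := hc

/-- The sum over the powers of `E` is a discrete delta selecting `j = a`, so `Υ` applies `Y^a` to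
the second factor when the first is in state `a`. -/
theorem dilogRep_upsilon_apply (hN : Odd N) {t s : ℂ} (hs : s ≠ 0) (h : t ^ N + s ^ N = 1) {c : ℂ}
    (hc : c ≠ 0) (a b a' b' : ZMod N) :
    (dilogRep hN hs h hc).upsilon (a, b) (a', b') = if a = a' then YPow N a b b' else 0 := by
  have hNN : (N : ℂ) ≠ 0 := Nat.cast_ne_zero.mpr (NeZero.ne N)
  have h1 : ∀ i j : ℕ, (root N ^ (i * j) • ((((1 : ℂ)⁻¹ • normalRep N
      ⟨1, -s, one_ne_zero, neg_ne_zero.mpr hs⟩ (Heis.gen N .E)) ^ i) ⊗ₖ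
      (((1 : ℂ)⁻¹ • normalRep N ⟨1, 1, one_ne_zero, one_ne_zero⟩ (Heis.gen N .Eb)) ^ j)))
      (a, b) (a', b') = if a = a' then wpow N ((j - a) * i) * YPow N j b b' else 0 := by
    intro i j
    simp only [normalRep_gen, inv_one, one_smul, one_pow, Zmat_inv, Matrix.diagonal_pow, Ymat_eq,
      YPow_pow hN, Matrix.smul_apply, Matrix.kroneckerMap_apply, Matrix.diagonal_apply,
      smul_eq_mul, mul_one, Pi.pow_apply, wpow_pow]
    split_ifs with e
    · rw [← mul_assoc, ← wpow_natCast, ← wpow_add]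
      congr 2
      push_cast
      ring
    · simp
  rw [RomegaRep.upsilon, Matrix.smul_apply, Matrix.sum_apply]
  simp only [Matrix.sum_apply]
  change (N : ℂ)⁻¹ • ∑ i ∈ Finset.range N, ∑ j ∈ Finset.range N, (root N ^ (i * j) •
    ((((1 : ℂ)⁻¹ • normalRep N ⟨1, -s, one_ne_zero, neg_ne_zero.mpr hs⟩ (Heis.gen N .E)) ^ i) ⊗ₖ
      (((1 : ℂ)⁻¹ • normalRep N ⟨1, 1, one_ne_zero, one_ne_zero⟩ (Heis.gen N .Eb)) ^ j)))
      (a, b) (a', b') = _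
  simp only [h1]
  split_ifs with e
  · rw [Finset.sum_comm, ← sum_zmod_eq_sum_range (fun j => ∑ i ∈ Finset.range N,
      wpow N (((j : ZMod N) - a) * (i : ZMod N)) * YPow N j b b')]
    have h2 : ∀ j : ZMod N, ∑ i ∈ Finset.range N,
        wpow N ((((j.val : ℕ) : ZMod N) - a) * (i : ZMod N)) * YPow N ((j.val : ℕ) : ZMod N) b b' =
        if j = a then N * YPow N a b b' else 0 := by
      intro j
      rw [ZMod.natCast_zmod_val, ← Finset.sum_mul, ← sum_zmod_eq_sum_range (fun i =>
        wpow N ((j - a) * (i : ZMod N)))]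
      simp only [ZMod.natCast_zmod_val, sum_wpow_mul, sub_eq_zero]
      split_ifs with e2
      · rw [e2]
      · simp
    simp only [h2, Finset.sum_ite_eq', Finset.mem_univ, if_true, smul_eq_mul]
    field_simp
  · simp

/-- The `n`-th power of `D ⊗ D̄` shifts the first index by `-n` and the second by `n`, so each entry
receives a single term of the series, the one with `n = a' - a`. -/
theorem dilogRep_psi_apply (hN : Odd N) {t s : ℂ} (hs : s ≠ 0) (h : t ^ N + s ^ N = 1) {c : ℂ}
    (hc : c ≠ 0) (a b a' b' : ZMod N) :
    (dilogRep hN hs h hc).psi (a, b) (a', b') =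
      if b = b' + (a' - a) then c * fd N t s (a' - a) * wpow N (-((a' - a) * a)) else 0 := by
  -- Writing `1/(1 - ω^{-k}t)` as `ω^k/(ω^k - t)` turns the coefficients into dilogarithms times
  -- `ω^{n(n+1)/2}`; the power `s^n` comes from the scalar by which `D ⊗ D̄` acts.
  have hcoef : ∀ n : ℕ, n < N →
      (∏ k ∈ Finset.range n, 1 / (1 - (root N)⁻¹ ^ (k + 1) * t)) * s ^ n =
      wpow N (half N * (n ^ 2 + n)) * fd N t s n := by
    intro n hn
    have hb : wpow N (half N * (n ^ 2 + n)) = ∏ k ∈ Finset.range n, root N ^ (k + 1) := by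
      clear hn
      induction n with
      | zero => simp [wpow_zero]
      | succ n ih =>
        rw [Finset.prod_range_succ, ← ih, ← wpow_natCast, ← wpow_add]
        congr 1
        push_cast
        linear_combination ((n : ZMod N) + 1) * two_mul_half hN
    rw [fd_natCast_lt hn, hb, ← Finset.prod_mul_distrib, ← Finset.card_range n,
      ← Finset.prod_const, Finset.card_range, ← Finset.prod_mul_distrib]
    refine Finset.prod_congr rfl fun k _ => ?_
    have hr := pow_ne_zero (k + 1) (root_ne_zero N)
    have h2 : root N ^ (k + 1) - t ≠ 0 := by
      rw [← wpow_natCast]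
      exact wpow_sub_ne_zero (pow_ne_one_of_add hs h) _
    have h3 : 1 - (root N)⁻¹ ^ (k + 1) * t = (root N ^ (k + 1) - t) / root N ^ (k + 1) := by
      rw [inv_pow]; field_simp
    rw [h3]
    field_simp
  have h1 : ∀ n : ℕ, ((∏ k ∈ Finset.range n, 1 / (1 - (root N)⁻¹ ^ (k + 1) * t)) •
      ((normalRep N ⟨1, -s, one_ne_zero, neg_ne_zero.mpr hs⟩ (Heis.gen N .D)) ⊗ₖ
      (normalRep N ⟨1, 1, one_ne_zero, one_ne_zero⟩ (Heis.gen N .Db))) ^ n) (a, b) (a', b') =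
      (∏ k ∈ Finset.range n, 1 / (1 - (root N)⁻¹ ^ (k + 1) * t)) * s ^ n *
        (YPow N (-n) a a' * ZYPow N n b b') := by
    intro n
    simp only [normalRep_gen, mul_one, inv_one, one_smul, div_one, neg_neg, Matrix.smul_kronecker,
      smul_pow, kronecker_pow, Zmat_inv_mul_Ymat hN, Ymat_inv hN, YPow_pow hN, ZYPow_pow,
      Matrix.smul_apply, Matrix.kroneckerMap_apply, smul_eq_mul, mul_neg]
    ring
  rw [RomegaRep.psi, Matrix.smul_apply, Matrix.sum_apply]
  change c • ∑ n ∈ Finset.range N, ((∏ k ∈ Finset.range n, 1 / (1 - (root N)⁻¹ ^ (k + 1) * t)) •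
      ((normalRep N ⟨1, -s, one_ne_zero, neg_ne_zero.mpr hs⟩ (Heis.gen N .D)) ⊗ₖ
      (normalRep N ⟨1, 1, one_ne_zero, one_ne_zero⟩ (Heis.gen N .Db))) ^ n) (a, b) (a', b') = _
  simp only [h1]
  have h2 : ∀ n ∈ Finset.range N, (∏ k ∈ Finset.range n, 1 / (1 - (root N)⁻¹ ^ (k + 1) * t)) *
      s ^ n * (YPow N (-n) a a' * ZYPow N n b b') =
      wpow N (half N * (n ^ 2 + n)) * fd N t s n * (YPow N (-n) a a' * ZYPow N n b b') :=
    fun n hn => by rw [hcoef n (Finset.mem_range.mp hn)]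
  rw [Finset.sum_congr rfl h2, ← sum_zmod_eq_sum_range (fun n =>
    wpow N (half N * ((n : ZMod N) ^ 2 + n)) * fd N t s n *
      (YPow N (-(n : ZMod N)) a a' * ZYPow N n b b'))]
  simp only [ZMod.natCast_zmod_val]
  rw [Finset.sum_eq_single (a' - a)]
  · simp only [YPow, ZYPow, Matrix.of_apply]
    have e : a = a' + -(a' - a) := by ring
    rw [if_pos e]
    split_ifs
    · have e2 : wpow N (half N * ((a' - a) ^ 2 + (a' - a))) *
          (wpow N (-(a' - a) * a' + half N * (-(a' - a)) ^ 2) * wpow N (-(half N * (a' - a)))) =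
          wpow N (-((a' - a) * a)) := by
        simp only [← wpow_add]
        congr 1
        linear_combination ((a' - a) ^ 2) * two_mul_half hN
      rw [smul_eq_mul]
      linear_combination (c * fd N t s (a' - a)) * e2
    · simp
  · intro n _ hn
    have : ¬ a = a' + -n := fun e => hn (by rw [e]; ring)
    simp [YPow, this]
  · simp

theorem dilogRep_image (hN : Odd N) {t s : ℂ} (hs : s ≠ 0) (h : t ^ N + s ^ N = 1) {c : ℂ}
    (hc : c ≠ 0) : (dilogRep hN hs h hc).image = cycMat N c t s := by
  ext ⟨a, b⟩ ⟨a', b'⟩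
  rw [RomegaRep.image, Matrix.mul_apply, Fintype.sum_prod_type]
  simp only [dilogRep_upsilon_apply, dilogRep_psi_apply]
  rw [Finset.sum_eq_single a]
  · rw [Finset.sum_eq_single (b' + (a' - a))]
    · simp only [if_true, YPow, cycMat, Matrix.of_apply]
      have e : b = b' + (a' - a) + a ↔ a' + b' = b := by
        rw [eq_comm]
        exact Eq.congr_left (by ring)
      simp only [e]
      split_ifs
      · have e2 : wpow N (a * (b' + (a' - a)) + half N * a ^ 2) * wpow N (-((a' - a) * a)) =
            wpow N (a * b') * wpow N (half N * a ^ 2) := by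
          simp only [← wpow_add]
          congr 1
          ring
        linear_combination (c * fd N t s (a' - a)) * e2
      · simp
    · intro m _ hm
      simp [hm]
    · simp
  · intro m _ hm
    simp [Ne.symm hm]
  · simp

end Dilogarithm

/-! ### Principal determinations, and multiplication of the arguments by `ω`. -/

/-- The principal `N`-th root of `1 - t ω^k`. -/
noncomputable def rootFactor (N : ℕ) (k : ZMod N) (t : ℂ) : ℂ := (1 - t * wpow N k) ^ ((N : ℂ)⁻¹)

/-- The determination of `(1 - t^N)^{1/N}` given by the product of the principal roots of the
factors of `1 - t^N`. -/
noncomputable def rProd (N : ℕ) [NeZero N] (t : ℂ) : ℂ := ∏ k : ZMod N, rootFactor N k t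

theorem rootFactor_pow (k : ZMod N) (t : ℂ) : rootFactor N k t ^ N = 1 - t * wpow N k :=
  Complex.cpow_nat_inv_pow _ (NeZero.ne N)

theorem rProd_pow (t : ℂ) : rProd N t ^ N = 1 - t ^ N := by
  rw [rProd, ← Finset.prod_pow, one_sub_pow_eq_prod_zmod]
  exact Finset.prod_congr rfl fun k _ => rootFactor_pow k t

theorem rProd_ne_zero {t : ℂ} (h : t ^ N ≠ 1) : rProd N t ≠ 0 := by
  intro h0
  have := rProd_pow (N := N) t
  rw [h0, zero_pow (NeZero.ne N)] at this
  exact h (by linear_combination this)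

theorem rootFactor_ne_zero {t : ℂ} (h : t ^ N ≠ 1) (k : ZMod N) : rootFactor N k t ≠ 0 :=
  Finset.prod_ne_zero_iff.mp (rProd_ne_zero h) k (Finset.mem_univ k)

theorem gPrincipal_eq (N : ℕ) [NeZero N] (t : ℂ) :
    gPrincipal N t = ∏ k : ZMod N, rootFactor N k t ^ k.val := by
  rw [gPrincipal, ← prod_zmod_eq_prod_range
    (fun j => (1 - t * root N ^ j) ^ ((j : ℂ) / (N : ℂ)))]
  refine Finset.prod_congr rfl fun k _ => ?_
  rw [rootFactor, ← Complex.cpow_nat_mul, div_eq_mul_inv]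
  rfl

theorem isDetermination_gPrincipal (N : ℕ) [NeZero N] : IsDetermination N (gPrincipal N) := by
  intro t
  rw [gPrincipal_eq, ← Finset.prod_pow,
    ← prod_zmod_eq_prod_range (fun j => (1 - t * root N ^ j) ^ j)]
  refine Finset.prod_congr rfl fun k _ => ?_
  rw [← pow_mul, mul_comm, pow_mul, rootFactor_pow]
  rfl

theorem rootFactor_root_mul (k : ZMod N) (t : ℂ) :
    rootFactor N k (root N * t) = rootFactor N (k + 1) t := by
  rw [rootFactor, rootFactor, wpow_add, wpow_one]
  congr 2
  ring

theorem rProd_root_mul (t : ℂ) : rProd N (root N * t) = rProd N t := by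
  simp only [rProd, rootFactor_root_mul]
  exact Fintype.prod_equiv (Equiv.addRight 1) _ _ fun k => rfl

/-- Multiplying `t` by `ω` shifts the index of the root factors, so the exponent of factor `k` drops
from `k` to `k - 1` and `rProd` restores it. Factor `0` instead gets exponent `N - 1`, which `rProd`
completes to `N`, giving `1 - t`. -/
theorem gPrincipal_root_mul (t : ℂ) :
    gPrincipal N (root N * t) * rProd N t = (1 - t) * gPrincipal N t := by
  rw [gPrincipal_eq, gPrincipal_eq, rProd]
  have h1 : ∏ k : ZMod N, rootFactor N k (root N * t) ^ k.val =
      ∏ k : ZMod N, rootFactor N k t ^ (k - 1).val :=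
    Fintype.prod_equiv (Equiv.addRight 1) _ _ fun k => by simp [rootFactor_root_mul]
  rw [h1, ← Finset.prod_mul_distrib, Fintype.prod_eq_mul_prod_compl 0,
    Fintype.prod_eq_mul_prod_compl 0 (fun k : ZMod N => rootFactor N k t ^ k.val), ← mul_assoc]
  have e0 : ((0 : ZMod N) - 1).val + 1 = N := by
    have h := NeZero.pos N
    have e : (0 : ZMod N) - 1 = ((N - 1 : ℕ) : ZMod N) := by
      rw [Nat.cast_sub h]
      simp
    rw [e, ZMod.val_cast_of_lt (by omega)]
    omega
  congr 1
  · rw [← pow_succ, e0, rootFactor_pow, wpow_zero]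
    simp
  · refine Finset.prod_congr rfl fun k hk => ?_
    have hk0 : k ≠ 0 := by simpa using hk
    have h2 : k.val ≠ 0 := fun h => hk0 ((ZMod.val_eq_zero k).mp h)
    have e1 : (k - 1).val + 1 = k.val := by
      have e : k - 1 = ((k.val - 1 : ℕ) : ZMod N) := by
        rw [Nat.cast_sub (by omega)]
        simp
      rw [e, ZMod.val_cast_of_lt (by have := ZMod.val_lt k; omega)]
      omega
    rw [← pow_succ, e1]

theorem root_pow_half (hN : Odd N) : (root N ^ ((N - 1) / 2))⁻¹ = wpow N (half N) := by
  rw [← wpow_natCast, ← wpow_neg]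
  congr 1
  obtain ⟨k, hk⟩ := hN
  have e1 : (N - 1) / 2 = k := by omega
  have e2 : (N + 1) / 2 = k + 1 := by omega
  have : ((2 * k + 1 : ℕ) : ZMod N) = 0 := by rw [← hk]; exact ZMod.natCast_self N
  rw [half, e1, e2]
  push_cast at this ⊢
  linear_combination -this

theorem hFun_gPrincipal_root_mul (hN : Odd N) (t : ℂ) :
    hFun N (gPrincipal N) (root N * t) * rProd N t =
      wpow N (half N) * (1 - t) * hFun N (gPrincipal N) t := by
  rw [hFun, hFun, ← root_pow_half hN, mul_pow, mul_inv]
  linear_combination ((root N ^ ((N - 1) / 2))⁻¹ * (t ^ ((N - 1) / 2))⁻¹ / gPrincipal N 1) *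
    gPrincipal_root_mul (N := N) t

theorem fd_neg_one (hN : Odd N) {t s : ℂ} (hs : s ≠ 0) (h : t ^ N + s ^ N = 1) :
    s * fd N t s (-1) = 1 - t := by
  have := fd_rec hN hs h 0
  simpa [wpow_zero] using this.symm

/-- Here `t` alone is multiplied by `ω`; `fd_succ_root_mul` treats the case of `t` and `s` together.
Both occur in the five-term summand when `t₂` or `t₃` changes by a root of unity. -/
theorem fd_root_mul_left (hN : Odd N) {t s : ℂ} (hs : s ≠ 0) (h : t ^ N + s ^ N = 1) (n : ZMod N) :
    (1 - t) * fd N (root N * t) s n = s * wpow N (-n) * fd N t s (n - 1) := by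
  have h' : (root N * t) ^ N + s ^ N = 1 := by rw [mul_pow, root_pow, one_mul, h]
  have := eq_mul_fd_of_rec hN hs h' (u := fun n => wpow N (-n) * fd N t s (n - 1)) (fun n => by
    have h1 := fd_rec hN hs h (n - 1)
    have e1 : wpow N n = root N * wpow N (n - 1) := by
      rw [← wpow_one N, ← wpow_add]; congr 1; ring
    have e2 : wpow N (-(n - 1)) = root N * wpow N (-n) := by
      rw [← wpow_one N, ← wpow_add]; congr 1; ring
    rw [e1, e2]
    linear_combination (root N * wpow N (-n)) * h1) n
  rw [zero_sub, neg_zero, wpow_zero, one_mul] at this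
  rw [← fd_neg_one hN hs h]
  linear_combination (-s) * this

theorem fd_succ_root_mul (hN : Odd N) {t s : ℂ} (hs : s ≠ 0) (h : t ^ N + s ^ N = 1) (n : ZMod N) :
    s * fd N t s n = (1 - t) * fd N (root N * t) (root N * s) (n + 1) := by
  have h1 := fd_div_fd_root_mul hN hs h n
  have h2 := fd_root_mul_rec hN hs h (n + 1)
  have h3 := fd_ne_zero (mul_ne_zero (root_ne_zero N) hs) (fd_root_mul_add h) n
  have h4 := wpow_sub_ne_zero (pow_ne_one_of_add hs h) n
  rw [div_eq_div_iff h3 h4] at h1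
  rw [add_sub_cancel_right] at h2
  apply mul_right_cancel₀ h4
  linear_combination s * h1 - (1 - t) * h2

/-- The exponent of the root of unity in the five-term identity. -/
def fiveExponent (N : ℕ) (e₁ e₂ e₃ e₄ f : ZMod N) : ZMod N :=
  half N ^ 3 + (e₁ - f) * (e₂ - e₃) - half N * (e₄ - e₃ - f) ^ 2

/-- The product of the constant and of the normalizations on one side of the five-term identity. -/
noncomputable def fiveRight (N : ℕ) [NeZero N] (s₁ s₃ t₁ t₂ t₃ : ℂ) : ℂ :=
  fiveSum N s₁ s₃ t₁ t₂ t₃ 0 0 * (hFun N (gPrincipal N) (t₁ * t₃ / t₂) *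
    hFun N (gPrincipal N) t₃ * hFun N (gPrincipal N) (t₂ / t₃))

/-- The product of the normalizations on the other side of the five-term identity. -/
noncomputable def fiveLeft (N : ℕ) (t₁ t₂ : ℂ) : ℂ :=
  hFun N (gPrincipal N) t₁ * hFun N (gPrincipal N) t₂

/-- The five-term identity with its exact constant. -/
def FiveIdentity (N : ℕ) [NeZero N] (s₁ s₃ t₁ t₂ t₃ : ℂ) : Prop :=
  ∀ e₁ e₂ e₃ e₄ f : ZMod N, s₁ = wpow N e₁ * rProd N t₁ → t₁ * s₃ = wpow N e₂ * rProd N t₂ →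
    s₃ = wpow N e₃ * rProd N t₃ → -(s₁ * s₃ / t₃) = wpow N e₄ * rProd N (t₂ / t₃) →
    s₁ / t₂ = wpow N f * rProd N (t₁ * t₃ / t₂) →
    wpow N (fiveExponent N e₁ e₂ e₃ e₄ f) * fiveRight N s₁ s₃ t₁ t₂ t₃ = fiveLeft N t₁ t₂

namespace FiveData

variable {s₁ s₃ t₁ t₂ t₃ : ℂ}

theorem root_mul₃ (d : FiveData N s₁ s₃ t₁ t₂ t₃) : FiveData N s₁ s₃ t₁ t₂ (root N * t₃) :=
  { d with
    t₃_ne := mul_ne_zero (root_ne_zero N) d.t₃_ne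
    eq₃ := by rw [mul_pow, root_pow, one_mul, d.eq₃] }

theorem root_mul₂ (d : FiveData N s₁ s₃ t₁ t₂ t₃) : FiveData N s₁ s₃ t₁ (root N * t₂) t₃ :=
  { d with
    t₂_ne := mul_ne_zero (root_ne_zero N) d.t₂_ne
    eq₂ := by rw [mul_pow, root_pow, one_mul, d.eq₂] }

/-- Replacing `t₃` by `ωt₃` multiplies `t₁t₃/t₂` by `ω` and divides `t₂/t₃` and its `s` by `ω`. All
three factors then move to `γ - 1` with scalars independent of `γ`, so the sums are proportional. -/
theorem fiveSum_root_mul₃ (hN : Odd N) (d : FiveData N s₁ s₃ t₁ t₂ t₃) :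
    (1 - t₁ * t₃ / t₂) * (1 - t₃) * -(s₁ * s₃ / (root N * t₃)) *
        fiveSum N s₁ s₃ t₁ t₂ (root N * t₃) 0 0 =
      s₁ / t₂ * s₃ * (1 - t₂ / (root N * t₃)) * wpow N (-1) * fiveSum N s₁ s₃ t₁ t₂ t₃ 0 0 := by
  have hr := root_ne_zero N
  have h3 := d.t₃_ne
  have e1 : t₁ * (root N * t₃) / t₂ = root N * (t₁ * t₃ / t₂) := by ring
  have e2 : root N * (t₂ / (root N * t₃)) = t₂ / t₃ := by field_simp
  have e3 : root N * -(s₁ * s₃ / (root N * t₃)) = -(s₁ * s₃ / t₃) := by field_simp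
  have hsum : fiveSum N s₁ s₃ t₁ t₂ t₃ 0 0 =
      ∑ γ : ZMod N, fiveTerm N s₁ s₃ t₁ t₂ t₃ 0 0 (γ - 1) :=
    (Fintype.sum_equiv (Equiv.subRight 1) _ _ fun γ => rfl).symm
  rw [hsum, fiveSum, Finset.mul_sum, Finset.mul_sum]
  refine Finset.sum_congr rfl fun γ _ => ?_
  have l1 := fd_root_mul_left hN d.s₅_ne d.eq₅ γ
  have l2 := fd_root_mul_left hN d.s₃_ne d.eq₃ γ
  have l3 := fd_succ_root_mul hN d.root_mul₃.s₄_ne (d.root_mul₃.eq₄ hN) (-γ)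
  rw [e2, e3] at l3
  have e4 : wpow N (γ * γ) * wpow N (-γ) * wpow N (-γ) =
      wpow N ((γ - 1) * (γ - 1)) * wpow N (-1) := by
    simp only [← wpow_add]; congr 1; ring
  have e5 : 0 - (γ - 1) = -γ + 1 := by ring
  simp only [fiveTerm, zero_add, add_zero, zero_sub, e1, e5]
  calc _ = wpow N (γ * γ) * ((1 - t₁ * t₃ / t₂) * fd N (root N * (t₁ * t₃ / t₂)) (s₁ / t₂) γ) *
        ((1 - t₃) * fd N (root N * t₃) s₃ γ) * (-(s₁ * s₃ / (root N * t₃)) *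
          fd N (t₂ / (root N * t₃)) (-(s₁ * s₃ / (root N * t₃))) (-γ)) := by ring
    _ = _ := by
      rw [l1, l2, l3]
      linear_combination (s₁ / t₂ * fd N (t₁ * t₃ / t₂) (s₁ / t₂) (γ - 1) * s₃ *
        fd N t₃ s₃ (γ - 1) * (1 - t₂ / (root N * t₃)) *
        fd N (t₂ / t₃) (-(s₁ * s₃ / t₃)) (-γ + 1)) * e4

/-- Replacing `t₂` by `ωt₂` moves the summand to index `γ + 1` of the sum at `(0, -1)`, which
`fiveSum_eq` relates to the sum at `(0, 0)`. -/
theorem fiveSum_root_mul₂ (hN : Odd N) (d : FiveData N s₁ s₃ t₁ t₂ t₃) :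
    s₁ / (root N * t₂) * (1 - t₂ / t₃) * (t₁ * s₃) *
        fiveSum N s₁ s₃ t₁ (root N * t₂) t₃ 0 0 =
      (1 - t₁ * t₃ / (root N * t₂)) * -(s₁ * s₃ / t₃) * (1 - t₂) *
        fiveSum N s₁ s₃ t₁ t₂ t₃ 0 0 := by
  have hr := root_ne_zero N
  have h2 := d.t₂_ne
  have e1 : root N * t₂ / t₃ = root N * (t₂ / t₃) := by ring
  have e2 : root N * (t₁ * t₃ / (root N * t₂)) = t₁ * t₃ / t₂ := by field_simp
  have e3 : root N * (s₁ / (root N * t₂)) = s₁ / t₂ := by field_simp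
  have hC := d.fiveSum_eq hN 0 (-1)
  rw [zero_add, fd_zero, mul_one] at hC
  have hC2 := fd_neg_one hN d.s₂_ne d.eq₂
  have hsum : fiveSum N s₁ s₃ t₁ t₂ t₃ 0 (-1) =
      ∑ γ : ZMod N, fiveTerm N s₁ s₃ t₁ t₂ t₃ 0 (-1) (γ + 1) :=
    (Fintype.sum_equiv (Equiv.addRight 1) _ _ fun γ => rfl).symm
  have key : s₁ / (root N * t₂) * (1 - t₂ / t₃) * fiveSum N s₁ s₃ t₁ (root N * t₂) t₃ 0 0 =
      (1 - t₁ * t₃ / (root N * t₂)) * -(s₁ * s₃ / t₃) * fiveSum N s₁ s₃ t₁ t₂ t₃ 0 (-1) := by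
    rw [hsum, fiveSum, Finset.mul_sum, Finset.mul_sum]
    refine Finset.sum_congr rfl fun γ _ => ?_
    have l1 := fd_root_mul_left hN d.s₄_ne (d.eq₄ hN) (-γ)
    have l3 := fd_succ_root_mul hN d.root_mul₂.s₅_ne d.root_mul₂.eq₅ γ
    rw [e2, e3] at l3
    rw [neg_neg] at l1
    have e4 : wpow N (γ * γ) * wpow N γ = wpow N ((γ + 1) * (γ + 1 + -1)) := by
      simp only [← wpow_add]; congr 1; ring
    have e5 : -1 + (γ + 1) = γ := by ring
    have e6 : -(γ + 1) = -γ - 1 := by ring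
    simp only [fiveTerm, zero_add, add_zero, zero_sub, e1, e5, e6]
    calc _ = wpow N (γ * γ) * (s₁ / (root N * t₂) * fd N (t₁ * t₃ / (root N * t₂))
          (s₁ / (root N * t₂)) γ) * fd N t₃ s₃ γ * ((1 - t₂ / t₃) *
          fd N (root N * (t₂ / t₃)) (-(s₁ * s₃ / t₃)) (-γ)) := by ring
      _ = _ := by
        rw [l1, l3]
        linear_combination ((1 - t₁ * t₃ / (root N * t₂)) *
          fd N (t₁ * t₃ / t₂) (s₁ / t₂) (γ + 1) * fd N t₃ s₃ γ * -(s₁ * s₃ / t₃) *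
          fd N (t₂ / t₃) (-(s₁ * s₃ / t₃)) (-γ - 1)) * e4
  rw [hC] at key
  linear_combination (t₁ * s₃) * key + ((1 - t₁ * t₃ / (root N * t₂)) * -(s₁ * s₃ / t₃) *
    fiveSum N s₁ s₃ t₁ t₂ t₃ 0 0) * hC2

theorem one_sub_ne_zero {t : ℂ} (h : t ^ N ≠ 1) : 1 - t ≠ 0 := by
  have := wpow_sub_ne_zero h 0
  rwa [wpow_zero] at this

/-- Only `e₄` changes, to `e₄ - 1`. The change of the quadratic exponent (`hQ`) cancels the phases
produced by the three values of `h` and by the sum. -/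
theorem fiveIdentity_of_root_mul₃ (hN : Odd N) (d : FiveData N s₁ s₃ t₁ t₂ t₃)
    (h : FiveIdentity N s₁ s₃ t₁ t₂ (root N * t₃)) : FiveIdentity N s₁ s₃ t₁ t₂ t₃ := by
  intro e₁ e₂ e₃ e₄ f h₁ h₂ h₃ h₄ h₅
  have hr := root_ne_zero N
  have k1 := d.t₃_ne
  have E1 : t₁ * (root N * t₃) / t₂ = root N * (t₁ * t₃ / t₂) := by ring
  have E2 : root N * (t₂ / (root N * t₃)) = t₂ / t₃ := by field_simp
  have E3 : root N * -(s₁ * s₃ / (root N * t₃)) = -(s₁ * s₃ / t₃) := by field_simp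
  have h₄' : -(s₁ * s₃ / (root N * t₃)) = wpow N (e₄ - 1) * rProd N (t₂ / (root N * t₃)) := by
    have : rProd N (t₂ / t₃) = rProd N (t₂ / (root N * t₃)) := by rw [← E2, rProd_root_mul]
    rw [this, ← E3] at h₄
    apply mul_left_cancel₀ hr
    rw [h₄, wpow_sub, wpow_one]
    field_simp
  have key := h e₁ e₂ e₃ (e₄ - 1) f h₁ h₂ (by rw [rProd_root_mul]; exact h₃) h₄'
    (by rw [E1, rProd_root_mul]; exact h₅)
  rw [← key, fiveRight, fiveRight, E1]
  have n3 : 1 - t₃ ≠ 0 := one_sub_ne_zero (pow_ne_one_of_add d.s₃_ne d.eq₃)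
  have n4 := one_sub_ne_zero (pow_ne_one_of_add (N := N) d.root_mul₃.s₄_ne (d.root_mul₃.eq₄ hN))
  have n5 := one_sub_ne_zero (pow_ne_one_of_add (N := N) d.s₅_ne d.eq₅)
  have S := d.fiveSum_root_mul₃ hN
  have g3 := hFun_gPrincipal_root_mul hN t₃
  have g4 := hFun_gPrincipal_root_mul hN (t₂ / (root N * t₃))
  have g5 := hFun_gPrincipal_root_mul hN (t₁ * t₃ / t₂)
  rw [E2] at g4
  have s3 := d.s₃_ne
  have s4 := d.root_mul₃.s₄_ne
  have s5 := d.s₅_ne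
  have hQ : wpow N (fiveExponent N e₁ e₂ e₃ (e₄ - 1) f) =
      wpow N (fiveExponent N e₁ e₂ e₃ e₄ f) * (wpow N (e₄ - 1) / (wpow N e₃ * wpow N f) *
        wpow N (half N) ) := by
    rw [← wpow_add, ← wpow_sub, ← wpow_add, ← wpow_add]
    congr 1
    unfold fiveExponent
    linear_combination (e₄ - e₃ - f - 1) * two_mul_half hN
  have hw : wpow N (-1) * wpow N (half N) * wpow N (half N) = 1 := by
    rw [← wpow_add, ← wpow_add, ← wpow_zero N]
    congr 1
    linear_combination two_mul_half hN
  rw [hQ]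
  have w1 := wpow_ne_zero N e₃
  have w2 := wpow_ne_zero N f
  have w3 := wpow_ne_zero N (e₄ - 1)
  have w4 := wpow_ne_zero N (half N)
  generalize hFun N (gPrincipal N) (root N * t₃) = H3 at *
  generalize hFun N (gPrincipal N) (root N * (t₁ * t₃ / t₂)) = H5 at *
  generalize hFun N (gPrincipal N) (t₂ / (root N * t₃)) = H4 at *
  generalize hFun N (gPrincipal N) t₃ = G3 at *
  generalize hFun N (gPrincipal N) (t₁ * t₃ / t₂) = G5 at *
  generalize hFun N (gPrincipal N) (t₂ / t₃) = G4 at *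
  generalize fiveSum N s₁ s₃ t₁ t₂ t₃ 0 0 = C at *
  generalize fiveSum N s₁ s₃ t₁ t₂ (root N * t₃) 0 0 = C' at *
  generalize s₁ / t₂ = S5 at *
  generalize -(s₁ * s₃ / (root N * t₃)) = S4 at *
  generalize t₁ * t₃ / t₂ = T5 at *
  generalize t₂ / (root N * t₃) = T4 at *
  generalize rProd N T5 = R5 at *
  generalize rProd N T4 = R4 at *
  generalize rProd N t₃ = R3 at *
  generalize wpow N (half N) = u at *
  generalize wpow N (-1) = v at *
  generalize wpow N e₃ = w₃ at *
  generalize wpow N f = w₅ at *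
  generalize wpow N (e₄ - 1) = w₄ at *
  generalize wpow N (fiveExponent N e₁ e₂ e₃ e₄ f) = q at *
  have r3 : R3 ≠ 0 := fun h0 => s3 (by rw [h₃, h0, mul_zero])
  have r4 : R4 ≠ 0 := fun h0 => s4 (by rw [h₄', h0, mul_zero])
  have r5 : R5 ≠ 0 := fun h0 => s5 (by rw [h₅, h0, mul_zero])
  have g3' : H3 = u * (1 - t₃) * G3 / R3 := by rw [eq_div_iff r3, g3]
  have g5' : H5 = u * (1 - T5) * G5 / R5 := by rw [eq_div_iff r5, g5]
  have g4' : H4 = G4 * R4 / (u * (1 - T4)) := by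
    rw [eq_div_iff (mul_ne_zero w4 n4), g4]; ring
  have S' : C' = S5 * s₃ * (1 - T4) * v * C / ((1 - T5) * (1 - t₃) * S4) := by
    rw [eq_div_iff (mul_ne_zero (mul_ne_zero n5 n3) s4), ← S]; ring
  rw [g3', g5', g4', S']
  clear g3' g5' g4' S' S g3 g4 g5 key
  rw [h₃, h₄', h₅]
  field_simp
  linear_combination (-(q*C*G5*G3*G4)) * hw

/-- As for `t₃`, except that now `f` is the exponent that changes, to `f - 1`. -/
theorem fiveIdentity_of_root_mul₂ (hN : Odd N) (d : FiveData N s₁ s₃ t₁ t₂ t₃)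
    (h : FiveIdentity N s₁ s₃ t₁ (root N * t₂) t₃) : FiveIdentity N s₁ s₃ t₁ t₂ t₃ := by
  intro e₁ e₂ e₃ e₄ f h₁ h₂ h₃ h₄ h₅
  have hr := root_ne_zero N
  have k1 := d.t₂_ne
  have E1 : root N * t₂ / t₃ = root N * (t₂ / t₃) := by ring
  have E2 : root N * (t₁ * t₃ / (root N * t₂)) = t₁ * t₃ / t₂ := by field_simp
  have E3 : root N * (s₁ / (root N * t₂)) = s₁ / t₂ := by field_simp
  have h₅' : s₁ / (root N * t₂) = wpow N (f - 1) * rProd N (t₁ * t₃ / (root N * t₂)) := by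
    have : rProd N (t₁ * t₃ / t₂) = rProd N (t₁ * t₃ / (root N * t₂)) := by
      rw [← E2, rProd_root_mul]
    rw [this, ← E3] at h₅
    apply mul_left_cancel₀ hr
    rw [h₅, wpow_sub, wpow_one]
    field_simp
  have key := h e₁ e₂ e₃ e₄ (f - 1) h₁ (by rw [rProd_root_mul]; exact h₂) h₃
    (by rw [E1, rProd_root_mul]; exact h₄) h₅'
  rw [fiveRight, fiveLeft, E1] at key
  rw [fiveRight, fiveLeft]
  have n2 := one_sub_ne_zero (pow_ne_one_of_add (N := N) d.s₂_ne d.eq₂)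
  have n4 := one_sub_ne_zero (pow_ne_one_of_add (N := N) d.s₄_ne (d.eq₄ hN))
  have n5 := one_sub_ne_zero (pow_ne_one_of_add (N := N) d.root_mul₂.s₅_ne d.root_mul₂.eq₅)
  have S := d.fiveSum_root_mul₂ hN
  have g2 := hFun_gPrincipal_root_mul hN t₂
  have g4 := hFun_gPrincipal_root_mul hN (t₂ / t₃)
  have g5 := hFun_gPrincipal_root_mul hN (t₁ * t₃ / (root N * t₂))
  rw [E2] at g5
  have s2 := d.s₂_ne
  have s4 := d.s₄_ne
  have s5 := d.root_mul₂.s₅_ne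
  have hQ : wpow N (fiveExponent N e₁ e₂ e₃ e₄ (f - 1)) =
      wpow N (fiveExponent N e₁ e₂ e₃ e₄ f) * (wpow N (f - 1) * wpow N e₂ / wpow N e₄ *
        wpow N (half N)) := by
    rw [← wpow_add, ← wpow_sub, ← wpow_add, ← wpow_add]
    congr 1
    unfold fiveExponent
    linear_combination (-(e₄ - e₃ - f) - 1) * two_mul_half hN
  rw [hQ] at key
  have w1 := wpow_ne_zero N e₂
  have w2 := wpow_ne_zero N (f - 1)
  have w3 := wpow_ne_zero N e₄
  have w4 := wpow_ne_zero N (half N)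
  generalize hFun N (gPrincipal N) (root N * t₂) = H2 at *
  generalize hFun N (gPrincipal N) (root N * (t₂ / t₃)) = H4 at *
  generalize hFun N (gPrincipal N) (t₁ * t₃ / (root N * t₂)) = H5 at *
  generalize hFun N (gPrincipal N) t₃ = G3 at *
  generalize hFun N (gPrincipal N) t₂ = G2 at *
  generalize hFun N (gPrincipal N) t₁ = G1 at *
  generalize hFun N (gPrincipal N) (t₁ * t₃ / t₂) = G5 at *
  generalize hFun N (gPrincipal N) (t₂ / t₃) = G4 at *
  generalize fiveSum N s₁ s₃ t₁ t₂ t₃ 0 0 = C at *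
  generalize fiveSum N s₁ s₃ t₁ (root N * t₂) t₃ 0 0 = C' at *
  generalize s₁ / (root N * t₂) = S5 at *
  generalize -(s₁ * s₃ / t₃) = S4 at *
  generalize t₁ * s₃ = S2 at *
  generalize t₁ * t₃ / (root N * t₂) = T5 at *
  generalize t₂ / t₃ = T4 at *
  generalize rProd N T5 = R5 at *
  generalize rProd N T4 = R4 at *
  generalize rProd N t₂ = R2 at *
  generalize wpow N (half N) = u at *
  generalize wpow N e₂ = w₂ at *
  generalize wpow N e₄ = w₄ at *
  generalize wpow N (f - 1) = w₅ at *
  generalize wpow N (fiveExponent N e₁ e₂ e₃ e₄ f) = q at *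
  have r2 : R2 ≠ 0 := fun h0 => s2 (by rw [h₂, h0, mul_zero])
  have r4 : R4 ≠ 0 := fun h0 => s4 (by rw [h₄, h0, mul_zero])
  have r5 : R5 ≠ 0 := fun h0 => s5 (by rw [h₅', h0, mul_zero])
  have g2' : H2 = u * (1 - t₂) * G2 / R2 := by rw [eq_div_iff r2, g2]
  have g4' : H4 = u * (1 - T4) * G4 / R4 := by rw [eq_div_iff r4, g4]
  have g5' : H5 = G5 * R5 / (u * (1 - T5)) := by
    rw [eq_div_iff (mul_ne_zero w4 n5), g5]; ring
  have S' : C' = (1 - T5) * S4 * (1 - t₂) * C / (S5 * (1 - T4) * S2) := by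
    rw [eq_div_iff (mul_ne_zero (mul_ne_zero s5 n4) s2), ← S]; ring
  rw [g2', g5', g4', S'] at key
  clear g2' g5' g4' S' S g2 g4 g5
  rw [h₂, h₄, h₅'] at key
  field_simp at key
  linear_combination key

end FiveData

/-! ### Cuts, jumps of the principal determinations, and continuity of the ratio. -/

open Filter Topology

theorem norm_wpow (k : ZMod N) : ‖wpow N k‖ = 1 :=
  Complex.norm_eq_one_of_pow_eq_one (wpow_pow_card k) (NeZero.ne N)

theorem conj_wpow (k : ZMod N) : (starRingEnd ℂ) (wpow N k) = wpow N (-k) := by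
  rw [wpow_neg, Complex.inv_eq_conj (norm_wpow k)]

theorem eq_of_ofReal_mul_wpow {a b : ℝ} (ha : 0 < a) (hb : 0 < b) {k l : ZMod N}
    (h : (a : ℂ) * wpow N k = b * wpow N l) : k = l := by
  have hab : a = b := by
    have := congrArg norm h
    simpa [norm_wpow, abs_of_pos ha, abs_of_pos hb] using this
  rw [hab] at h
  exact wpow_injective N (mul_left_cancel₀ (Complex.ofReal_ne_zero.mpr hb.ne') h)

theorem exp_pi_div (hN : Odd N) :
    Complex.exp (Real.pi * Complex.I / N) = -wpow N (half N) := by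
  obtain ⟨k, hk⟩ := hN
  have e2 : (N + 1) / 2 = k + 1 := by omega
  have hN0 : (N : ℂ) ≠ 0 := Nat.cast_ne_zero.mpr (NeZero.ne N)
  have hkc : (N : ℂ) = 2 * k + 1 := by rw [hk]; push_cast; ring
  rw [half, wpow_natCast, root, ← Complex.exp_nat_mul, e2]
  have : ((k + 1 : ℕ) : ℂ) * (2 * Real.pi * Complex.I / N) =
      Real.pi * Complex.I / N + Real.pi * Complex.I := by
    push_cast
    field_simp
    rw [hkc]
    ring
  rw [this, Complex.exp_add, Complex.exp_pi_mul_I]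
  ring

theorem mem_slitPlane_of_ne_ofReal {z : ℂ} (h : ∀ p : ℝ, p ≤ 0 → z ≠ p) :
    z ∈ Complex.slitPlane := by
  by_contra hz
  rw [Complex.mem_slitPlane_iff, not_or, not_lt, not_not] at hz
  exact h z.re hz.1 (Complex.ext (by simp) (by simp [hz.2]))

theorem offCuts_iff {t : ℂ} : OffCuts N t ↔ ∀ p : ℝ, 1 ≤ p → t ^ N ≠ p := by
  constructor
  · intro h p hp hz
    have := h
    rw [OffCuts, hz, ← Complex.ofReal_one, ← Complex.ofReal_sub,
      Complex.ofReal_mem_slitPlane] at this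
    linarith
  · intro h
    refine mem_slitPlane_of_ne_ofReal fun p hp hz => h (1 - p) (by linarith) ?_
    push_cast
    linear_combination -hz

theorem OffCuts.one_sub_mul_wpow_mem {t : ℂ} (h : OffCuts N t) (k : ZMod N) :
    1 - t * wpow N k ∈ Complex.slitPlane := by
  refine mem_slitPlane_of_ne_ofReal fun p hp hz => ?_
  refine offCuts_iff.mp h ((1 - p) ^ N) (one_le_pow₀ (by linarith)) ?_
  have : t * wpow N k = ((1 - p : ℝ) : ℂ) := by push_cast; linear_combination -hz
  rw [Complex.ofReal_pow, ← this, mul_pow, wpow_pow_card, mul_one]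

theorem exists_mul_wpow_eq_of_not_offCuts {t : ℂ} (h : ¬ OffCuts N t) (h1 : t ^ N ≠ 1) :
    ∃ j : ZMod N, ∃ p : ℝ, 1 < p ∧ t * wpow N j = p := by
  rw [offCuts_iff] at h
  push Not at h
  obtain ⟨p, hp, ht⟩ := h
  have hp1 : 1 < p := lt_of_le_of_ne hp fun h0 => h1 (by rw [ht, ← h0]; simp)
  have hp0 : 0 < p := by linarith
  set q : ℝ := p ^ ((N : ℝ)⁻¹) with hq
  have hqN : q ^ N = p := Real.rpow_inv_natCast_pow hp0.le (NeZero.ne N)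
  have hq1 : 1 < q := Real.one_lt_rpow hp1 (by
    have := NeZero.pos N
    positivity)
  have hq0 : (q : ℂ) ≠ 0 := Complex.ofReal_ne_zero.mpr (by linarith)
  obtain ⟨k, hk⟩ := exists_wpow_eq (N := N) (z := t / q) (by
    rw [div_pow, ht, ← Complex.ofReal_pow, hqN, div_self]
    exact Complex.ofReal_ne_zero.mpr hp0.ne')
  refine ⟨-k, q, hq1, ?_⟩
  rw [wpow_neg, hk]
  have : t ≠ 0 := by
    rintro rfl
    exact wpow_ne_zero N k (by rw [hk, zero_div])
  field_simp

/-- Two different rotations of `t` by powers of `ω` cannot both be positive, so on a cut exactly one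
root factor is at its branch line. -/
theorem one_sub_mul_wpow_mem_of_ne {t : ℂ} {j : ZMod N} {p : ℝ} (hp : 0 < p)
    (h : t * wpow N j = p) {k : ZMod N} (hk : k ≠ j) :
    1 - t * wpow N k ∈ Complex.slitPlane := by
  refine mem_slitPlane_of_ne_ofReal fun q hq hz => hk ?_
  have h1 : t * wpow N k = ((1 - q : ℝ) : ℂ) := by push_cast; linear_combination -hz
  have hw := wpow_ne_zero N j
  refine (eq_of_ofReal_mul_wpow (a := 1 - q) (b := p) (by linarith) hp ?_).symm
  rw [← h, ← h1]
  ring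

theorem continuousAt_rootFactor {k : ZMod N} {t : ℂ}
    (h : 1 - t * wpow N k ∈ Complex.slitPlane) : ContinuousAt (rootFactor N k) t :=
  ContinuousAt.cpow (by fun_prop) continuousAt_const h

theorem OffCuts.continuousAt_rProd {t : ℂ} (h : OffCuts N t) : ContinuousAt (rProd N) t := by
  unfold rProd
  exact tendsto_finsetProd _ fun k _ => continuousAt_rootFactor (h.one_sub_mul_wpow_mem k)

theorem continuousAt_gPrincipal {t : ℂ}
    (h : ∀ k : ZMod N, k ≠ 0 → 1 - t * wpow N k ∈ Complex.slitPlane) :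
    ContinuousAt (gPrincipal N) t := by
  have e : gPrincipal N = fun t => ∏ k : ZMod N, rootFactor N k t ^ k.val :=
    funext fun t => gPrincipal_eq N t
  rw [e]
  refine tendsto_finsetProd _ fun k _ => ?_
  rcases eq_or_ne k 0 with rfl | hk
  · simp
  · exact (continuousAt_rootFactor (h k hk)).pow _

theorem continuousAt_hFun_gPrincipal {t : ℂ} (ht : t ≠ 0)
    (h : ∀ k : ZMod N, k ≠ 0 → 1 - t * wpow N k ∈ Complex.slitPlane) :
    ContinuousAt (hFun N (gPrincipal N)) t := by
  unfold hFun
  exact ((continuousAt_id.pow ((N - 1) / 2)).inv₀ (pow_ne_zero _ ht)).mul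
    ((continuousAt_gPrincipal h).div_const _)

theorem OffCuts.continuousAt_hFun {t : ℂ} (h : OffCuts N t) (ht : t ≠ 0) :
    ContinuousAt (hFun N (gPrincipal N)) t :=
  continuousAt_hFun_gPrincipal ht fun k _ => h.one_sub_mul_wpow_mem k

theorem OffCuts.continuousAt_rPrincipal {t : ℂ} (h : OffCuts N t) :
    ContinuousAt (rPrincipal N) t := by
  unfold rPrincipal
  exact ContinuousAt.cpow (by fun_prop) continuousAt_const h

theorem OffCuts.pow_ne_one {t : ℂ} (h : OffCuts N t) : t ^ N ≠ 1 := by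
  have := offCuts_iff.mp h 1 le_rfl
  simpa using this

theorem rPrincipal_pow (t : ℂ) : rPrincipal N t ^ N = 1 - t ^ N := by
  rw [rPrincipal, one_div]
  exact Complex.cpow_nat_inv_pow _ (NeZero.ne N)

theorem OffCuts.ofReal_mul {t : ℂ} (h : OffCuts N t) {x : ℝ} (h0 : 0 ≤ x) (h1 : x ≤ 1) :
    OffCuts N (x * t) := by
  rw [offCuts_iff] at h ⊢
  intro p hp hz
  have hN := NeZero.ne N
  have hx : 0 < x := lt_of_le_of_ne h0 fun h => by
    rw [← h] at hz
    simp [hN] at hz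
    rw [eq_comm, Complex.ofReal_eq_zero] at hz
    linarith
  have hxN : 0 < x ^ N := pow_pos hx N
  refine h (p / x ^ N) ?_ ?_
  · rw [le_div_iff₀ hxN]
    have := pow_le_one₀ h0 h1 (n := N)
    linarith
  · have : ((x ^ N : ℝ) : ℂ) ≠ 0 := Complex.ofReal_ne_zero.mpr hxN.ne'
    rw [Complex.ofReal_div, eq_div_iff this, ← hz]
    push_cast
    ring

/-- The values lie in a finite, hence discrete, set and the domain is connected. -/
theorem eq_of_continuousOn_of_pow_eq_one {s : Set ℝ} (hs : IsPreconnected s) {f : ℝ → ℂ}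
    (hc : ContinuousOn f s) (hf : ∀ x ∈ s, f x ^ N = 1) {x y : ℝ} (hx : x ∈ s) (hy : y ∈ s) :
    f x = f y := by
  refine hs.constant_of_mapsTo (T := Set.range (wpow N)) (Set.finite_range _).isDiscrete hc
    (fun z hz => ?_) hx hy
  obtain ⟨k, hk⟩ := exists_wpow_eq (N := N) (hf z hz)
  exact ⟨k, hk⟩

/-- The segment from `t` to `0` stays off the cuts; along it the quotient is a continuous root of
unity, equal to `1` at `0`. -/
theorem OffCuts.rProd_eq_rPrincipal {t : ℂ} (h : OffCuts N t) : rProd N t = rPrincipal N t := by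
  have hne : ∀ x ∈ Set.Icc (0 : ℝ) 1, rPrincipal N (x * t) ≠ 0 := by
    intro x hx h0
    have h1 := rPrincipal_pow (N := N) (x * t)
    rw [h0, zero_pow (NeZero.ne N)] at h1
    exact (h.ofReal_mul hx.1 hx.2).pow_ne_one (by linear_combination h1)
  have hc : ContinuousOn (fun x : ℝ => rProd N (x * t) / rPrincipal N (x * t)) (Set.Icc 0 1) := by
    intro x hx
    have hx' := h.ofReal_mul hx.1 hx.2
    have hm : ContinuousAt (fun x : ℝ => (x : ℂ) * t) x := by fun_prop
    exact ((ContinuousAt.comp (f := fun x : ℝ => (x : ℂ) * t) hx'.continuousAt_rProd hm).div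
      (ContinuousAt.comp (f := fun x : ℝ => (x : ℂ) * t) hx'.continuousAt_rPrincipal hm)
      (hne x hx)).continuousWithinAt
  have key := eq_of_continuousOn_of_pow_eq_one (N := N) isPreconnected_Icc hc
    (fun x hx => by
      have h2 : rPrincipal N (x * t) ^ N ≠ 0 := pow_ne_zero _ (hne x hx)
      rw [rPrincipal_pow] at h2
      rw [div_pow, rProd_pow, rPrincipal_pow, div_self h2])
    (show (1 : ℝ) ∈ Set.Icc 0 1 by simp) (show (0 : ℝ) ∈ Set.Icc 0 1 by simp)
  have h1 := hne 1 (by simp)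
  simp only [Complex.ofReal_one, one_mul, Complex.ofReal_zero, zero_mul] at key h1
  have e0 : rProd N 0 = 1 := by simp [rProd, rootFactor]
  have e1 : rPrincipal N 0 = 1 := by simp [rPrincipal, NeZero.ne N]
  rw [e0, e1, div_one, div_eq_one_iff_eq h1] at key
  exact key

/-- `(-z)^{1/N}` is continuous near the negative axis, so this displays the jump of the principal
root: a factor `ω^{-1}` from the closed upper side to the lower side. -/
theorem cpow_eq_neg_cpow_mul {z : ℂ} (hz : z.re < 0) :
    (0 ≤ z.im → z ^ ((N : ℂ)⁻¹) = (-z) ^ ((N : ℂ)⁻¹) * Complex.exp (Real.pi * Complex.I / N)) ∧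
    (z.im < 0 → z ^ ((N : ℂ)⁻¹) =
      (-z) ^ ((N : ℂ)⁻¹) * Complex.exp (Real.pi * Complex.I / N) * wpow N (-1)) := by
  have hz0 : z ≠ 0 := by rintro rfl; simp at hz
  have hw : wpow N (-1) = Complex.exp (-(2 * Real.pi * Complex.I / N)) := by
    rw [wpow_neg, wpow_one, root, Complex.exp_neg]
  constructor
  · intro h
    have ha : Complex.arg (-z) = Complex.arg z - Real.pi := by
      rw [Complex.arg_neg_eq_arg_sub_pi_iff]
      rcases h.lt_or_eq with h | h
      · exact Or.inl h
      · exact Or.inr ⟨h.symm, hz⟩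
    rw [Complex.cpow_def_of_ne_zero hz0, Complex.cpow_def_of_ne_zero (neg_ne_zero.mpr hz0),
      ← Complex.exp_add, Complex.log, Complex.log, ha, norm_neg]
    congr 1
    push_cast
    ring
  · intro h
    have ha : Complex.arg (-z) = Complex.arg z + Real.pi := by
      rw [Complex.arg_neg_eq_arg_add_pi_iff]
      exact Or.inl h
    rw [hw, Complex.cpow_def_of_ne_zero hz0, Complex.cpow_def_of_ne_zero (neg_ne_zero.mpr hz0),
      ← Complex.exp_add, ← Complex.exp_add, Complex.log, Complex.log, ha, norm_neg]
    congr 1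
    push_cast
    ring

theorem rProd_mul_wpow (t : ℂ) (j : ZMod N) : rProd N (t * wpow N j) = rProd N t := by
  unfold rProd
  refine Fintype.prod_equiv (Equiv.addRight j) _ _ fun k => ?_
  rw [rootFactor, rootFactor, Equiv.coe_addRight, wpow_add]
  congr 2
  ring

/-- For `p > 1` the factors `1 - pω^k` and `1 - pω^{-k}` are conjugate, so the arguments cancel
except for the negative factor `1 - p`, whose root contributes `e^{iπ/N} = -ω^{1/2}`. -/
theorem rProd_eq_of_mul_wpow_eq (hN : Odd N) {t : ℂ} {j : ZMod N} {p : ℝ} (hp : 1 < p)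
    (h : t * wpow N j = p) : ∃ c : ℝ, 0 < c ∧ rProd N t = -(c * wpow N (half N)) := by
  rw [← rProd_mul_wpow t j, h]
  have hw : (p : ℂ) * wpow N 0 = p := by rw [wpow_zero, mul_one]
  have hmem : ∀ k : ZMod N, k ≠ 0 → 1 - (p : ℂ) * wpow N k ∈ Complex.slitPlane := fun k hk =>
    one_sub_mul_wpow_mem_of_ne (by linarith) hw hk
  set A : ZMod N → ℝ := fun k => if k = 0 then 0 else Complex.arg (1 - (p : ℂ) * wpow N k) with hA
  have hAneg : ∀ k, A (-k) = -A k := by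
    intro k
    by_cases hk : k = 0
    · simp [hA, hk]
    · simp only [hA, neg_eq_zero, hk, if_false]
      have : 1 - (p : ℂ) * wpow N (-k) = (starRingEnd ℂ) (1 - (p : ℂ) * wpow N k) := by
        simp [conj_wpow]
      rw [this, Complex.arg_conj, if_neg]
      exact (Complex.mem_slitPlane_iff_arg.mp (hmem k hk)).1
  have hsum : ∑ k, A k = 0 := by
    have h1 : ∑ k, A k = ∑ k, A (-k) := (Fintype.sum_equiv (Equiv.neg _) _ _ fun k => rfl).symm
    simp only [hAneg, Finset.sum_neg_distrib] at h1
    linarith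
  set L : ZMod N → ℝ := fun k => Real.log ‖1 - (p : ℂ) * wpow N k‖ with hL
  have hterm : ∀ k, rootFactor N k p =
      Complex.exp (((L k : ℂ) + A k * Complex.I) * (N : ℂ)⁻¹) *
        (if k = 0 then Complex.exp (Real.pi * Complex.I / N) else 1) := by
    intro k
    have hne : 1 - (p : ℂ) * wpow N k ≠ 0 := by
      by_cases hk : k = 0
      · rw [hk, hw, ← Complex.ofReal_one, ← Complex.ofReal_sub]
        exact Complex.ofReal_ne_zero.mpr (by linarith)
      · exact Complex.slitPlane_ne_zero (hmem k hk)
    rw [rootFactor, Complex.cpow_def_of_ne_zero hne, Complex.log]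
    by_cases hk : k = 0
    · have : Complex.arg (1 - (p : ℂ) * wpow N k) = Real.pi := by
        rw [hk, hw, ← Complex.ofReal_one, ← Complex.ofReal_sub]
        exact Complex.arg_ofReal_of_neg (by linarith)
      rw [this, if_pos hk, ← Complex.exp_add]
      congr 1
      simp [hA, hk, hL]
      ring
    · rw [if_neg hk, mul_one]
      simp [hA, hk, hL]
  rw [rProd, Finset.prod_congr rfl fun k _ => hterm k, Finset.prod_mul_distrib,
    ← Complex.exp_sum, ← Finset.sum_mul, Finset.sum_add_distrib, ← Finset.sum_mul,
    ← Complex.ofReal_sum, ← Complex.ofReal_sum, hsum, Finset.prod_ite_eq' Finset.univ 0,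
    if_pos (Finset.mem_univ _), exp_pi_div hN]
  refine ⟨Real.exp ((∑ k, L k) * (N : ℝ)⁻¹), Real.exp_pos _, ?_⟩
  push_cast
  simp

/-- For a point `(t, s)` of the Fermat curve, the exponent `e` with `s = ω^e r(t)`, where `r` is the
determination `rProd` of `(1 - t^N)^{1/N}`. -/
noncomputable def phase (N : ℕ) [NeZero N] (t s : ℂ) : ZMod N :=
  open Classical in if h : ∃ k, s = wpow N k * rProd N t then h.choose else 0

theorem eq_wpow_phase_mul {t s : ℂ} (hs : s ≠ 0) (h : t ^ N + s ^ N = 1) :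
    s = wpow N (phase N t s) * rProd N t := by
  have hr := rProd_ne_zero (pow_ne_one_of_add hs h)
  obtain ⟨k, hk⟩ := exists_wpow_eq (N := N) (z := s / rProd N t) (by
    rw [div_pow, rProd_pow, ← eq_sub_of_add_eq' h, div_self (pow_ne_zero _ hs)])
  have hex : ∃ k, s = wpow N k * rProd N t := ⟨k, by rw [hk, div_mul_cancel₀ _ hr]⟩
  rw [phase, dif_pos hex]
  exact hex.choose_spec

theorem phase_eq {t s : ℂ} (hs : s ≠ 0) {k : ZMod N} (h : s = wpow N k * rProd N t) :
    phase N t s = k := by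
  have hr : rProd N t ≠ 0 := fun h0 => hs (by rw [h, h0, mul_zero])
  have hex : ∃ k, s = wpow N k * rProd N t := ⟨k, h⟩
  rw [phase, dif_pos hex]
  exact wpow_injective N (mul_right_cancel₀ hr (hex.choose_spec.symm.trans h))

theorem wpow_phase {t s : ℂ} (hs : s ≠ 0) (h : t ^ N + s ^ N = 1) :
    wpow N (phase N t s) = s / rProd N t := by
  rw [eq_div_iff (rProd_ne_zero (pow_ne_one_of_add hs h)), ← eq_wpow_phase_mul hs h]

theorem eventually_eq_of_tendsto_wpow {X : Type*} {l : Filter X} {u : X → ℂ} {k₀ : ZMod N}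
    (h : Tendsto u l (𝓝 (wpow N k₀))) : ∀ᶠ x in l, ∀ k, u x = wpow N k → k = k₀ := by
  have hopen : IsOpen (wpow N '' {k | k ≠ k₀})ᶜ :=
    (Set.toFinite (wpow N '' {k | k ≠ k₀})).isClosed.isOpen_compl
  have hmem : wpow N k₀ ∈ (wpow N '' {k | k ≠ k₀})ᶜ := by
    rintro ⟨k, hk, he⟩
    exact hk (wpow_injective N he)
  filter_upwards [h.eventually (hopen.mem_nhds hmem)] with x hx k hk
  by_contra hne
  exact hx ⟨k, hne, hk.symm⟩

section Limits

variable {X : Type*} {l : Filter X} {t s : X → ℂ} {t₀ s₀ : ℂ}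

theorem OffCuts.eventually_phase_eq (ho : OffCuts N t₀) (ht : Tendsto t l (𝓝 t₀))
    (hs : Tendsto s l (𝓝 s₀)) (hs₀ : s₀ ≠ 0) (h₀ : t₀ ^ N + s₀ ^ N = 1)
    (hev : ∀ᶠ x in l, s x ≠ 0 ∧ t x ^ N + s x ^ N = 1) :
    ∀ᶠ x in l, phase N (t x) (s x) = phase N t₀ s₀ := by
  have hT : Tendsto (fun x => s x / rProd N (t x)) l (𝓝 (wpow N (phase N t₀ s₀))) := by
    rw [wpow_phase hs₀ h₀]
    exact hs.div (ho.continuousAt_rProd.tendsto.comp ht)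
      (rProd_ne_zero (pow_ne_one_of_add hs₀ h₀))
  filter_upwards [eventually_eq_of_tendsto_wpow hT, hev] with x hx hx'
  exact hx _ (wpow_phase hx'.1 hx'.2).symm

/-- Near the cut with index `j` only root factor `j` is discontinuous. It enters `rProd` once, so
its jump changes the phase by one, and it enters `g` with exponent `j`; hence `ω^{j·phase} h` stays
continuous. -/
theorem tendsto_wpow_mul_hFun_of_mul_wpow_eq {j : ZMod N} {p : ℝ} (hp : 1 < p)
    (hw : t₀ * wpow N j = p) (ht : Tendsto t l (𝓝 t₀))
    (hs : Tendsto s l (𝓝 s₀)) (hs₀ : s₀ ≠ 0) (h₀ : t₀ ^ N + s₀ ^ N = 1)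
    (hev : ∀ᶠ x in l, s x ≠ 0 ∧ t x ^ N + s x ^ N = 1) :
    (∀ᶠ x in l, phase N (t x) (s x) = phase N t₀ s₀ ∨
      phase N (t x) (s x) = phase N t₀ s₀ + 1) ∧
    Tendsto (fun x => wpow N (j * phase N (t x) (s x)) * hFun N (gPrincipal N) (t x)) l
      (𝓝 (wpow N (j * phase N t₀ s₀) * hFun N (gPrincipal N) t₀)) := by
  have ht₀ : t₀ ≠ 0 := by
    rintro rfl
    rw [zero_mul, eq_comm, Complex.ofReal_eq_zero] at hw
    linarith
  have hne1 := pow_ne_one_of_add hs₀ h₀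
  set A : ℂ → ℂ := fun t => ∏ k ∈ Finset.univ.erase j, rootFactor N k t with hA
  set B : ℂ → ℂ := fun t => ∏ k ∈ Finset.univ.erase j, rootFactor N k t ^ k.val with hB
  have hrA : ∀ t, rProd N t = rootFactor N j t * A t := fun t =>
    (Finset.mul_prod_erase _ _ (Finset.mem_univ j)).symm
  have hgB : ∀ t, gPrincipal N t = rootFactor N j t ^ j.val * B t := fun t => by
    rw [gPrincipal_eq]
    exact (Finset.mul_prod_erase _ (fun k => rootFactor N k t ^ k.val) (Finset.mem_univ j)).symm
  have hmem : ∀ k ∈ Finset.univ.erase j, 1 - t₀ * wpow N k ∈ Complex.slitPlane := fun k hk =>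
    one_sub_mul_wpow_mem_of_ne (by linarith) hw (Finset.ne_of_mem_erase hk)
  have hAt : Tendsto (fun x => A (t x)) l (𝓝 (A t₀)) := tendsto_finsetProd _ fun k hk =>
    (continuousAt_rootFactor (hmem k hk)).tendsto.comp ht
  have hBt : Tendsto (fun x => B (t x)) l (𝓝 (B t₀)) := tendsto_finsetProd _ fun k hk =>
    ((continuousAt_rootFactor (hmem k hk)).tendsto.comp ht).pow _
  have hA₀ : A t₀ ≠ 0 := fun h => rProd_ne_zero hne1 (by rw [hrA, h, mul_zero])
  have hj : ((j.val : ℕ) : ZMod N) = j := ZMod.natCast_zmod_val j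
  constructor
  -- `M` is the branch of root factor `j` that is continuous across the cut and agrees with the
  -- principal one on the upper side.
  · set M : ℂ → ℂ := fun t => (-(1 - t * wpow N j)) ^ ((N : ℂ)⁻¹) *
      Complex.exp (Real.pi * Complex.I / N) with hM
    have hz₀ : 1 - t₀ * wpow N j = ((1 - p : ℝ) : ℂ) := by rw [hw]; push_cast; ring
    have hre₀ : (1 - t₀ * wpow N j).re < 0 := by rw [hz₀, Complex.ofReal_re]; linarith
    have hM₀ : rootFactor N j t₀ = M t₀ :=
      (cpow_eq_neg_cpow_mul hre₀).1 (by rw [hz₀, Complex.ofReal_im])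
    have hMt : Tendsto (fun x => M (t x)) l (𝓝 (M t₀)) := by
      refine Tendsto.mul_const _ ?_
      refine Tendsto.comp (g := fun t => (-(1 - t * wpow N j)) ^ ((N : ℂ)⁻¹)) (y := 𝓝 t₀) ?_ ht
      refine ContinuousAt.cpow (by fun_prop) continuousAt_const ?_
      exact Or.inl (by rw [Complex.neg_re]; linarith)
    have hM₀' : M t₀ ≠ 0 := by
      rw [← hM₀]
      exact rootFactor_ne_zero hne1 j
    have hu : Tendsto (fun x => s x / (M (t x) * A (t x))) l (𝓝 (wpow N (phase N t₀ s₀))) := by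
      rw [wpow_phase hs₀ h₀, hrA, hM₀]
      exact hs.div (hMt.mul hAt) (mul_ne_zero hM₀' hA₀)
    have hre : ∀ᶠ x in l, (1 - t x * wpow N j).re < 0 := by
      have hc : ContinuousAt (fun t => (1 - t * wpow N j).re) t₀ := by fun_prop
      exact (hc.tendsto.comp ht).eventually (gt_mem_nhds hre₀)
    filter_upwards [eventually_eq_of_tendsto_wpow hu, hev, hre] with x hx hx' hxre
    have hph := wpow_phase hx'.1 hx'.2
    rcases le_or_gt 0 (1 - t x * wpow N j).im with him | him
    · left
      apply hx
      rw [hph, hrA, rootFactor, (cpow_eq_neg_cpow_mul hxre).1 him]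
    · right
      have hc := (cpow_eq_neg_cpow_mul (N := N) hxre).2 him
      have := hx (phase N (t x) (s x) - 1) (by
        rw [wpow_sub, hph, hrA, show rootFactor N j (t x) = M (t x) * wpow N (-1) from hc, wpow_neg]
        have := wpow_ne_zero N 1
        field_simp)
      rw [← this, sub_add_cancel]
  -- The quotient `s/A` is `ω^{phase}` times root factor `j`, so the combination can be rewritten
  -- without the discontinuous factor.
  · have hform : ∀ t s : ℂ, s ≠ 0 → t ^ N + s ^ N = 1 → A t ≠ 0 →
        wpow N (j * phase N t s) * hFun N (gPrincipal N) t =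
          (t ^ ((N - 1) / 2))⁻¹ * ((s / A t) ^ j.val * B t / gPrincipal N 1) := by
      intro t s hs h hA0
      have h1 : wpow N (j * phase N t s) = wpow N (phase N t s) ^ j.val := by
        rw [wpow_pow, hj]
      have h2 : s / A t = wpow N (phase N t s) * rootFactor N j t := by
        rw [div_eq_iff hA0, mul_assoc, ← hrA, ← eq_wpow_phase_mul hs h]
      rw [hFun, hgB, h1, h2, mul_pow]
      ring
    rw [hform t₀ s₀ hs₀ h₀ hA₀]
    have hlim : Tendsto (fun x => (t x ^ ((N - 1) / 2))⁻¹ *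
        ((s x / A (t x)) ^ j.val * B (t x) / gPrincipal N 1)) l
        (𝓝 ((t₀ ^ ((N - 1) / 2))⁻¹ * ((s₀ / A t₀) ^ j.val * B t₀ / gPrincipal N 1))) :=
      ((ht.pow _).inv₀ (pow_ne_zero _ ht₀)).mul
        ((((hs.div hAt hA₀).pow _).mul hBt).div_const _)
    refine hlim.congr' ?_
    filter_upwards [hev, hAt.eventually_ne hA₀] with x hx hx'
    exact (hform _ _ hx.1 hx.2 hx').symm

/-- The exponent `Q` need not be linear in the phase: near the limit the phase takes at most two
consecutive values, so only one increment of `Q` matters. -/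
theorem tendsto_wpow_mul_hFun (Q : ZMod N → ZMod N) (ht₀ : t₀ ≠ 0)
    (ht : Tendsto t l (𝓝 t₀)) (hs : Tendsto s l (𝓝 s₀)) (hs₀ : s₀ ≠ 0)
    (h₀ : t₀ ^ N + s₀ ^ N = 1) (hev : ∀ᶠ x in l, s x ≠ 0 ∧ t x ^ N + s x ^ N = 1)
    (hQ : ∀ (j : ZMod N) (p : ℝ), 1 < p → t₀ * wpow N j = p →
      Q (phase N t₀ s₀ + 1) - Q (phase N t₀ s₀) = j) :
    Tendsto (fun x => wpow N (Q (phase N (t x) (s x))) * hFun N (gPrincipal N) (t x)) l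
      (𝓝 (wpow N (Q (phase N t₀ s₀)) * hFun N (gPrincipal N) t₀)) := by
  by_cases ho : OffCuts N t₀
  · refine Tendsto.congr' (f₁ := fun x => wpow N (Q (phase N t₀ s₀)) *
      hFun N (gPrincipal N) (t x)) ?_ (((ho.continuousAt_hFun ht₀).tendsto.comp ht).const_mul _)
    filter_upwards [ho.eventually_phase_eq ht hs hs₀ h₀ hev] with x hx
    rw [hx]
  · obtain ⟨j, p, hp, hw⟩ := exists_mul_wpow_eq_of_not_offCuts ho (pow_ne_one_of_add hs₀ h₀)
    obtain ⟨h1, h2⟩ := tendsto_wpow_mul_hFun_of_mul_wpow_eq hp hw ht hs hs₀ h₀ hev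
    have hj := hQ j p hp hw
    set a := phase N t₀ s₀ with ha
    have := h2.const_mul (wpow N (Q a - j * a))
    rw [← mul_assoc, ← wpow_add, sub_add_cancel] at this
    refine this.congr' ?_
    filter_upwards [h1] with x hx
    rw [← mul_assoc, ← wpow_add]
    congr 2
    rcases hx with hx | hx
    · rw [hx]; ring
    · rw [hx]; linear_combination -hj

end Limits

theorem rPrincipal_eq_cpow {t s : ℂ} (h : t ^ N + s ^ N = 1) :
    rPrincipal N t = (s ^ N) ^ ((N : ℂ)⁻¹) := by
  rw [rPrincipal, ← eq_sub_of_add_eq' h, one_div]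

theorem exists_ofReal_mul_cpow (c : ℝ) {q : ℝ} (hq : 0 < q) {z : ℂ} (hz : z ≠ 0) :
    ∃ a : ℝ, 0 < a ∧ ((q : ℂ) * z) ^ (c : ℂ) = a * z ^ (c : ℂ) := by
  refine ⟨Real.exp (Real.log q * c), Real.exp_pos _, ?_⟩
  rw [Complex.cpow_def_of_ne_zero (mul_ne_zero (Complex.ofReal_ne_zero.mpr hq.ne') hz),
    Complex.cpow_def_of_ne_zero hz, Complex.log_ofReal_mul hq hz, Complex.ofReal_exp,
    ← Complex.exp_add]
  congr 1
  push_cast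
  ring

theorem OffCuts.pow_mem_slitPlane {t s : ℂ} (h : OffCuts N t) (h1 : t ^ N + s ^ N = 1) :
    s ^ N ∈ Complex.slitPlane := by
  rw [eq_sub_of_add_eq' h1]
  exact h

theorem fiveExponent_add_one (hN : Odd N) (e₁ e₂ e₃ e₄ f : ZMod N) :
    fiveExponent N e₁ e₂ e₃ (e₄ + 1) f - fiveExponent N e₁ e₂ e₃ e₄ f =
      -(e₄ - e₃ - f + half N) := by
  unfold fiveExponent
  linear_combination (-(e₄ - e₃ - f)) * two_mul_half hN

theorem fiveExponent_add_one_last (hN : Odd N) (e₁ e₂ e₃ e₄ f : ZMod N) :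
    fiveExponent N e₁ e₂ e₃ e₄ (f + 1) - fiveExponent N e₁ e₂ e₃ e₄ f =
      -(e₂ + f - e₄ + half N) := by
  unfold fiveExponent
  linear_combination (e₄ - e₃ - f) * two_mul_half hN

namespace FiveData

variable {s₁ s₃ t₁ t₂ t₃ : ℂ}

/-- On a cut of `t₂/t₃` the product `s₃^N (s₁/t₂)^N` is a positive real, so the principal roots of
its two factors have opposite arguments. Comparing phases then gives the increment of `fiveExponent`
in `e₄` needed for continuity. -/
theorem add_eq_zero_of_mul_wpow_eq₄ (hN : Odd N) (d : FiveData N s₁ s₃ t₁ t₂ t₃)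
    (o₃ : OffCuts N t₃) (o₅ : OffCuts N (t₁ * t₃ / t₂)) {e₃ e₄ f j : ZMod N} {p : ℝ} (hp : 1 < p)
    (hw : t₂ / t₃ * wpow N j = p) (h₃ : s₃ = wpow N e₃ * rProd N t₃)
    (h₄ : -(s₁ * s₃ / t₃) = wpow N e₄ * rProd N (t₂ / t₃))
    (h₅ : s₁ / t₂ = wpow N f * rProd N (t₁ * t₃ / t₂)) :
    e₄ - e₃ - f + half N + j = 0 := by
  have hpN : 1 < p ^ N := one_lt_pow₀ hp (NeZero.ne N)
  have n2 := d.t₂_ne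
  have n3 := d.t₃_ne
  have ns3 := d.s₃_ne
  have ns1 := d.s₁_ne
  obtain ⟨c, hc, hr4⟩ := rProd_eq_of_mul_wpow_eq hN hp hw
  have hT4 : (t₂ / t₃) ^ N = (p : ℂ) ^ N := by rw [← hw, mul_pow, wpow_pow_card, mul_one]
  have hS4 : (-(s₁ * s₃ / t₃)) ^ N = 1 - (p : ℂ) ^ N := by
    rw [← hT4]; linear_combination d.eq₄ hN
  set q : ℝ := (p ^ N - 1) / p ^ N with hq
  have hq0 : 0 < q := div_pos (by linarith) (by linarith)
  have hp0 : (p : ℂ) ^ N ≠ 0 := by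
    rw [← Complex.ofReal_pow]
    exact Complex.ofReal_ne_zero.mpr (by linarith)
  have hS5 : (s₁ / t₂) ^ N = (q : ℂ) * (s₃ ^ N)⁻¹ := by
    have e : (q : ℂ) = -(-(s₁ * s₃ / t₃)) ^ N / (t₂ / t₃) ^ N := by
      rw [hS4, hT4, hq]; push_cast; ring
    rw [e, hN.neg_pow, neg_neg, ← div_pow, ← inv_pow, ← mul_pow]
    congr 1
    field_simp
  have hm := o₃.pow_mem_slitPlane d.eq₃
  obtain ⟨a, ha, hcp⟩ := exists_ofReal_mul_cpow (N : ℝ)⁻¹ hq0 (inv_ne_zero (pow_ne_zero N ns3))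
  have hr : rProd N (t₁ * t₃ / t₂) * rProd N t₃ = a := by
    rw [o₃.rProd_eq_rPrincipal, o₅.rProd_eq_rPrincipal, rPrincipal_eq_cpow d.eq₃,
      rPrincipal_eq_cpow d.eq₅, hS5]
    push_cast at hcp
    rw [hcp, Complex.inv_cpow _ _ (Complex.mem_slitPlane_iff_arg.mp hm).1, mul_assoc,
      inv_mul_cancel₀, mul_one]
    exact (Complex.cpow_ne_zero_iff_of_exponent_ne_zero (inv_ne_zero
      (Nat.cast_ne_zero.mpr (NeZero.ne N)))).mpr (pow_ne_zero N ns3)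
  have key : t₂ / t₃ * (s₃ * (s₁ / t₂)) = -(-(s₁ * s₃ / t₃)) := by field_simp
  rw [h₄, h₅, hr4] at key
  rw [h₃] at key
  have key2 : (p * a : ℝ) * wpow N 0 = (c : ℂ) * wpow N (e₄ - e₃ - f + half N + j) := by
    rw [wpow_add, wpow_add, wpow_sub, wpow_sub, wpow_zero]
    have w3 := wpow_ne_zero N e₃
    have w5 := wpow_ne_zero N f
    push_cast
    rw [← hw, ← hr]
    generalize rProd N (t₁ * t₃ / t₂) = R at *
    generalize t₂ / t₃ = T at *
    field_simp
    linear_combination (wpow N j) * key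
  exact (eq_of_ofReal_mul_wpow (mul_pos (by linarith) ha) hc key2).symm

/-- On a cut of `t₁t₃/t₂` the powers `(t₁s₃)^N` and `(-(s₁s₃/t₃))^N` differ by a positive factor, so
their principal roots have equal arguments. The result matches the increment of `fiveExponent` in
`f`. -/
theorem add_eq_zero_of_mul_wpow_eq₅ (hN : Odd N) (d : FiveData N s₁ s₃ t₁ t₂ t₃)
    (o₂ : OffCuts N t₂) (o₄ : OffCuts N (t₂ / t₃)) {e₂ e₄ f j : ZMod N} {p : ℝ} (hp : 1 < p)
    (hw : t₁ * t₃ / t₂ * wpow N j = p) (h₂ : t₁ * s₃ = wpow N e₂ * rProd N t₂)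
    (h₄ : -(s₁ * s₃ / t₃) = wpow N e₄ * rProd N (t₂ / t₃))
    (h₅ : s₁ / t₂ = wpow N f * rProd N (t₁ * t₃ / t₂)) :
    e₂ + f - e₄ + half N + j = 0 := by
  have hpN : 1 < p ^ N := one_lt_pow₀ hp (NeZero.ne N)
  have n1 := d.t₁_ne
  have n2 := d.t₂_ne
  have n3 := d.t₃_ne
  have ns3 := d.s₃_ne
  have ns1 := d.s₁_ne
  obtain ⟨c, hc, hr5⟩ := rProd_eq_of_mul_wpow_eq hN hp hw
  have hT5 : (t₁ * t₃ / t₂) ^ N = (p : ℂ) ^ N := by rw [← hw, mul_pow, wpow_pow_card, mul_one]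
  have hS5 : (s₁ / t₂) ^ N = 1 - (p : ℂ) ^ N := by rw [← hT5]; linear_combination d.eq₅
  set q : ℝ := p ^ N / (p ^ N - 1) with hq
  have hq0 : 0 < q := div_pos (by linarith) (by linarith)
  have hS2 : (t₁ * s₃) ^ N = (q : ℂ) * (-(s₁ * s₃ / t₃)) ^ N := by
    have e : (q : ℂ) = -((t₁ * t₃ / t₂) ^ N / (s₁ / t₂) ^ N) := by
      rw [hS5, hT5, hq, ← div_neg]; push_cast; ring
    rw [e, hN.neg_pow, neg_mul_neg, ← div_pow, ← mul_pow]
    congr 1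
    field_simp
  obtain ⟨a, ha, hcp⟩ := exists_ofReal_mul_cpow (N : ℝ)⁻¹ hq0 (pow_ne_zero N d.s₄_ne)
  have hr : rProd N t₂ = a * rProd N (t₂ / t₃) := by
    rw [o₂.rProd_eq_rPrincipal, o₄.rProd_eq_rPrincipal, rPrincipal_eq_cpow d.eq₂,
      rPrincipal_eq_cpow (d.eq₄ hN), hS2]
    push_cast at hcp
    exact hcp
  have key : t₁ * t₃ / t₂ * -(s₁ * s₃ / t₃) = -(t₁ * s₃ * (s₁ / t₂)) := by field_simp
  have r4 : rProd N (t₂ / t₃) ≠ 0 := fun h0 => d.s₄_ne (by rw [h₄, h0, mul_zero])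
  rw [h₄, h₅, hr5, h₂, hr] at key
  have key2 : (p : ℂ) * wpow N 0 = (a * c : ℝ) * wpow N (e₂ + f - e₄ + half N + j) := by
    rw [wpow_add, wpow_add, wpow_sub, wpow_add, wpow_zero]
    have w3 := wpow_ne_zero N e₄
    push_cast
    rw [← hw]
    have : t₁ * t₃ / t₂ = a * c * (wpow N e₂ * wpow N f / wpow N e₄ * wpow N (half N)) := by
      apply mul_right_cancel₀ (mul_ne_zero w3 r4)
      rw [key]
      field_simp
    rw [this]
    ring
  exact (eq_of_ofReal_mul_wpow (by linarith) (mul_pos ha hc) key2).symm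

/-- If `(t₂/t₃)^N` and `(t₁t₃/t₂)^N` were both real and greater than `1`, the Fermat equations would
make `t₃^N` real and greater than `1` as well. So jumps need only be treated one at a time. -/
theorem offCuts₄_or_offCuts₅ (hN : Odd N) (d : FiveData N s₁ s₃ t₁ t₂ t₃) (o₃ : OffCuts N t₃) :
    OffCuts N (t₂ / t₃) ∨ OffCuts N (t₁ * t₃ / t₂) := by
  by_contra hcon
  rw [not_or] at hcon
  obtain ⟨h4, h5⟩ := hcon
  have k4 := (pow_ne_one_of_add d.s₄_ne (d.eq₄ hN))
  have k5 := (pow_ne_one_of_add d.s₅_ne d.eq₅)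
  rw [offCuts_iff] at h4 h5
  push Not at h4 h5
  obtain ⟨p, hp, h4⟩ := h4
  obtain ⟨q, hq, h5⟩ := h5
  have hp1 : 1 < p := lt_of_le_of_ne hp fun h0 => k4 (by rw [h4, ← h0]; simp)
  have hq1 : 1 < q := lt_of_le_of_ne hq fun h0 => k5 (by rw [h5, ← h0]; simp)
  have n2 := d.t₂_ne
  have n3 := d.t₃_ne
  have e : (t₂ / t₃) ^ N * (s₃ ^ N * (s₁ / t₂) ^ N) = -(-(s₁ * s₃ / t₃)) ^ N := by
    rw [hN.neg_pow, neg_neg, ← mul_pow, ← mul_pow]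
    congr 1
    field_simp
  have hs4 := eq_sub_of_add_eq' (d.eq₄ hN)
  have hs5 := eq_sub_of_add_eq' d.eq₅
  rw [hs4, hs5, h4, h5] at e
  have hs3 := eq_sub_of_add_eq' d.eq₃
  rw [hs3] at e
  refine offCuts_iff.mp o₃ (1 + (p - 1) / (p * (q - 1))) ?_ ?_
  · have : 0 < (p - 1) / (p * (q - 1)) :=
      div_pos (by linarith) (mul_pos (by linarith) (by linarith))
    linarith
  · have hp0 : (p : ℂ) ≠ 0 := Complex.ofReal_ne_zero.mpr (by linarith)
    have hq0 : (q : ℂ) - 1 ≠ 0 := by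
      rw [← Complex.ofReal_one, ← Complex.ofReal_sub]
      exact Complex.ofReal_ne_zero.mpr (by linarith)
    push_cast
    field_simp
    linear_combination e

end FiveData

/-- The quotient of the two sides of the five-term identity, for the exact root of unity. -/
noncomputable def fiveRatio (N : ℕ) [NeZero N] (s₁ s₃ t₁ t₂ t₃ : ℂ) : ℂ :=
  wpow N (fiveExponent N (phase N t₁ s₁) (phase N t₂ (t₁ * s₃)) (phase N t₃ s₃)
    (phase N (t₂ / t₃) (-(s₁ * s₃ / t₃))) (phase N (t₁ * t₃ / t₂) (s₁ / t₂))) *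
    fiveRight N s₁ s₃ t₁ t₂ t₃ / fiveLeft N t₁ t₂

namespace FiveData

variable {s₁ s₃ t₁ t₂ t₃ : ℂ}

theorem fiveLeft_ne_zero (hN : Odd N) (d : FiveData N s₁ s₃ t₁ t₂ t₃) : fiveLeft N t₁ t₂ ≠ 0 :=
  mul_ne_zero (hFun_ne_zero hN (isDetermination_gPrincipal N) d.t₁_ne
      (pow_ne_one_of_add d.s₁_ne d.eq₁))
    (hFun_ne_zero hN (isDetermination_gPrincipal N) d.t₂_ne (pow_ne_one_of_add d.s₂_ne d.eq₂))

theorem fiveRatio_pow (hN : Odd N) (d : FiveData N s₁ s₃ t₁ t₂ t₃) :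
    fiveRatio N s₁ s₃ t₁ t₂ t₃ ^ N = 1 := by
  rw [fiveRatio, div_pow, mul_pow, wpow_pow_card, one_mul, fiveRight,
    d.fiveSum_pow hN (isDetermination_gPrincipal N), ← fiveLeft, div_self]
  exact pow_ne_zero _ (d.fiveLeft_ne_zero hN)

theorem fiveIdentity_iff (hN : Odd N) (d : FiveData N s₁ s₃ t₁ t₂ t₃) :
    FiveIdentity N s₁ s₃ t₁ t₂ t₃ ↔ fiveRatio N s₁ s₃ t₁ t₂ t₃ = 1 := by
  rw [fiveRatio, div_eq_one_iff_eq (d.fiveLeft_ne_zero hN)]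
  constructor
  · intro h
    exact h _ _ _ _ _ (eq_wpow_phase_mul d.s₁_ne d.eq₁) (eq_wpow_phase_mul d.s₂_ne d.eq₂)
      (eq_wpow_phase_mul d.s₃_ne d.eq₃) (eq_wpow_phase_mul d.s₄_ne (d.eq₄ hN))
      (eq_wpow_phase_mul d.s₅_ne d.eq₅)
  · intro h e₁ e₂ e₃ e₄ f h₁ h₂ h₃ h₄ h₅
    rwa [phase_eq d.s₁_ne h₁, phase_eq d.s₂_ne h₂, phase_eq d.s₃_ne h₃, phase_eq d.s₄_ne h₄,
      phase_eq d.s₅_ne h₅] at h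

end FiveData

theorem tendsto_fd {X : Type*} {l : Filter X} {t s : X → ℂ} {t₀ s₀ : ℂ}
    (ht : Tendsto t l (𝓝 t₀)) (hs : Tendsto s l (𝓝 s₀))
    (h : ∀ k : ZMod N, k ≠ 0 → wpow N k ≠ t₀) (n : ZMod N) :
    Tendsto (fun x => fd N (t x) (s x) n) l (𝓝 (fd N t₀ s₀ n)) := by
  unfold fd
  refine tendsto_finsetProd _ fun j hj => hs.div (tendsto_const_nhds.sub ht) ?_
  have hj' : j + 1 < N := lt_of_le_of_lt (Nat.succ_le_of_lt (Finset.mem_range.mp hj))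
    (ZMod.val_lt n)
  have := h ((j + 1 : ℕ) : ZMod N) (fun h0 => by
    rw [ZMod.natCast_eq_zero_iff] at h0
    exact absurd (Nat.le_of_dvd (Nat.succ_pos j) h0) (by omega))
  rw [wpow_natCast] at this
  exact sub_ne_zero.mpr this

theorem wpow_ne_of_pow_ne_one {t : ℂ} (h : t ^ N ≠ 1) (k : ZMod N) : wpow N k ≠ t := by
  rintro rfl
  exact h (wpow_pow_card k)

theorem tendsto_fiveSum {X : Type*} {l : Filter X} {s₁ t₁ : ℂ} {s₃ t₂ t₃ : X → ℂ}
    {s₃' t₂' t₃' : ℂ} (hs₃ : Tendsto s₃ l (𝓝 s₃')) (ht₂ : Tendsto t₂ l (𝓝 t₂'))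
    (ht₃ : Tendsto t₃ l (𝓝 t₃')) (n₂ : t₂' ≠ 0) (n₃ : t₃' ≠ 0)
    (k₃ : ∀ k : ZMod N, k ≠ 0 → wpow N k ≠ t₃')
    (k₄ : ∀ k : ZMod N, k ≠ 0 → wpow N k ≠ t₂' / t₃')
    (k₅ : ∀ k : ZMod N, k ≠ 0 → wpow N k ≠ t₁ * t₃' / t₂') :
    Tendsto (fun x => fiveSum N s₁ (s₃ x) t₁ (t₂ x) (t₃ x) 0 0) l
      (𝓝 (fiveSum N s₁ s₃' t₁ t₂' t₃' 0 0)) := by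
  unfold fiveSum fiveTerm
  refine tendsto_finsetSum _ fun γ _ => Tendsto.mul (Tendsto.mul (Tendsto.const_mul _ ?_) ?_) ?_
  · exact tendsto_fd ((ht₃.const_mul _).div ht₂ n₂) (tendsto_const_nhds.div ht₂ n₂) k₅ _
  · exact tendsto_fd ht₃ hs₃ k₃ _
  · exact tendsto_fd (ht₂.div ht₃ n₃) ((hs₃.const_mul _).div ht₃ n₃).neg k₄ _

/-- The derived points `t₂/t₃` and `t₁t₃/t₂` are allowed to lie on cuts: at most one of them does,
and there the jump of `h` is compensated by that of the exponent. -/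
theorem FiveData.tendsto_fiveRatio (hN : Odd N) {X : Type*} {l : Filter X} {s₁ t₁ : ℂ}
    {s₃ t₂ t₃ : X → ℂ} {s₃' t₂' t₃' : ℂ} (hs₃ : Tendsto s₃ l (𝓝 s₃'))
    (ht₂ : Tendsto t₂ l (𝓝 t₂')) (ht₃ : Tendsto t₃ l (𝓝 t₃'))
    (d : FiveData N s₁ s₃' t₁ t₂' t₃') (hd : ∀ᶠ x in l, FiveData N s₁ (s₃ x) t₁ (t₂ x) (t₃ x))
    (o₂ : OffCuts N t₂') (o₃ : OffCuts N t₃') :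
    Tendsto (fun x => fiveRatio N s₁ (s₃ x) t₁ (t₂ x) (t₃ x)) l
      (𝓝 (fiveRatio N s₁ s₃' t₁ t₂' t₃')) := by
  have n2 := d.t₂_ne
  have n3 := d.t₃_ne
  have ht4 : Tendsto (fun x => t₂ x / t₃ x) l (𝓝 (t₂' / t₃')) := ht₂.div ht₃ n3
  have ht5 : Tendsto (fun x => t₁ * t₃ x / t₂ x) l (𝓝 (t₁ * t₃' / t₂')) :=
    (ht₃.const_mul t₁).div ht₂ n2
  have hs4 : Tendsto (fun x => -(s₁ * s₃ x / t₃ x)) l (𝓝 (-(s₁ * s₃' / t₃'))) :=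
    ((hs₃.const_mul s₁).div ht₃ n3).neg
  have hs5 : Tendsto (fun x => s₁ / t₂ x) l (𝓝 (s₁ / t₂')) := tendsto_const_nhds.div ht₂ n2
  have ev4 : ∀ᶠ x in l, -(s₁ * s₃ x / t₃ x) ≠ 0 ∧
      (t₂ x / t₃ x) ^ N + (-(s₁ * s₃ x / t₃ x)) ^ N = 1 :=
    hd.mono fun x hx => ⟨hx.s₄_ne, hx.eq₄ hN⟩
  have ev5 : ∀ᶠ x in l, s₁ / t₂ x ≠ 0 ∧ (t₁ * t₃ x / t₂ x) ^ N + (s₁ / t₂ x) ^ N = 1 :=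
    hd.mono fun x hx => ⟨hx.s₅_ne, hx.eq₅⟩
  have hC := tendsto_fiveSum (N := N) (s₁ := s₁) (t₁ := t₁) hs₃ ht₂ ht₃ n2 n3
    (fun k _ => wpow_ne_of_pow_ne_one (pow_ne_one_of_add d.s₃_ne d.eq₃) k)
    (fun k _ => wpow_ne_of_pow_ne_one (pow_ne_one_of_add d.s₄_ne (d.eq₄ hN)) k)
    (fun k _ => wpow_ne_of_pow_ne_one (pow_ne_one_of_add d.s₅_ne d.eq₅) k)
  have hh2 := (o₂.continuousAt_hFun n2).tendsto.comp ht₂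
  have hh3 := (o₃.continuousAt_hFun n3).tendsto.comp ht₃
  have p2 := o₂.eventually_phase_eq ht₂ (hs₃.const_mul t₁) d.s₂_ne d.eq₂
    (hd.mono fun x hx => ⟨hx.s₂_ne, hx.eq₂⟩)
  have p3 := o₃.eventually_phase_eq ht₃ hs₃ d.s₃_ne d.eq₃ (hd.mono fun x hx => ⟨hx.s₃_ne, hx.eq₃⟩)
  suffices hmain : Tendsto (fun x =>
      wpow N (fiveExponent N (phase N t₁ s₁) (phase N t₂' (t₁ * s₃')) (phase N t₃' s₃')
        (phase N (t₂ x / t₃ x) (-(s₁ * s₃ x / t₃ x))) (phase N (t₁ * t₃ x / t₂ x) (s₁ / t₂ x))) *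
      (hFun N (gPrincipal N) (t₁ * t₃ x / t₂ x) * hFun N (gPrincipal N) (t₂ x / t₃ x))) l
      (𝓝 (wpow N (fiveExponent N (phase N t₁ s₁) (phase N t₂' (t₁ * s₃')) (phase N t₃' s₃')
        (phase N (t₂' / t₃') (-(s₁ * s₃' / t₃'))) (phase N (t₁ * t₃' / t₂') (s₁ / t₂'))) *
      (hFun N (gPrincipal N) (t₁ * t₃' / t₂') * hFun N (gPrincipal N) (t₂' / t₃')))) by
    have hlim := ((hmain.mul hC).mul hh3).div ((tendsto_const_nhds
      (x := hFun N (gPrincipal N) t₁)).mul hh2) (d.fiveLeft_ne_zero hN)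
    have e : ∀ a b c h3 h4 h5 : ℂ, a * (h5 * h4) * c * h3 / b = a * (c * (h5 * h3 * h4)) / b := by
      intros; ring
    rw [e] at hlim
    refine Tendsto.congr' ?_ hlim
    filter_upwards [p2, p3] with x hx2 hx3
    rw [fiveRatio, hx2, hx3]
    exact e _ _ _ _ _ _
  have E₂ := eq_wpow_phase_mul d.s₂_ne d.eq₂
  have E₃ := eq_wpow_phase_mul d.s₃_ne d.eq₃
  have E₄ := eq_wpow_phase_mul d.s₄_ne (d.eq₄ hN)
  have E₅ := eq_wpow_phase_mul d.s₅_ne d.eq₅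
  by_cases o₅ : OffCuts N (t₁ * t₃' / t₂')
  · have p5 := o₅.eventually_phase_eq ht5 hs5 d.s₅_ne d.eq₅ ev5
    have hh5 := (o₅.continuousAt_hFun d.t₅_ne).tendsto.comp ht5
    have hh4 := tendsto_wpow_mul_hFun (fun e => fiveExponent N (phase N t₁ s₁)
      (phase N t₂' (t₁ * s₃')) (phase N t₃' s₃') e (phase N (t₁ * t₃' / t₂') (s₁ / t₂'))) d.t₄_ne
      ht4 hs4 d.s₄_ne (d.eq₄ hN) ev4 (fun j p hp hw => by
        have := d.add_eq_zero_of_mul_wpow_eq₄ hN o₃ o₅ hp hw E₃ E₄ E₅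
        rw [fiveExponent_add_one hN]
        linear_combination -this)
    have hlim := hh4.mul hh5
    rw [mul_assoc, mul_comm (hFun N (gPrincipal N) (t₂' / t₃'))] at hlim
    refine Tendsto.congr' ?_ hlim
    filter_upwards [p5] with x hx
    rw [hx]
    simp only [Function.comp_apply]
    ring
  · have o₄ := (d.offCuts₄_or_offCuts₅ hN o₃).resolve_right o₅
    have p4 := o₄.eventually_phase_eq ht4 hs4 d.s₄_ne (d.eq₄ hN) ev4
    have hh4 := (o₄.continuousAt_hFun d.t₄_ne).tendsto.comp ht4
    have hh5 := tendsto_wpow_mul_hFun (fun f => fiveExponent N (phase N t₁ s₁)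
      (phase N t₂' (t₁ * s₃')) (phase N t₃' s₃') (phase N (t₂' / t₃') (-(s₁ * s₃' / t₃'))) f)
      d.t₅_ne ht5 hs5 d.s₅_ne d.eq₅ ev5 (fun j p hp hw => by
        have := d.add_eq_zero_of_mul_wpow_eq₅ hN o₂ o₄ hp hw E₂ E₄ E₅
        rw [fiveExponent_add_one_last hN]
        linear_combination -this)
    have hlim := hh5.mul hh4
    rw [mul_assoc] at hlim
    refine Tendsto.congr' ?_ hlim
    filter_upwards [p4] with x hx
    rw [hx]
    simp only [Function.comp_apply]
    ring

/-! ### The limit along a ray, where the constant is computed. -/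

/-- On a cut too, both sides are positive multiples of `-ω^{1/2}`; their `N`-th powers agree, hence
so do the positive factors. -/
theorem rProd_eq_rPrincipal (hN : Odd N) {t : ℂ} (h : t ^ N ≠ 1) :
    rProd N t = rPrincipal N t := by
  by_cases ho : OffCuts N t
  · exact ho.rProd_eq_rPrincipal
  · obtain ⟨j, p, hp, hw⟩ := exists_mul_wpow_eq_of_not_offCuts ho h
    obtain ⟨c, hc, hr⟩ := rProd_eq_of_mul_wpow_eq hN hp hw
    have hpN : 1 < p ^ N := one_lt_pow₀ hp (NeZero.ne N)
    have ht : 1 - t ^ N = ((1 - p ^ N : ℝ) : ℂ) := by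
      have : t ^ N = (p : ℂ) ^ N := by rw [← hw, mul_pow, wpow_pow_card, mul_one]
      rw [this]
      push_cast
      ring
    have hR : rPrincipal N t = -((((p ^ N - 1) ^ ((N : ℝ)⁻¹) : ℝ) : ℂ) * wpow N (half N)) := by
      rw [rPrincipal, one_div, ht, (cpow_eq_neg_cpow_mul (by rw [Complex.ofReal_re]; linarith)).1
        (by rw [Complex.ofReal_im]), exp_pi_div hN, ← Complex.ofReal_neg, neg_sub,
        Complex.ofReal_cpow (by linarith)]
      push_cast
      ring
    have h1 : rProd N t ^ N = rPrincipal N t ^ N := by rw [rProd_pow, rPrincipal_pow]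
    rw [hr, hR, hN.neg_pow, hN.neg_pow, mul_pow, mul_pow, wpow_pow_card, mul_one, mul_one, neg_inj,
      ← Complex.ofReal_pow, ← Complex.ofReal_pow, Complex.ofReal_inj] at h1
    rw [hr, hR, (pow_left_inj₀ hc.le (Real.rpow_nonneg (by linarith) _) (NeZero.ne N)).mp h1]

/-- The logarithm of `-(xy/z)` is the combination of the logarithms shifted by an odd multiple of
`πi`; the bound on the arguments leaves only `±πi`. The sign decides between `k = 1/2` and `k =
-1/2`, but only `k²` enters the final exponent. -/
theorem cpow_neg_mul_div (hN : Odd N) {x y z : ℂ} (hx : x ≠ 0) (hy : y ≠ 0) (hz : z ≠ 0)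
    (h : |x.arg| + |y.arg| + |z.arg| < 2 * Real.pi) :
    ∃ k : ZMod N, k ^ 2 = half N ^ 2 ∧ x ^ ((N : ℂ)⁻¹) * y ^ ((N : ℂ)⁻¹) / z ^ ((N : ℂ)⁻¹) =
      -(wpow N k * (-(x * y / z)) ^ ((N : ℂ)⁻¹)) := by
  have hw : -(x * y / z) ≠ 0 := neg_ne_zero.mpr (div_ne_zero (mul_ne_zero hx hy) hz)
  have hexp : Complex.exp (Complex.log (-(x * y / z))) = Complex.exp (Complex.log x +
      Complex.log y - Complex.log z + Real.pi * Complex.I) := by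
    rw [Complex.exp_add, Complex.exp_sub, Complex.exp_add, Complex.exp_pi_mul_I,
      Complex.exp_log hx, Complex.exp_log hy, Complex.exp_log hz, Complex.exp_log hw]
    ring
  obtain ⟨n, hn⟩ := Complex.exp_eq_exp_iff_exists_int.mp hexp
  have him := congrArg Complex.im hn
  simp [Complex.log_im] at him
  have hpi := Real.pi_pos
  have b1 := Complex.arg_le_pi (-(x * y / z))
  have b2 := Complex.neg_pi_lt_arg (-(x * y / z))
  have hx1 := abs_le.mp (le_refl |x.arg|)
  have hy1 := abs_le.mp (le_refl |y.arg|)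
  have hz1 := abs_le.mp (le_refl |z.arg|)
  have hn1 : (n : ℝ) < 1 := by
    by_contra hcon
    push Not at hcon
    nlinarith
  have hn2 : -2 < (n : ℝ) := by
    by_contra hcon
    push Not at hcon
    nlinarith
  have hn1' : n < 1 := by exact_mod_cast hn1
  have hn2' : -2 < n := by exact_mod_cast hn2
  have hE := exp_pi_div (N := N) hN
  have hNc : (N : ℂ) ≠ 0 := Nat.cast_ne_zero.mpr (NeZero.ne N)
  have hh := wpow_ne_zero N (half N)
  have hcases : n = 0 ∨ n = -1 := by omega
  rw [Complex.cpow_def_of_ne_zero hx, Complex.cpow_def_of_ne_zero hy,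
    Complex.cpow_def_of_ne_zero hz, Complex.cpow_def_of_ne_zero hw, hn, ← Complex.exp_add,
    ← Complex.exp_sub]
  rcases hcases with rfl | rfl
  · refine ⟨-half N, by ring, ?_⟩
    have e : (Complex.log x + Complex.log y - Complex.log z + Real.pi * Complex.I +
        ((0 : ℤ) : ℂ) * (2 * Real.pi * Complex.I)) * (N : ℂ)⁻¹ =
        (Complex.log x * (N : ℂ)⁻¹ + Complex.log y * (N : ℂ)⁻¹ - Complex.log z * (N : ℂ)⁻¹) +
          Real.pi * Complex.I / N := by
      push_cast; ring
    rw [e, Complex.exp_add _ (Real.pi * Complex.I / N), hE, wpow_neg]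
    field_simp
  · refine ⟨half N, rfl, ?_⟩
    have e : (Complex.log x + Complex.log y - Complex.log z + Real.pi * Complex.I +
        ((-1 : ℤ) : ℂ) * (2 * Real.pi * Complex.I)) * (N : ℂ)⁻¹ =
        (Complex.log x * (N : ℂ)⁻¹ + Complex.log y * (N : ℂ)⁻¹ - Complex.log z * (N : ℂ)⁻¹) -
          Real.pi * Complex.I / N := by
      push_cast; ring
    rw [e, Complex.exp_sub _ (Real.pi * Complex.I / N), hE]
    field_simp

theorem offCuts_rPrincipal_iff {s : ℂ} : OffCuts N (rPrincipal N s) ↔ s ^ N ∈ Complex.slitPlane := by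
  rw [OffCuts, rPrincipal_pow, sub_sub_cancel]

theorem ofReal_mul_mem_slitPlane {z : ℂ} (hz : z ∈ Complex.slitPlane) {r : ℝ} (hr : 0 < r) :
    (r : ℂ) * z ∈ Complex.slitPlane := by
  rw [Complex.mem_slitPlane_iff] at hz ⊢
  rw [Complex.re_ofReal_mul, Complex.im_ofReal_mul]
  exact hz.imp (fun h => mul_pos hr h) fun h => mul_ne_zero hr.ne' h

theorem rPrincipal_ne_zero {s : ℂ} (h : s ^ N ≠ 1) : rPrincipal N s ≠ 0 := by
  intro h0
  have h1 := rPrincipal_pow (N := N) s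
  rw [h0, zero_pow (NeZero.ne N)] at h1
  exact h (by linear_combination h1)

theorem fd_one_zero {n : ZMod N} (hn : n ≠ 0) (t : ℂ) : fd N t 0 n = 0 := by
  have : n.val ≠ 0 := fun h => hn ((ZMod.val_eq_zero n).mp h)
  simp [fd, this]

theorem fiveSum_zero_one (s₁ t₁ : ℂ) : fiveSum N s₁ 0 t₁ 1 1 0 0 = 1 := by
  rw [fiveSum, Fintype.sum_eq_single 0]
  · simp [fiveTerm, wpow_zero]
  · intro γ hγ
    simp [fiveTerm, fd_one_zero hγ]

theorem gPrincipal_one_ne_zero (N : ℕ) [NeZero N] : gPrincipal N 1 ≠ 0 := by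
  intro h0
  have h := isDetermination_gPrincipal N 1
  rw [h0, zero_pow (NeZero.ne N)] at h
  exact prod_one_sub_root_ne_zero N h.symm

theorem hFun_gPrincipal_one (N : ℕ) [NeZero N] : hFun N (gPrincipal N) 1 = 1 := by
  rw [hFun, div_self (gPrincipal_one_ne_zero N)]
  simp

theorem continuousAt_hFun_gPrincipal_one (N : ℕ) [NeZero N] :
    ContinuousAt (hFun N (gPrincipal N)) 1 :=
  continuousAt_hFun_gPrincipal one_ne_zero fun _ hk =>
    one_sub_mul_wpow_mem_of_ne (j := 0) (p := 1) one_pos (by simp [wpow_zero]) hk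

theorem rPrincipal_zero (N : ℕ) [NeZero N] : rPrincipal N 0 = 1 := by
  simp [rPrincipal, NeZero.ne N]

theorem offCuts_zero (N : ℕ) [NeZero N] : OffCuts N 0 := by
  simp [OffCuts, NeZero.ne N]

theorem one_ne_wpow {k : ZMod N} (hk : k ≠ 0) : wpow N k ≠ 1 := by
  rw [← wpow_zero N]
  exact fun h => hk (wpow_injective N h)

/-- This is the configuration in the limit `s₃ → 0`: `f = e₁` kills the bilinear term, and `(1/2)³`
cancels the remaining square. It explains the constant `1/8`. -/
theorem fiveExponent_eq_zero (e₁ e₂ e₃ : ZMod N) {e₄ k : ZMod N} (hk : k ^ 2 = half N ^ 2)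
    (h : e₄ = e₁ + e₃ + k) : fiveExponent N e₁ e₂ e₃ e₄ e₁ = 0 := by
  unfold fiveExponent
  rw [h]
  linear_combination (-half N) * hk

section Ray

variable {s₁ s₃ t₁ : ℂ}

theorem FiveData.of_ray {t₂ t₃ : ℂ} (d : FiveData N s₁ s₃ t₁ t₂ t₃) (c₂ : OffCuts N (t₁ * s₃))
    (c₃ : OffCuts N s₃) {x : ℝ} (hx : x ∈ Set.Ioc (0 : ℝ) 1) :
    FiveData N s₁ (x * s₃) t₁ (rPrincipal N (t₁ * (x * s₃))) (rPrincipal N (x * s₃)) where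
  s₁_ne := d.s₁_ne
  s₃_ne := mul_ne_zero (Complex.ofReal_ne_zero.mpr hx.1.ne') d.s₃_ne
  t₁_ne := d.t₁_ne
  t₂_ne := rPrincipal_ne_zero (by
    rw [mul_left_comm]
    exact (c₂.ofReal_mul hx.1.le hx.2).pow_ne_one)
  t₃_ne := rPrincipal_ne_zero (c₃.ofReal_mul hx.1.le hx.2).pow_ne_one
  eq₁ := d.eq₁
  eq₂ := by rw [rPrincipal_pow]; ring
  eq₃ := by rw [rPrincipal_pow]; ring

/-- As `x → 0` the point `(t₁t₃/t₂, s₁/t₂)` tends to `(t₁, s₁)`, so `f = e₁`. The argument of `t₃^N`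
tends to `0` while those of `s₁^N` and `(x s₃)^N` stay fixed and inside `(-π, π)`, so
`cpow_neg_mul_div` gives `e₄ = e₁ + e₃ ± 1/2`. -/
theorem eventually_fiveExponent_eq_zero (hN : Odd N) {t₂ t₃ : ℂ} (d : FiveData N s₁ s₃ t₁ t₂ t₃)
    (c₂ : OffCuts N (t₁ * s₃)) (c₃ : OffCuts N s₃) (o₁ : OffCuts N t₁)
    (m₃ : s₃ ^ N ∈ Complex.slitPlane)
    (ht₂ : Tendsto (fun x : ℝ => rPrincipal N (t₁ * (x * s₃))) (𝓝[>] 0) (𝓝 1))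
    (ht₃ : Tendsto (fun x : ℝ => rPrincipal N (x * s₃)) (𝓝[>] 0) (𝓝 1)) :
    ∀ᶠ x : ℝ in 𝓝[>] 0, fiveExponent N (phase N t₁ s₁)
      (phase N (rPrincipal N (t₁ * (x * s₃))) (t₁ * (x * s₃)))
      (phase N (rPrincipal N (x * s₃)) (x * s₃))
      (phase N (rPrincipal N (t₁ * (x * s₃)) / rPrincipal N (x * s₃))
        (-(s₁ * (x * s₃) / rPrincipal N (x * s₃))))
      (phase N (t₁ * rPrincipal N (x * s₃) / rPrincipal N (t₁ * (x * s₃)))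
        (s₁ / rPrincipal N (t₁ * (x * s₃)))) = 0 := by
  have hmem : ∀ᶠ x : ℝ in 𝓝[>] 0, x ∈ Set.Ioc (0 : ℝ) 1 := Ioc_mem_nhdsGT zero_lt_one
  have hd : ∀ᶠ x : ℝ in 𝓝[>] 0, FiveData N s₁ (x * s₃) t₁ (rPrincipal N (t₁ * (x * s₃)))
      (rPrincipal N (x * s₃)) := hmem.mono fun x hx => d.of_ray c₂ c₃ hx
  have ht5 : Tendsto (fun x : ℝ => t₁ * rPrincipal N (x * s₃) / rPrincipal N (t₁ * (x * s₃)))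
      (𝓝[>] 0) (𝓝 t₁) := by
    have := (ht₃.const_mul t₁).div ht₂ one_ne_zero
    rwa [mul_one, div_one] at this
  have hs5 : Tendsto (fun x : ℝ => s₁ / rPrincipal N (t₁ * (x * s₃))) (𝓝[>] 0) (𝓝 s₁) := by
    have := (tendsto_const_nhds (x := s₁)).div ht₂ one_ne_zero
    rwa [div_one] at this
  have p5 := o₁.eventually_phase_eq ht5 hs5 d.s₁_ne d.eq₁ (hd.mono fun x hx => ⟨hx.s₅_ne, hx.eq₅⟩)
  have m₁ := o₁.pow_mem_slitPlane d.eq₁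
  have habs : ∀ {z : ℂ}, z ∈ Complex.slitPlane → |z.arg| < Real.pi := fun hz =>
    lt_of_le_of_ne (Complex.abs_arg_le_pi _) fun h => by
      rcases (abs_eq Real.pi_pos.le).mp h with h | h
      · exact (Complex.mem_slitPlane_iff_arg.mp hz).1 h
      · exact absurd (Complex.neg_pi_lt_arg _) (by rw [h]; exact lt_irrefl _)
  have harg : ∀ᶠ x : ℝ in 𝓝[>] 0, |(rPrincipal N (x * s₃) ^ N).arg| <
      2 * Real.pi - |(s₁ ^ N).arg| - |(s₃ ^ N).arg| := by
    have hT : Tendsto (fun x : ℝ => rPrincipal N (x * s₃) ^ N) (𝓝[>] 0) (𝓝 1) := by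
      simpa using ht₃.pow N
    have hc := ((Complex.continuousAt_arg Complex.one_mem_slitPlane).abs.tendsto.comp hT)
    refine hc.eventually (gt_mem_nhds ?_)
    rw [Complex.arg_one, abs_zero]
    linarith [habs m₁, habs m₃]
  filter_upwards [hmem, hd, p5, harg] with x hx dx hp5 hax
  rw [hp5]
  have hxN : 0 < x ^ N := pow_pos hx.1 N
  have e3 : ((x : ℂ) * s₃) ^ N = ((x ^ N : ℝ) : ℂ) * s₃ ^ N := by rw [mul_pow]; push_cast; ring
  have harg3 : (((x : ℂ) * s₃) ^ N).arg = (s₃ ^ N).arg := by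
    rw [e3, Complex.arg_real_mul _ hxN]
  obtain ⟨k, hk, hcp⟩ := cpow_neg_mul_div (N := N) hN (pow_ne_zero N dx.s₁_ne)
    (pow_ne_zero N dx.s₃_ne) (pow_ne_zero N dx.t₃_ne) (by rw [harg3]; linarith)
  refine fiveExponent_eq_zero _ _ _ hk (phase_eq dx.s₄_ne ?_)
  have e1 := eq_wpow_phase_mul dx.s₁_ne dx.eq₁
  have e2 := eq_wpow_phase_mul dx.s₃_ne dx.eq₃
  have r1 : rProd N t₁ = (s₁ ^ N) ^ ((N : ℂ)⁻¹) := by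
    rw [o₁.rProd_eq_rPrincipal, rPrincipal_eq_cpow d.eq₁]
  have r3 : rProd N (rPrincipal N (x * s₃)) = ((x * s₃) ^ N) ^ ((N : ℂ)⁻¹) := by
    rw [rProd_eq_rPrincipal hN (pow_ne_one_of_add dx.s₃_ne dx.eq₃), rPrincipal_eq_cpow dx.eq₃]
  have r4 : rProd N (rPrincipal N (t₁ * (x * s₃)) / rPrincipal N (x * s₃)) =
      ((-(s₁ * (x * s₃) / rPrincipal N (x * s₃))) ^ N) ^ ((N : ℂ)⁻¹) := by
    rw [rProd_eq_rPrincipal hN (pow_ne_one_of_add dx.s₄_ne (dx.eq₄ hN)),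
      rPrincipal_eq_cpow (dx.eq₄ hN)]
  have r0 : (rPrincipal N (x * s₃) ^ N) ^ ((N : ℂ)⁻¹) = rPrincipal N (x * s₃) := by
    rw [rPrincipal_pow, rPrincipal, one_div]
  rw [hN.neg_pow, div_pow, mul_pow] at r4
  rw [r0, ← r1, ← r3, ← r4] at hcp
  rw [wpow_add, wpow_add]
  have : -(s₁ * (x * s₃) / rPrincipal N (x * s₃)) =
      -(wpow N (phase N t₁ s₁) * wpow N (phase N (rPrincipal N (x * s₃)) (x * s₃)) *
        (rProd N t₁ * rProd N (rPrincipal N (x * s₃)) / rPrincipal N (x * s₃))) := by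
    linear_combination (-(x * s₃ / rPrincipal N (x * s₃))) * e1 -
      (wpow N (phase N t₁ s₁) * rProd N t₁ / rPrincipal N (x * s₃)) * e2
  rw [this, hcp]
  ring

/-- Scaling `s₃` by `x ∈ (0, 1]`, with `t₂, t₃` the principal roots, keeps the ratio continuous and
hence constant. As `x → 0` only `γ = 0` survives in the sum and `h(t₂), h(t₃), h(t₂/t₃)` tend to
`h(1) = 1`, so the ratio tends to `1`. -/
theorem FiveData.fiveIdentity_rPrincipal (hN : Odd N)
    (d : FiveData N s₁ s₃ t₁ (rPrincipal N (t₁ * s₃)) (rPrincipal N s₃))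
    (c₂ : OffCuts N (t₁ * s₃)) (c₃ : OffCuts N s₃) (o₁ : OffCuts N t₁)
    (o₂ : OffCuts N (rPrincipal N (t₁ * s₃))) (o₃ : OffCuts N (rPrincipal N s₃)) :
    FiveIdentity N s₁ s₃ t₁ (rPrincipal N (t₁ * s₃)) (rPrincipal N s₃) := by
  rw [d.fiveIdentity_iff hN]
  have m₂ := offCuts_rPrincipal_iff.mp o₂
  have m₃ := offCuts_rPrincipal_iff.mp o₃
  set F : ℝ → ℂ := fun x => fiveRatio N s₁ (x * s₃) t₁ (rPrincipal N (t₁ * (x * s₃)))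
    (rPrincipal N (x * s₃)) with hF
  have hcont : ContinuousOn F (Set.Ioc 0 1) := by
    intro x hx
    have hs : ContinuousAt (fun x : ℝ => (x : ℂ) * s₃) x := by fun_prop
    have hs2 : ContinuousAt (fun x : ℝ => t₁ * ((x : ℂ) * s₃)) x := by fun_prop
    have hc2 : OffCuts N (t₁ * (x * s₃)) := by
      rw [mul_left_comm]
      exact c₂.ofReal_mul hx.1.le hx.2
    refine FiveData.tendsto_fiveRatio hN (hs.tendsto.mono_left nhdsWithin_le_nhds)
      ((ContinuousAt.comp (f := fun x : ℝ => t₁ * ((x : ℂ) * s₃)) hc2.continuousAt_rPrincipal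
        hs2).tendsto.mono_left nhdsWithin_le_nhds)
      ((ContinuousAt.comp (f := fun x : ℝ => (x : ℂ) * s₃)
        (c₃.ofReal_mul hx.1.le hx.2).continuousAt_rPrincipal hs).tendsto.mono_left
        nhdsWithin_le_nhds) (d.of_ray c₂ c₃ hx)
      (eventually_nhdsWithin_of_forall fun y hy => d.of_ray c₂ c₃ hy) ?_ ?_
    · rw [offCuts_rPrincipal_iff, mul_left_comm, mul_pow, ← Complex.ofReal_pow]
      exact ofReal_mul_mem_slitPlane m₂ (pow_pos hx.1 N)
    · rw [offCuts_rPrincipal_iff, mul_pow, ← Complex.ofReal_pow]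
      exact ofReal_mul_mem_slitPlane m₃ (pow_pos hx.1 N)
  have h1 : (1 : ℝ) ∈ Set.Ioc (0 : ℝ) 1 := by simp
  have hconst : ∀ x ∈ Set.Ioc (0 : ℝ) 1, F x = F 1 := fun x hx =>
    eq_of_continuousOn_of_pow_eq_one isPreconnected_Ioc hcont
      (fun y hy => (d.of_ray c₂ c₃ hy).fiveRatio_pow hN) hx h1
  have hmem : ∀ᶠ x : ℝ in 𝓝[>] 0, x ∈ Set.Ioc (0 : ℝ) 1 := Ioc_mem_nhdsGT zero_lt_one
  have hs₃ : Tendsto (fun x : ℝ => (x : ℂ) * s₃) (𝓝[>] 0) (𝓝 0) := by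
    have : ContinuousAt (fun x : ℝ => (x : ℂ) * s₃) 0 := by fun_prop
    have h := this.tendsto
    simp only [Complex.ofReal_zero, zero_mul] at h
    exact h.mono_left nhdsWithin_le_nhds
  have hr : Tendsto (rPrincipal N) (𝓝 0) (𝓝 1) := by
    have := (offCuts_zero N).continuousAt_rPrincipal.tendsto
    rwa [rPrincipal_zero] at this
  have ht₃ : Tendsto (fun x : ℝ => rPrincipal N (x * s₃)) (𝓝[>] 0) (𝓝 1) := hr.comp hs₃
  have ht₂ : Tendsto (fun x : ℝ => rPrincipal N (t₁ * (x * s₃))) (𝓝[>] 0) (𝓝 1) := by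
    have := hs₃.const_mul t₁
    rw [mul_zero] at this
    exact hr.comp this
  have ht4 : Tendsto (fun x : ℝ => rPrincipal N (t₁ * (x * s₃)) / rPrincipal N (x * s₃))
      (𝓝[>] 0) (𝓝 1) := by
    have := ht₂.div ht₃ one_ne_zero
    rwa [div_one] at this
  have ht5 : Tendsto (fun x : ℝ => t₁ * rPrincipal N (x * s₃) / rPrincipal N (t₁ * (x * s₃)))
      (𝓝[>] 0) (𝓝 t₁) := by
    have := (ht₃.const_mul t₁).div ht₂ one_ne_zero
    rwa [mul_one, div_one] at this
  have hC := tendsto_fiveSum (N := N) (s₁ := s₁) (t₁ := t₁) hs₃ ht₂ ht₃ one_ne_zero one_ne_zero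
    (fun k hk => one_ne_wpow hk) (fun k hk => by rw [div_one]; exact one_ne_wpow hk)
    (fun k _ => by
      rw [mul_one, div_one]
      exact wpow_ne_of_pow_ne_one o₁.pow_ne_one k)
  rw [fiveSum_zero_one] at hC
  have hh1 := (continuousAt_hFun_gPrincipal_one N).tendsto
  rw [hFun_gPrincipal_one] at hh1
  have hh5 := (o₁.continuousAt_hFun d.t₁_ne).tendsto.comp ht5
  have g1 : hFun N (gPrincipal N) t₁ ≠ 0 :=
    hFun_ne_zero hN (isDetermination_gPrincipal N) d.t₁_ne o₁.pow_ne_one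
  have hlim := (hC.mul ((hh5.mul (hh1.comp ht₃)).mul (hh1.comp ht4))).div
    ((tendsto_const_nhds (x := hFun N (gPrincipal N) t₁)).mul (hh1.comp ht₂))
    (by rw [mul_one]; exact g1)
  rw [one_mul, mul_one, mul_one, div_self g1] at hlim
  have hev := eventually_fiveExponent_eq_zero hN d c₂ c₃ o₁ m₃ ht₂ ht₃
  have hF1 : F 1 = 1 := by
    refine tendsto_nhds_unique (f := fun _ : ℝ => F 1) (l := 𝓝[>] (0 : ℝ)) tendsto_const_nhds
      (hlim.congr' ?_)
    filter_upwards [hev, hmem] with x hx hx'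
    rw [← hconst x hx', hF]
    simp only [fiveRatio]
    rw [hx, wpow_zero, one_mul]
    rfl
  simpa [hF] using hF1

end Ray

/-! ### Removal of the restrictions on the roots and on `s₃`. -/

namespace FiveData

variable {s₁ s₃ t₁ t₂ t₃ : ℂ}

theorem fiveIdentity_of_root_pow_mul (hN : Odd N) (m n : ℕ) :
    ∀ {t₂ t₃ : ℂ}, FiveData N s₁ s₃ t₁ t₂ t₃ →
      FiveIdentity N s₁ s₃ t₁ (root N ^ m * t₂) (root N ^ n * t₃) →
      FiveIdentity N s₁ s₃ t₁ t₂ t₃ := by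
  induction m with
  | zero =>
    induction n with
    | zero =>
      intro t₂ t₃ _ h
      simpa using h
    | succ n ih =>
      intro t₂ t₃ d h
      exact d.fiveIdentity_of_root_mul₃ hN (ih d.root_mul₃ (by rwa [← mul_assoc, ← pow_succ]))
  | succ m ih =>
    intro t₂ t₃ d h
    exact d.fiveIdentity_of_root_mul₂ hN (ih d.root_mul₂ (by rwa [← mul_assoc, ← pow_succ]))

/-- The given `t₂` and `t₃` differ from the principal roots by powers of `ω`, which the invariance
under multiplication by `ω` removes. -/
theorem fiveIdentity_of_offCuts (hN : Odd N) (d : FiveData N s₁ s₃ t₁ t₂ t₃)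
    (c₂ : OffCuts N (t₁ * s₃)) (c₃ : OffCuts N s₃) (o₁ : OffCuts N t₁) (o₂ : OffCuts N t₂)
    (o₃ : OffCuts N t₃) : FiveIdentity N s₁ s₃ t₁ t₂ t₃ := by
  have d1 := d.of_ray c₂ c₃ (x := 1) (by simp)
  rw [Complex.ofReal_one, one_mul] at d1
  have r2 : rPrincipal N (t₁ * s₃) ^ N = t₂ ^ N := by
    rw [rPrincipal_pow]; linear_combination -d.eq₂
  have r3 : rPrincipal N s₃ ^ N = t₃ ^ N := by
    rw [rPrincipal_pow]; linear_combination -d.eq₃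
  obtain ⟨m, hm⟩ := exists_eq_wpow_mul d.t₂_ne r2
  obtain ⟨n, hn⟩ := exists_eq_wpow_mul d.t₃_ne r3
  have h := d1.fiveIdentity_rPrincipal hN c₂ c₃ o₁ (by rwa [OffCuts, r2]) (by rwa [OffCuts, r3])
  rw [hm, hn] at h
  exact d.fiveIdentity_of_root_pow_mul hN m.val n.val h

end FiveData

theorem isOpen_setOf_offCuts (N : ℕ) : IsOpen {t : ℂ | OffCuts N t} :=
  Complex.isOpen_slitPlane.preimage (f := fun t : ℂ => 1 - t ^ N) (by fun_prop)

theorem tendsto_mul_exp (s : ℂ) :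
    Tendsto (fun x : ℝ => s * Complex.exp (x * Complex.I)) (𝓝[>] 0) (𝓝 s) := by
  have : ContinuousAt (fun x : ℝ => s * Complex.exp (x * Complex.I)) 0 := by fun_prop
  have h := this.tendsto
  simp only [Complex.ofReal_zero, zero_mul, Complex.exp_zero, mul_one] at h
  exact h.mono_left nhdsWithin_le_nhds

/-- On a cut, `s^N` is a positive real, and a small rotation of `s` gives it a nonzero imaginary
part. -/
theorem eventually_offCuts_mul_exp (N : ℕ) [NeZero N] (s : ℂ) :
    ∀ᶠ x : ℝ in 𝓝[>] 0, OffCuts N (s * Complex.exp (x * Complex.I)) := by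
  by_cases ho : OffCuts N s
  · exact (tendsto_mul_exp s).eventually ((isOpen_setOf_offCuts N).mem_nhds ho)
  · rw [offCuts_iff] at ho
    push Not at ho
    obtain ⟨p, hp, hs⟩ := ho
    have hN0 : (0 : ℝ) < N := Nat.cast_pos.mpr (NeZero.pos N)
    filter_upwards [Ioo_mem_nhdsGT (div_pos Real.pi_pos hN0)] with x hx
    have hsin : 0 < Real.sin (N * x) := Real.sin_pos_of_pos_of_lt_pi (mul_pos hN0 hx.1) (by
      have := (lt_div_iff₀ hN0).mp hx.2
      linarith)
    refine Or.inr ?_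
    have e : Complex.exp (x * Complex.I) ^ N = Complex.exp (((N * x : ℝ) : ℂ) * Complex.I) := by
      rw [← Complex.exp_nat_mul]; push_cast; ring_nf
    rw [mul_pow, hs, e, Complex.sub_im, Complex.im_ofReal_mul, Complex.exp_ofReal_mul_I_im,
      Complex.one_im, zero_sub]
    exact neg_ne_zero.mpr (mul_pos (by linarith) hsin).ne'

/-- A continuous branch of `(1 - s^N)^{1/N}` through `t₀`: dividing by `t₀^N` puts the argument of
the root near `1`, where the principal root is continuous. -/
theorem tendsto_root_perturbation {X : Type*} {l : Filter X} {s : X → ℂ} {t₀ s₀ : ℂ}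
    (ht₀ : t₀ ≠ 0) (hs : Tendsto s l (𝓝 s₀)) (h : t₀ ^ N + s₀ ^ N = 1) :
    Tendsto (fun x => t₀ * ((1 - s x ^ N) / t₀ ^ N) ^ ((N : ℂ)⁻¹)) l (𝓝 t₀) := by
  have h1 : Tendsto (fun x => (1 - s x ^ N) / t₀ ^ N) l (𝓝 1) := by
    have := (tendsto_const_nhds (x := (1 : ℂ))).sub (hs.pow N) |>.div_const (t₀ ^ N)
    rwa [← eq_sub_of_add_eq h, div_self (pow_ne_zero N ht₀)] at this
  have h2 : ContinuousAt (fun z : ℂ => z ^ ((N : ℂ)⁻¹)) 1 :=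
    ContinuousAt.cpow continuousAt_id continuousAt_const Complex.one_mem_slitPlane
  have := (h2.tendsto.comp h1).const_mul t₀
  simpa using this

theorem root_perturbation_pow {t₀ : ℂ} (ht₀ : t₀ ≠ 0) (s : ℂ) :
    (t₀ * ((1 - s ^ N) / t₀ ^ N) ^ ((N : ℂ)⁻¹)) ^ N + s ^ N = 1 := by
  rw [mul_pow, Complex.cpow_nat_inv_pow _ (NeZero.ne N),
    mul_div_cancel₀ _ (pow_ne_zero N ht₀), sub_add_cancel]

/-- Rotating `s₃` slightly moves `s₃` and `t₁s₃` off the cuts, where the identity is known;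
continuity of the ratio brings it back to the given point. -/
theorem FiveData.fiveIdentity (hN : Odd N) {s₁ s₃ t₁ t₂ t₃ : ℂ}
    (d : FiveData N s₁ s₃ t₁ t₂ t₃) (o₁ : OffCuts N t₁) (o₂ : OffCuts N t₂) (o₃ : OffCuts N t₃) :
    FiveIdentity N s₁ s₃ t₁ t₂ t₃ := by
  set u₃ : ℝ → ℂ := fun x => s₃ * Complex.exp (x * Complex.I) with hu₃
  set v₂ : ℝ → ℂ := fun x => t₂ * ((1 - (t₁ * u₃ x) ^ N) / t₂ ^ N) ^ ((N : ℂ)⁻¹) with hv₂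
  set v₃ : ℝ → ℂ := fun x => t₃ * ((1 - u₃ x ^ N) / t₃ ^ N) ^ ((N : ℂ)⁻¹) with hv₃
  have hu : Tendsto u₃ (𝓝[>] 0) (𝓝 s₃) := tendsto_mul_exp s₃
  have h2 : Tendsto v₂ (𝓝[>] 0) (𝓝 t₂) :=
    tendsto_root_perturbation d.t₂_ne (hu.const_mul t₁) d.eq₂
  have h3 : Tendsto v₃ (𝓝[>] 0) (𝓝 t₃) := tendsto_root_perturbation d.t₃_ne hu d.eq₃
  have hd : ∀ᶠ x in 𝓝[>] 0, FiveData N s₁ (u₃ x) t₁ (v₂ x) (v₃ x) := by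
    filter_upwards [h2.eventually_ne d.t₂_ne, h3.eventually_ne d.t₃_ne] with x n2 n3
    exact ⟨d.s₁_ne, mul_ne_zero d.s₃_ne (Complex.exp_ne_zero _), d.t₁_ne, n2, n3, d.eq₁,
      root_perturbation_pow d.t₂_ne _, root_perturbation_pow d.t₃_ne _⟩
  rw [d.fiveIdentity_iff hN]
  refine tendsto_nhds_unique (d.tendsto_fiveRatio hN hu h2 h3 hd o₂ o₃) ?_
  refine tendsto_const_nhds.congr' ?_
  have hc2 := eventually_offCuts_mul_exp N (t₁ * s₃)
  have hc3 := eventually_offCuts_mul_exp N s₃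
  filter_upwards [hd, hc2, hc3, h2.eventually ((isOpen_setOf_offCuts N).mem_nhds o₂),
    h3.eventually ((isOpen_setOf_offCuts N).mem_nhds o₃)] with x dx c2 c3 o2 o3
  rw [mul_assoc] at c2
  exact ((dx.fiveIdentity_iff hN).mp (dx.fiveIdentity_of_offCuts hN c2 c3 o₁ o2 o3)).symm

theorem wpow_eq_of_gPrincipal {N : ℕ} [NeZero N] (hN : Odd N)
    {s₁ s₃ t₁ t₂ t₃ : ℂ} (d : FiveData N s₁ s₃ t₁ t₂ t₃)
    (o₁ : OffCuts N t₁) (o₂ : OffCuts N t₂) (o₃ : OffCuts N t₃) {e₁ e₂ e₃ e₄ f : ZMod N}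
    (h₁ : s₁ = wpow N e₁ * rPrincipal N t₁) (h₂ : t₁ * s₃ = wpow N e₂ * rPrincipal N t₂)
    (h₃ : s₃ = wpow N e₃ * rPrincipal N t₃)
    (h₄ : -(s₁ * s₃ / t₃) = wpow N e₄ * rPrincipal N (t₂ / t₃))
    (h₅ : s₁ / t₂ = wpow N f * rPrincipal N (t₁ * t₃ / t₂)) :
    wpow N (half N ^ 3 + (e₁ - f) * (e₂ - e₃) - half N * (e₄ - e₃ - f) ^ 2) *
      (fiveSum N s₁ s₃ t₁ t₂ t₃ 0 0 * (hFun N (gPrincipal N) (t₁ * t₃ / t₂) *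
        hFun N (gPrincipal N) t₃ * hFun N (gPrincipal N) (t₂ / t₃))) =
      hFun N (gPrincipal N) t₁ * hFun N (gPrincipal N) t₂ := by
  rw [← o₁.rProd_eq_rPrincipal] at h₁
  rw [← o₂.rProd_eq_rPrincipal] at h₂
  rw [← o₃.rProd_eq_rPrincipal] at h₃
  rw [← rProd_eq_rPrincipal hN (pow_ne_one_of_add d.s₄_ne (d.eq₄ hN))] at h₄
  rw [← rProd_eq_rPrincipal hN (pow_ne_one_of_add d.s₅_ne d.eq₅)] at h₅
  exact d.fiveIdentity hN o₁ o₂ o₃ e₁ e₂ e₃ e₄ f h₁ h₂ h₃ h₄ h₅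

end CyclicSixJ

/-! ### Assembly of the proposition. -/

open CyclicSixJ
theorem proposition5p7 (N : ℕ) [NeZero N] (hN : Odd N) (hN1 : 1 < N)
    (g : ℂ → ℂ) (hg : IsDetermination N g)
    (ρ μ ν ρμ μν ρμν : StdRep) (hreg : IsRegularTriple N ρ μ ν)
    (hρμ : IsProduct N ρ μ ρμ) (hμν : IsProduct N μ ν μν) (hρμν : IsProduct N ρμ ν ρμν) :
    -- the standard Clebsch–Gordan operators are bases of the multiplicity modules
    (IsBasisOf (stdCGO N g ρ μ ρμ) (intertwiners (ρμ.hom N) (tensorRep (ρ.hom N) (μ.hom N))) ∧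
     IsBasisOf (stdCGO N g ρμ ν ρμν) (intertwiners (ρμν.hom N) (tensorRep (ρμ.hom N) (ν.hom N))) ∧
     IsBasisOf (stdCGO N g μ ν μν) (intertwiners (μν.hom N) (tensorRep (μ.hom N) (ν.hom N))) ∧
     IsBasisOf (stdCGO N g ρ μν ρμν)
       (intertwiners (ρμν.hom N) (tensorRep (ρ.hom N) (μν.hom N))) ∧
     IsBasisOf (leftComposite N g ρ μ ν ρμ ρμν)
       (intertwiners (ρμν.hom N) (tensorRep (tensorRep (ρ.hom N) (μ.hom N)) (ν.hom N))) ∧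
     IsBasisOf (rightComposite N g ρ μ ν μν ρμν)
       (intertwiners (ρμν.hom N) (tensorRep (ρ.hom N) (tensorRep (μ.hom N) (ν.hom N))))) ∧
    ∃ ζ : ℂ, ζ ^ N = 1 ∧
      -- the root of unity, for the principal determinations off the cuts
      (g = gPrincipal N →
        OffCuts N (pairArg ρ μ ρμ) → OffCuts N (pairArg ρμ ν ρμν) →
        OffCuts N (pairArg μ ν μν) → OffCuts N (pairArg ρ μν ρμν) →
        OffCuts N (tripleArg μ ρμ μν ρμν) →
        ∀ e₁ e₂ e₃ e₄ f : ZMod N,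
          -(ρ.y / (ρ.a * μ.a * μ.y)) = wpow N e₁ * rPrincipal N (pairArg ρ μ ρμ) →
          -(ρμ.y / (ρμ.a * ν.a * ν.y)) = wpow N e₂ * rPrincipal N (pairArg ρμ ν ρμν) →
          -(μ.y / (μ.a * ν.a * ν.y)) = wpow N e₃ * rPrincipal N (pairArg μ ν μν) →
          -(ρ.y / (ρ.a * μν.a * μν.y)) = wpow N e₄ * rPrincipal N (pairArg ρ μν ρμν) →
          -(ρ.y * ν.y / (ρμν.y * μ.y)) =
            wpow N f * rPrincipal N (tripleArg μ ρμ μν ρμν) →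
          ζ = wpow N (half N ^ 3 + (e₁ - f) * (e₂ - e₃) - half N * (e₄ - e₃ - f) ^ 2)) ∧
      -- the matrix of the 6j-symbol
      (∀ R : Matrix (ZMod N × ZMod N) (ZMod N × ZMod N) ℂ,
        IsSixJ N g ρ μ ν ρμ μν ρμν R ↔
          R = sixJ N (ζ * hFun N g (tripleArg μ ρμ μν ρμν)) ρ μ ν ρμ μν ρμν) ∧
      -- the matrix of its inverse
      (∀ R Rbar : Matrix (ZMod N × ZMod N) (ZMod N × ZMod N) ℂ,
        IsSixJ N g ρ μ ν ρμ μν ρμν R →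
          (R * Rbar = 1 ∧ Rbar * R = 1 ↔
            Rbar = sixJBar N (ζ * hFun N g (tripleArg μ ρμ μν ρμν)) ρ μ ν ρμ μν ρμν)) ∧
      -- the 6j-symbol is a cyclic representation of the twisted dilogarithm operator
      (∃ (T : RomegaRep N) (p q pq : StdRep), IsProduct N p q pq ∧ T.IsNormal p q pq ∧
        T.norm = ζ * hFun N g (pairArg p q pq) ∧
        IsSixJ N g ρ μ ν ρμ μν ρμν T.image) := by
  have hρ := hρμ.assoc hμν hρμν
  refine ⟨⟨isBasisOf_stdCGO hN hN1 hg hρμ, isBasisOf_stdCGO hN hN1 hg hρμν,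
    isBasisOf_stdCGO hN hN1 hg hμν, isBasisOf_stdCGO hN hN1 hg hρ,
    isBasisOf_leftComposite hN hN1 hg hρμ hρμν, isBasisOf_rightComposite hN hN1 hg hμν hρ⟩, ?_⟩
  have d := fiveData_of_isProduct hN hρμ hμν hρμν
  have hT := tripleArg_pow_add hN hρμ hμν hρμν
  have hT0 := tripleArg_ne_zero μ ρμ μν ρμν
  have hS0 := tripleS_ne_zero ρ μ ν ρμν
  have n1 := hFun_pairArg_ne_zero hN hg hρμ
  have n2 := hFun_pairArg_ne_zero hN hg hρμν
  have n3 := hFun_pairArg_ne_zero hN hg hμν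
  have n4 := hFun_pairArg_ne_zero hN hg hρ
  have n5 := hFun_ne_zero hN hg hT0 (pow_ne_one_of_add hS0 hT)
  have hpow := d.fiveSum_pow hN hg
  rw [pairArg_mul_div hρμ.1, pairArg_div_pairArg hρμ.1] at hpow
  change (tripleConst N ρ μ ν ρμ μν ρμν * _) ^ N = _ at hpow
  have hL := pow_ne_zero N (mul_ne_zero n1 n2)
  have hR : tripleConst N ρ μ ν ρμ μν ρμν * (hFun N g (tripleArg μ ρμ μν ρμν) *
      hFun N g (pairArg μ ν μν) * hFun N g (pairArg ρ μν ρμν)) ≠ 0 := by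
    intro h0
    rw [h0, zero_pow (NeZero.ne N)] at hpow
    exact hL hpow.symm
  -- The factor by which the five-term constant fails to be the quotient of the values of `h`;
  -- `hpow` makes it an `N`-th root of unity.
  set ζ := hFun N g (pairArg ρ μ ρμ) * hFun N g (pairArg ρμ ν ρμν) /
    (tripleConst N ρ μ ν ρμ μν ρμν * (hFun N g (tripleArg μ ρμ μν ρμν) *
      hFun N g (pairArg μ ν μν) * hFun N g (pairArg ρ μν ρμν))) with hζ
  have hζN : ζ ^ N = 1 := by rw [hζ, div_pow, hpow, div_self hL]
  have hζ0 : ζ ≠ 0 := fun h => by simp [h, NeZero.ne N] at hζN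
  have hc0 := mul_ne_zero hζ0 n5
  have hsix := isSixJ_cycMat hN hρμ hμν hρμν g
    (c := ζ * hFun N g (tripleArg μ ρμ μν ρμν)) (by
      rw [hζ, div_mul_eq_mul_div, div_mul_eq_mul_div, div_eq_iff hR]; ring)
  have hinv := cycMat_mul_cycMatBar hN hN1 hc0 hT0 hS0 hT
  refine ⟨ζ, hζN, ?_, ?_, ?_, ?_⟩
  · rintro rfl o1 o2 o3 - - e₁ e₂ e₃ e₄ f h1 h2 h3 h4 h5
    have key := wpow_eq_of_gPrincipal hN d o1 o2 o3 (e₁ := e₁) (e₂ := e₂) (e₃ := e₃) (e₄ := e₄) (f := f) h1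
      (by rw [pairArg_mul_pairS hρμ.1]; exact h2) h3
      (by rw [pairArg_div_pairArg hρμ.1, pairS_mul_div hμν.1]; exact h4)
      (by rw [pairArg_mul_div hρμ.1, pairS_div_pairArg hρμ.1]; exact h5)
    rw [pairArg_mul_div hρμ.1, pairArg_div_pairArg hρμ.1] at key
    rw [hζ, ← key]
    exact mul_div_cancel_right₀ _ hR
  · intro R
    rw [sixJ_eq_cycMat]
    exact ⟨fun h => h.unique hN hN1 hg hμν hρ hsix, fun h => h ▸ hsix⟩
  · intro R Rbar h
    rw [h.unique hN hN1 hg hμν hρ hsix, sixJBar_eq_cycMatBar]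
    constructor
    · rintro ⟨-, h2⟩
      exact left_inv_eq_right_inv h2 hinv
    · rintro rfl
      exact ⟨hinv, mul_eq_one_comm.mp hinv⟩
  -- With all `a` equal to `1`, the choice `y_π = -s` makes `D` act as `s Y⁻¹`, and `y_{ππ*} = t`
  -- gives `b = t`; the product condition is then the Fermat equation of the triple.
  · refine ⟨dilogRep hN hS0 hT hc0, ⟨1, -tripleS ρ μ ν ρμν, one_ne_zero, neg_ne_zero.mpr hS0⟩,
      ⟨1, 1, one_ne_zero, one_ne_zero⟩, ⟨1, tripleArg μ ρμ μν ρμν, one_ne_zero, hT0⟩,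
      ⟨by simp, ?_⟩, ⟨rfl, rfl, ?_, ?_, ?_⟩, ?_, ?_⟩
    · simp only [one_pow, hN.neg_pow, div_one, one_mul]
      linear_combination hT
    · simp [dilogRep]
    · simp [dilogRep]
    · simp [dilogRep, pairArg]
    · simp [dilogRep, pairArg]
    · rw [dilogRep_image]
      exact hsix
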